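/- Let $V$ be a vertex algebra over $\mathbb C$ of countable dimension which is simple (nonzero, without ideals other than $0$ and $V$), let $G$ be a finite group of automorphisms of $V$, let $V^G$ be the vertex subalgebra of fixed points, and let $\sigma$ be an element of the center of $G$, of order $T$. Put $V^r=\{v\in V\mid \sigma v=e^{-2\pi i r/T}v\}$. A $\sigma$-twisted $V$-module $M$ is a vector space with a linear map $v\mapsto Y_M(v,z)=\sum_{n\in\frac1T\mathbb Z}v_nz^{-n-1}$, $v_n\in\mathrm{End}\,M$, such that $Y_M(\mathbf 1,z)=\mathrm{id}_M$ and, for $0\le r\le T-1$, $u\in V^r$, $v\in V$, $w\in M$: $u_n=0$ unless $n\in\frac rT+\mathbb Z$; $u_nw=0$ for $n\gg0$; and $$z_0^{-1}\delta\Big(\tfrac{z_1-z_2}{z_0}\Big)Y_M(u,z_1)Y_M(v,z_2)-z_0^{-1}\delta\Big(\tfrac{z_2-z_1}{-z_0}\Big)Y_M(v,z_2)Y_M(u,z_1)=z_2^{-1}\Big(\tfrac{z_1-z_0}{z_2}\Big)^{-r/T}\delta\Big(\tfrac{z_1-z_0}{z_2}\Big)Y_M(Y(u,z_0)v,z_2).$$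 A module for a vertex algebra is a twisted module for its identity automorphism. For $g\in G$, $M\cdot g$ is the space $M$ with $Y_{M\cdot g}(v,z)=Y_M(gv,z)$. Let $\mathcal S$ be a finite set of pairwise inequivalent irreducible $\sigma$-twisted $V$-modules which is $G$-stable: for $M\in\mathcal S$ and $g\in G$ there is $N\in\mathcal S$ with $N\cong M\cdot g$. Then for $N\in\mathcal S$ and $g\in G$ there are linear isomorphisms $\phi_N(g):N\to M$, where $M\in\mathcal S$ is the module with $N\cong M\cdot g$, such that $\phi_N(g)Y_N(u,z)=Y_M(gu,z)\phi_N(g)$ for $u\in V$, and $\phi_N(1)=\mathrm{id}_N$. For any choice of these there are scalars $\alpha_N(g,h)\in\mathbb C^*$ such that $\phi_M(g)\phi_N(h)=\alpha_N(g,h)\phi_N(gh)$, where $\phi_N(h):N\to M$. Let $\mathcal A=\mathcal A_\alpha(G,\mathcal S)$ be the associative algebra with basis $g\otimes e(M)$ ($g\in G$, $M\in\mathcal S$), product $$(g\otimes e(M))(h\otimes e(N))=\begin{cases}\alpha_N(g,h)\,gh\otimes e(N)&\text{if }N\cong M\cdot h,\\0&\text{otherwise,}\end{cases}$$ and identity $\sum_{M\in\mathcal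 S} 1\otimes e(M)$. It acts on $\mathcal M=\bigoplus_{M\in\mathcal S}M$ by $(g\otimes e(M))w=\delta_{M,N}\phi_N(g)w$ for $w\in N$. This action commutes with that of $V^G$. For $M\in\mathcal S$ let $G_M=\{g\in G\mid M\cdot g\cong M\}$ and let $\mathbb C^{\alpha_M}[G_M]$ be the twisted group algebra with basis $\bar g$, $g\in G_M$, and $\bar g\bar h=\alpha_M(g,h)\overline{gh}$; it acts on $M$ by $\bar g\mapsto\phi_M(g)$. Let $S(M)\subseteq D(M)$ be the spans in $\mathcal A$ of the elements $g\otimes e(M)$ with $g\in G_M$ and with $g\in G$, respectively; $S(M)$ is identified with $\mathbb C^{\alpha_M}[G_M]$ by $g\otimes e(M)\leftrightarrow\bar g$. Let $M^j$ ($j\in J$) be representatives of the $G$-orbits in $\mathcal S$. For $j\in J$ let $\Lambda_j$ be the set of irreducible characters (equivalently, of isomorphism classes of simple modules) of $\mathbb C^{\alpha_{M^j}}[G_{M^j}]$. For $\lambda\in\Lambda_j$ let $W_{j,\lambda}$ be the corresponding simple module, let $W^j_\lambda=D(M^j)\otimes_{S(M^j)}W_{j,\lambda}$, an $\mathcal A$-module,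 and let $M^j_\lambda=\mathrm{Hom}_{\mathbb C^{\alpha_{M^j}}[G_{M^j}]}(W_{j,\lambda},M^j)$ be the multiplicity space, a $V^G$-module by $v_nf=v_n\circ f$. Then the $W^j_\lambda$ ($j\in J$, $\lambda\in\Lambda_j$) are simple and pairwise non-isomorphic $\mathcal A$-modules, and every simple $\mathcal A$-module is isomorphic to one of them; there is an isomorphism of $\mathcal A\otimes V^G$-modules $$\mathcal M\cong\bigoplus_{j\in J,\ \lambda\in\Lambda_j}W^j_\lambda\otimes M^j_\lambda ;$$ and $(\mathcal A,V^G)$ is a dual pair on $\mathcal M$, that is, $\mathcal A$ is finite-dimensional and semisimple, its action commutes with that of $V^G$, and the multiplicity spaces $\mathrm{Hom}_{\mathcal A}(W,\mathcal M)$ of the simple $\mathcal A$-modules $W$ are irreducible $V^G$-modules, which are isomorphic for $W$ and $W'$ if and only if $W\cong W'$. Moreover: (1) $M^j_\lambda\ne0$ for all $j\in J$ and $\lambda\in\Lambda_j$; (2) each $M^j_\lambda$ is an irreducible $V^G$-module; (3) $M^{j_1}_{\lambda_1}$ and $M^{j_2}_{\lambda_2}$ are isomorphic $V^G$-modules if and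 only if $j_1=j_2$ and $\lambda_1=\lambda_2$. In particular, every irreducible $\sigma$-twisted $V$-module is a direct sum of finitely many irreducible $V^G$-modules. -/

import Mathlib

universe u v w

noncomputable section

open scoped TensorProduct

/-- A vertex algebra over `ℂ`: the vertex operators `Y(v, z) = ∑ v_n z^{-n-1}` are linear maps into
Laurent series (so that `u_n v = 0` for `n` large), and the Jacobi identity is written as the
equality of the coefficients of `z₀^{-l-1} z₁^{-m-1} z₂^{-n-1}`, applied to a vector `w`.  All the
sums have only finitely many nonzero terms. -/
class VertexAlgebra (V : Type u) [AddCommGroup V] [Module ℂ V] where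
  /-- the state-field correspondence -/
  Y : V →ₗ[ℂ] VertexOperator ℂ V
  /-- the vacuum vector -/
  vac : V
  vacuum : ∀ (n : ℤ), VertexOperator.ncoeff (Y vac) n = if n = -1 then 1 else 0
  creation : ∀ (v : V) (n : ℤ), 0 ≤ n → VertexOperator.ncoeff (Y v) n vac = 0
  creation_limit : ∀ (v : V), VertexOperator.ncoeff (Y v) (-1) vac = v
  jacobi : ∀ (u v w : V) (l m n : ℤ),
    (∑ᶠ i : ℕ, ((-1 : ℂ) ^ i * (Ring.choose l i : ℤ)) •
        VertexOperator.ncoeff (Y u) (m + l - i) (VertexOperator.ncoeff (Y v) (n + i) w)) -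
      (∑ᶠ i : ℕ, ((-1 : ℂ) ^ (l + i) * (Ring.choose l i : ℤ)) •
        VertexOperator.ncoeff (Y v) (n + l - i) (VertexOperator.ncoeff (Y u) (m + i) w)) =
    ∑ᶠ i : ℕ, ((Ring.choose m i : ℤ) : ℂ) •
        VertexOperator.ncoeff (Y (VertexOperator.ncoeff (Y u) (l + i) v)) (m + n - i) w

theorem coe_finsum_submodule {M : Type u} [AddCommGroup M] [Module ℂ M] {N : Submodule ℂ M}
    (f : ℕ → N) : ((∑ᶠ i, f i : N) : M) = ∑ᶠ i, (f i : M) :=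
  AddMonoidHom.map_finsum_of_injective N.subtype.toAddMonoidHom Subtype.val_injective f

namespace VertexAlgebra

section Basic

variable {V : Type u} [AddCommGroup V] [Module ℂ V] [VertexAlgebra V]

/-- The mode `u_n`, i.e. the coefficient of `z^{-n-1}` in `Y(u, z)`. -/
def mode (u : V) (n : ℤ) : Module.End ℂ V := VertexOperator.ncoeff (Y u) n

variable (V) in
/-- A vertex algebra is simple if it is nonzero and has no ideals besides `0` and itself. -/
def IsSimple : Prop :=
  Nontrivial V ∧ ∀ I : Submodule ℂ V,
    (∀ (u v : V) (n : ℤ), v ∈ I → mode u n v ∈ I ∧ mode v n u ∈ I) → I = ⊥ ∨ I = ⊤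

theorem mode_add (u u' : V) (n : ℤ) : mode (u + u') n = mode u n + mode u' n := by
  simp [mode]

theorem mode_smul (c : ℂ) (u : V) (n : ℤ) : mode (c • u) n = c • mode u n := by
  simp [mode]

theorem mode_trunc (u v : V) : ∃ N : ℤ, ∀ n, N ≤ n → mode u n v = 0 := by
  refine ⟨-(HahnSeries.order ((HahnModule.of ℂ).symm (Y u v))), fun n hn => ?_⟩
  exact VertexOperator.ncoeff_eq_zero_of_lt_order _ _ _ (by omega)

variable (V) in
/-- The automorphism group of a vertex algebra. -/
def autSubgroup : Subgroup (V ≃ₗ[ℂ] V) where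
  carrier := {g | g vac = vac ∧ ∀ (u v : V) (n : ℤ), g (mode u n v) = mode (g u) n (g v)}
  mul_mem' := by
    rintro a b ⟨ha, ha'⟩ ⟨hb, hb'⟩
    refine ⟨?_, fun u v n => ?_⟩
    · simp [LinearEquiv.mul_apply, ha, hb]
    · simp [LinearEquiv.mul_apply, ha', hb']
  one_mem' := ⟨rfl, fun _ _ _ => rfl⟩
  inv_mem' := by
    rintro a ⟨ha, ha'⟩
    refine ⟨?_, fun u v n => ?_⟩
    · change a.symm vac = vac
      rw [LinearEquiv.symm_apply_eq, ha]
    · change a.symm _ = mode (a.symm u) n (a.symm v)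
      rw [LinearEquiv.symm_apply_eq, ha']
      simp

variable (V) in
/-- The group of automorphisms of a vertex algebra. -/
abbrev Aut : Type u := ↥(autSubgroup V)

theorem aut_mode (g : Aut V) (u v : V) (n : ℤ) : g • mode u n v = mode (g • u) n (g • v) :=
  g.2.2 u v n

theorem aut_vac (g : Aut V) : g • (vac : V) = vac := g.2.1

/-- The fixed points `V^G`. -/
def fixed (G : Subgroup (Aut V)) : Submodule ℂ V where
  carrier := {v | ∀ g ∈ G, g • v = v}
  add_mem' := by
    intro a b ha hb g hg
    rw [smul_add, ha g hg, hb g hg]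
  zero_mem' := fun g _ => smul_zero g
  smul_mem' := by
    intro c a ha g hg
    have h : g • (c • a) = c • (g • a) := (g : V ≃ₗ[ℂ] V).map_smul c a
    rw [h, ha g hg]

theorem mode_mem_fixed {G : Subgroup (Aut V)} {u v : V} (hu : u ∈ fixed G) (hv : v ∈ fixed G)
    (n : ℤ) : mode u n v ∈ fixed G := by
  intro g hg
  rw [aut_mode, hu g hg, hv g hg]

/-- The vertex operator of `u ∈ V^G` on `V^G` is the restriction of that on `V`. -/
def fixedOp (G : Subgroup (Aut V)) (u : fixed G) : VertexOperator ℂ (fixed G) :=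
  VertexOperator.of_coeff
    (fun n => (mode (u : V) (-n - 1)).restrict (fun _ hv => mode_mem_fixed u.2 hv _)) (by
      intro x
      obtain ⟨N, hN⟩ := mode_trunc (u : V) (x : V)
      refine ⟨-N - 1, fun n hn => ?_⟩
      by_contra hlt
      apply hn
      apply Subtype.ext
      exact hN _ (by omega))

theorem fixedOp_coe (G : Subgroup (Aut V)) (u v : fixed G) (n : ℤ) :
    ((VertexOperator.ncoeff (fixedOp G u) n v : fixed G) : V) = mode (u : V) n (v : V) := by
  have h : -(-n - 1) - 1 = n := by ring
  rw [fixedOp, VertexOperator.ncoeff_of_coeff, LinearMap.coe_restrict_apply, h]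

theorem fixedOp_ext {G : Subgroup (Aut V)} {A B : VertexOperator ℂ (fixed G)}
    (h : ∀ n v, VertexOperator.ncoeff A n v = VertexOperator.ncoeff B n v) : A = B := by
  apply HVertexOperator.coeff_inj
  funext n
  rw [VertexOperator.coeff_eq_ncoeff, VertexOperator.coeff_eq_ncoeff]
  exact LinearMap.ext (h _)

/-- The vertex operators of `V^G`, as a linear map. -/
def fixedY (G : Subgroup (Aut V)) : fixed G →ₗ[ℂ] VertexOperator ℂ (fixed G) where
  toFun := fixedOp G
  map_add' a b := by
    refine fixedOp_ext fun n v => Subtype.ext ?_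
    rw [map_add]
    simp only [Pi.add_apply, LinearMap.add_apply, Submodule.coe_add, fixedOp_coe, mode_add]
  map_smul' c a := by
    refine fixedOp_ext fun n v => Subtype.ext ?_
    rw [map_smul]
    simp only [Pi.smul_apply, LinearMap.smul_apply, Submodule.coe_smul, fixedOp_coe, mode_smul,
      RingHom.id_apply]

theorem fixedY_coe (G : Subgroup (Aut V)) (u v : fixed G) (n : ℤ) :
    ((VertexOperator.ncoeff (fixedY G u) n v : fixed G) : V) = mode (u : V) n (v : V) :=
  fixedOp_coe G u v n

/-- `V^G` is a vertex algebra. -/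
instance fixedVertexAlgebra (G : Subgroup (Aut V)) : VertexAlgebra (fixed G) where
  Y := fixedY G
  vac := ⟨vac, fun g _ => aut_vac g⟩
  vacuum n := by
    ext x
    rw [fixedY_coe]
    change VertexOperator.ncoeff (Y vac) n (x : V) = _
    rw [vacuum]
    split_ifs <;> rfl
  creation v n hn := by
    apply Subtype.ext
    rw [fixedY_coe]
    exact creation (v : V) n hn
  creation_limit v := by
    apply Subtype.ext
    rw [fixedY_coe]
    exact creation_limit (v : V)
  jacobi a b c l m n := by
    apply Subtype.ext
    rw [Submodule.coe_sub, coe_finsum_submodule, coe_finsum_submodule, coe_finsum_submodule]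
    simp only [Submodule.coe_smul, fixedY_coe]
    exact jacobi (a : V) b c l m n

end Basic

/-- For an automorphism `g` of order `T`, the eigenspace
`V^r = {v | g v = e^{-2πir/T} v}`. -/
def eigen {V : Type u} [AddCommGroup V] [Module ℂ V] [VertexAlgebra V] (g : Aut V) (r : ℕ) :
    Submodule ℂ V where
  carrier := {v | g • v =
    Complex.exp (-2 * Real.pi * Complex.I * (r : ℂ) / (orderOf g : ℂ)) • v}
  add_mem' := by
    intro a b ha hb
    simp only [Set.mem_ofPred_eq] at *
    rw [smul_add, smul_add, ha, hb]
  zero_mem' := by simp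
  smul_mem' := by
    intro c a ha
    have h : g • (c • a) = c • (g • a) := (g : V ≃ₗ[ℂ] V).map_smul c a
    simp only [Set.mem_ofPred_eq] at *
    rw [h, ha, smul_comm]

theorem mode_trunc_nat {V : Type u} [AddCommGroup V] [Module ℂ V] [VertexAlgebra V] (u v : V)
    (n : ℤ) : ∃ K : ℕ, ∀ i : ℕ, K ≤ i → mode u (n + i) v = 0 := by
  obtain ⟨N, hN⟩ := mode_trunc u v
  exact ⟨(N - n).toNat, fun i hi => hN _ (by omega)⟩

theorem fixed_coe_mode {V : Type u} [AddCommGroup V] [Module ℂ V] [VertexAlgebra V]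
    {G : Subgroup (Aut V)} (u v : fixed G) (n : ℤ) :
    ((mode u n v : fixed G) : V) = mode (u : V) n (v : V) :=
  fixedY_coe G u v n

theorem smul_mem_eigen {V : Type u} [AddCommGroup V] [Module ℂ V] [VertexAlgebra V]
    {g h : Aut V} (hg : g * h = h * g) {r : ℕ} {u : V} (hu : u ∈ eigen g r) :
    h • u ∈ eigen g r := by
  have hu' : g • u = _ := hu
  change g • h • u = _
  rw [smul_smul, hg, ← smul_smul, hu']
  exact (h : V ≃ₗ[ℂ] V).map_smul _ u

theorem fixed_mem_eigen {V : Type u} [AddCommGroup V] [Module ℂ V] [VertexAlgebra V]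
    {g : Aut V} {G : Subgroup (Aut V)} (hg : g ∈ G) {u : V} (hu : u ∈ fixed G) :
    u ∈ eigen g 0 := by
  change g • u = _
  simp [hu g hg]

/-- A `g`-twisted module `M` for the vertex algebra `V`, where `g` has finite order `T`.  The
operators `v_n` of `Y_M(v, z) = ∑ v_n z^{-n-1}` are indexed by `n ∈ ℚ`; for `u ∈ V^r` only those
with `n ∈ r/T + ℤ` may be nonzero.  The twisted Jacobi identity is written as the equality of the
coefficients of `z₀^{-l-1} z₁^{-m-1} z₂^{-n-1}`, applied to `w`, where `l ∈ ℤ` and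
`m ∈ r/T + ℤ`.  All the sums have only finitely many nonzero terms. -/
structure TwistedModule {V : Type u} [AddCommGroup V] [Module ℂ V] [VertexAlgebra V] (g : Aut V)
    (M : Type v) [AddCommGroup M] [Module ℂ M] where
  /-- `Y v n` is the operator `v_n` -/
  Y : V →ₗ[ℂ] (ℚ → Module.End ℂ M)
  support : ∀ r : ℕ, r < orderOf g → ∀ u ∈ eigen g r, ∀ n : ℚ,
    (¬ ∃ k : ℤ, n = (r : ℚ) / (orderOf g : ℚ) + k) → Y u n = 0
  trunc : ∀ (u : V) (w : M), ∃ N : ℚ, ∀ n, N ≤ n → Y u n w = 0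
  vacuum : ∀ n : ℚ, Y vac n = if n = -1 then 1 else 0
  jacobi : ∀ r : ℕ, r < orderOf g → ∀ u ∈ eigen g r, ∀ (v : V) (w : M) (l : ℤ) (m n : ℚ),
    (∃ k : ℤ, m = (r : ℚ) / (orderOf g : ℚ) + k) →
    (∑ᶠ i : ℕ, ((-1 : ℂ) ^ i * (Ring.choose l i : ℤ)) • Y u (m + l - i) (Y v (n + i) w)) -
      (∑ᶠ i : ℕ, ((-1 : ℂ) ^ (l + i) * (Ring.choose l i : ℤ)) •
        Y v (n + l - i) (Y u (m + i) w)) =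
    ∑ᶠ i : ℕ, ((Ring.choose m i : ℚ) : ℂ) • Y (mode u (l + i) v) (m + n - i) w

namespace TwistedModule

section Basic

variable {V : Type u} [AddCommGroup V] [Module ℂ V] [VertexAlgebra V] {g : Aut V}
  {M : Type v} [AddCommGroup M] [Module ℂ M] {M' : Type w} [AddCommGroup M'] [Module ℂ M']

/-- Isomorphism of `g`-twisted modules. -/
def Iso (X : TwistedModule g M) (X' : TwistedModule g M') : Prop :=
  ∃ f : M ≃ₗ[ℂ] M', ∀ (u : V) (n : ℚ) (w : M), f (X.Y u n w) = X'.Y u n (f w)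

/-- A subspace is a submodule if it is stable under all modes. -/
def IsInvariant (X : TwistedModule g M) (N : Submodule ℂ M) : Prop :=
  ∀ (u : V) (n : ℚ), ∀ w ∈ N, X.Y u n w ∈ N

/-- A twisted module is irreducible if it is nonzero and has no submodules besides `0` and
itself. -/
def IsIrreducible (X : TwistedModule g M) : Prop :=
  Nontrivial M ∧ ∀ N : Submodule ℂ M, X.IsInvariant N → N = ⊥ ∨ N = ⊤

/-- For `h` commuting with `g`, the twisted module `M ∘ h` with the same underlying space and
`Y_{M ∘ h}(v, z) = Y_M(h v, z)`. -/
def conj (X : TwistedModule g M) (h : Aut V) (hg : g * h = h * g) : TwistedModule g M where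
  Y := X.Y ∘ₗ ((h : V ≃ₗ[ℂ] V) : V →ₗ[ℂ] V)
  support r hr u hu n hn := X.support r hr _ (smul_mem_eigen hg hu) n hn
  trunc u x := X.trunc _ x
  vacuum n := by
    have e : (h : V ≃ₗ[ℂ] V) vac = vac := aut_vac h
    simpa [e] using X.vacuum n
  jacobi r hr u hu v x l m n hm := by
    have key := X.jacobi r hr _ (smul_mem_eigen hg hu) (h • v) x l m n hm
    simp only [← aut_mode] at key
    exact key

/-- A `σ`-twisted `V`-module with `σ ∈ G` is, by restriction, an (untwisted) `V^G`-module. -/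
def restrict (X : TwistedModule g M) (G : Subgroup (Aut V)) (hg : g ∈ G)
    (hfin : 0 < orderOf g) : TwistedModule (1 : Aut (fixed G)) M where
  Y := X.Y ∘ₗ (fixed G).subtype
  support r hr u hu n hn := by
    obtain rfl : r = 0 := by simpa using hr
    refine X.support 0 hfin _ (fixed_mem_eigen hg u.2) n ?_
    simpa using hn
  trunc u x := X.trunc _ x
  vacuum n := X.vacuum n
  jacobi r hr u hu v x l m n hm := by
    obtain rfl : r = 0 := by simpa using hr
    have key := X.jacobi 0 hfin _ (fixed_mem_eigen hg u.2) (v : V) x l m n (by simpa using hm)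
    simp only [← fixed_coe_mode] at key
    exact key

/-- A linear map commutes with the sums in the Jacobi identity. -/
theorem map_finsum_trunc {P : Type*} [AddCommGroup P] [Module ℂ P] (F : P →ₗ[ℂ] M) (f : ℕ → P)
    (hK : ∃ K : ℕ, ∀ i, K ≤ i → f i = 0) : F (∑ᶠ i, f i) = ∑ᶠ i, F (f i) := by
  obtain ⟨K, hK⟩ := hK
  refine F.toAddMonoidHom.map_finsum ((Set.finite_lt_nat K).subset fun i hi => ?_)
  by_contra hlt
  exact hi (hK i (not_lt.mp hlt))

/-- Operators that satisfy the truncation condition, and that are compatible with a jointly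
injective family of linear maps to twisted modules, define a twisted module. -/
def ofJointlyInjective {P : Type*} [AddCommGroup P] [Module ℂ P] {κ : Type*} {N : κ → Type*}
    [∀ k, AddCommGroup (N k)] [∀ k, Module ℂ (N k)] (X : ∀ k, TwistedModule g (N k))
    (T : V →ₗ[ℂ] (ℚ → Module.End ℂ P)) (ev : ∀ k, P →ₗ[ℂ] N k)
    (hev : ∀ k u n p, ev k (T u n p) = (X k).Y u n (ev k p))
    (hinj : ∀ p q, (∀ k, ev k p = ev k q) → p = q)
    (htr : ∀ (u : V) (p : P), ∃ B : ℚ, ∀ n, B ≤ n → T u n p = 0) : TwistedModule g P where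
  Y := T
  support r hr u hu n hn := by
    refine LinearMap.ext fun p => hinj _ _ fun k => ?_
    rw [hev, (X k).support r hr u hu n hn]
    simp
  trunc := htr
  vacuum n := by
    refine LinearMap.ext fun p => hinj _ _ fun k => ?_
    rw [hev, (X k).vacuum]
    split_ifs <;> simp
  jacobi r hr u hu v p l m n hm := by
    have htr' : ∀ (u : V) (p : P) (n : ℚ), ∃ K : ℕ, ∀ i : ℕ, K ≤ i → T u (n + i) p = 0 := by
      intro u p n
      obtain ⟨B, hB⟩ := htr u p
      obtain ⟨K, hK⟩ := exists_nat_ge (B - n)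
      refine ⟨K, fun i hi => hB _ ?_⟩
      have : (K : ℚ) ≤ i := by exact_mod_cast hi
      linarith
    refine hinj _ _ fun k => ?_
    rw [map_sub, map_finsum_trunc, map_finsum_trunc, map_finsum_trunc]
    · simp only [map_smul, hev]
      exact (X k).jacobi r hr u hu v (ev k p) l m n hm
    · obtain ⟨K, hK⟩ := mode_trunc_nat u v l
      exact ⟨K, fun i hi => by simp [hK i hi]⟩
    · obtain ⟨K, hK⟩ := htr' u p m
      exact ⟨K, fun i hi => by simp [hK i hi]⟩
    · obtain ⟨K, hK⟩ := htr' v p n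
      exact ⟨K, fun i hi => by simp [hK i hi]⟩

/-- The twisted module structure on an invariant subspace. -/
def sub (X : TwistedModule g M) (N : Submodule ℂ M) (hN : X.IsInvariant N) :
    TwistedModule g N :=
  ofJointlyInjective (κ := Unit) (fun _ => X)
    { toFun := fun u n => (X.Y u n).restrict (hN u n)
      map_add' := by intros; ext; simp
      map_smul' := by intros; ext; simp }
    (fun _ => N.subtype) (fun _ _ _ _ => rfl) (fun _ _ h => Subtype.ext (h ())) (by
      intro u x
      obtain ⟨K, hK⟩ := X.trunc u x
      exact ⟨K, fun n hn => Subtype.ext (by simpa using hK n hn)⟩)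

/-- The modes on the multiplicity space: `v_n f = v_n ∘ f`. -/
def multiplicityY (X : TwistedModule g M) {A : Type*} [Ring A] [Algebra ℂ A] [Module A M]
    [IsScalarTower ℂ A M]
    (hA : ∀ (a : A) (u : V) (n : ℚ) (x : M), a • X.Y u n x = X.Y u n (a • x))
    (W : Type*) [AddCommGroup W] [Module A W] :
    V →ₗ[ℂ] (ℚ → Module.End ℂ (W →ₗ[A] M)) where
  toFun u n :=
    { toFun := fun f =>
        { toFun := fun x => X.Y u n (f x)
          map_add' := by intros; simp
          map_smul' := by intros; simp [hA] }
      map_add' := by intros; ext; simp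
      map_smul' := by intros; ext; simp }
  map_add' := by intros; ext; simp
  map_smul' := by intros; ext; simp

/-- The multiplicity space `Hom_A(W, M)` of a finitely generated `A`-module `W` in a module `M`
for `A` and for the vertex algebra with commuting actions, with `v_n f = v_n ∘ f`. -/
def multiplicity (X : TwistedModule g M) {A : Type*} [Ring A] [Algebra ℂ A] [Module A M]
    [IsScalarTower ℂ A M]
    (hA : ∀ (a : A) (u : V) (n : ℚ) (x : M), a • X.Y u n x = X.Y u n (a • x))
    (W : Type*) [AddCommGroup W] [Module A W] [Module.Finite A W] :
    TwistedModule g (W →ₗ[A] M) :=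
  ofJointlyInjective (κ := W) (fun _ => X) (X.multiplicityY hA W)
    (fun x => { toFun := fun f => f x, map_add' := fun _ _ => rfl, map_smul' := fun _ _ => rfl })
    (fun _ _ _ _ => rfl) (fun _ _ h => LinearMap.ext h) (by
      intro u f
      obtain ⟨s, hs⟩ := Module.Finite.fg_top (R := A) (M := W)
      choose N hN using fun x : W => X.trunc u (f x)
      obtain ⟨B, hB⟩ := (s.image N).bddAbove
      refine ⟨B, fun n hn => LinearMap.ext_on hs fun x hx => hN x n (le_trans (hB ?_) hn)⟩
      simpa using ⟨x, hx, rfl⟩)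

/-- The direct sum of finitely many twisted modules (realized on the product). -/
def pi {I : Type*} [Finite I] {N : I → Type*} [∀ i, AddCommGroup (N i)] [∀ i, Module ℂ (N i)]
    (X : ∀ i, TwistedModule g (N i)) : TwistedModule g (∀ i, N i) :=
  ofJointlyInjective X
    { toFun := fun u n => LinearMap.pi fun i => (X i).Y u n ∘ₗ LinearMap.proj i
      map_add' := by intros; funext n; refine LinearMap.ext fun p => funext fun i => ?_; simp
      map_smul' := by intros; funext n; refine LinearMap.ext fun p => funext fun i => ?_; simp }
    (fun i => LinearMap.proj i) (fun _ _ _ _ => rfl) (fun _ _ h => funext h) (by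
      intro u x
      choose B hB using fun i => (X i).trunc u (x i)
      obtain ⟨C, hC⟩ := (Set.finite_range B).bddAbove
      exact ⟨C, fun n hn => funext fun i => hB i n (le_trans (hC ⟨i, rfl⟩) hn)⟩)

end Basic

end TwistedModule
end VertexAlgebra

/-! ### The algebras `𝒜_α(G, 𝒮)` and `ℂ^α[G]` -/

/-- A group `G` acting on a set `I`, together with a normalized 2-cocycle `α` with values in the
functions `I → ℂˣ`. -/
structure ActionCocycle (G : Type u) [Group G] (I : Type v) where
  /-- the action -/
  act : G → I → I
  act_one : ∀ i, act 1 i = i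
  act_mul : ∀ g h i, act (g * h) i = act g (act h i)
  /-- `α j g h` is `α_j(g, h)` -/
  α : I → G → G → ℂˣ
  one_left : ∀ j h, α j 1 h = 1
  one_right : ∀ j g, α j g 1 = 1
  cocycle : ∀ j g h k, α j g (h * k) * α j h k = α (act k j) g h * α j (g * h) k

namespace ActionCocycle

variable {G : Type u} [Group G] {I : Type v}

/-- The vector space with basis `g ⊗ e(i)`, for `g ∈ G` and `i ∈ I`. -/
def Alg (_ : ActionCocycle G I) : Type (max u v) := G × I →₀ ℂ

variable (c : ActionCocycle G I)

instance : AddCommGroup c.Alg := inferInstanceAs (AddCommGroup (G × I →₀ ℂ))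

instance : Module ℂ c.Alg := inferInstanceAs (Module ℂ (G × I →₀ ℂ))

/-- The basis of `c.Alg`. -/
def basis : Module.Basis (G × I) ℂ c.Alg :=
  Module.Basis.ofRepr (LinearEquiv.refl ℂ (G × I →₀ ℂ))

open scoped Classical in
/-- The product of basis vectors,
`(g ⊗ e(i)) (h ⊗ e(j)) = α_j(g, h) gh ⊗ e(j)` if `i = h · j`, and `0` otherwise. -/
def basisMul (p q : G × I) : c.Alg :=
  if p.2 = c.act q.1 q.2 then (c.α q.2 p.1 q.1 : ℂ) • c.basis (p.1 * q.1, q.2) else 0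

/-- The bilinear extension of the product of basis vectors. -/
def mulMap : c.Alg →ₗ[ℂ] c.Alg →ₗ[ℂ] c.Alg :=
  c.basis.constr ℂ fun p => c.basis.constr ℂ fun q => c.basisMul p q

theorem mulMap_basis (p q : G × I) : c.mulMap (c.basis p) (c.basis q) = c.basisMul p q := by
  simp [mulMap]

theorem mulMap_assoc (x y z : c.Alg) :
    c.mulMap (c.mulMap x y) z = c.mulMap x (c.mulMap y z) := by
  let L : c.Alg →ₗ[ℂ] c.Alg →ₗ[ℂ] c.Alg →ₗ[ℂ] c.Alg :=
    c.mulMap.compr₂ c.mulMap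
  let R : c.Alg →ₗ[ℂ] c.Alg →ₗ[ℂ] c.Alg →ₗ[ℂ] c.Alg :=
    LinearMap.mk₂ ℂ (fun x y => c.mulMap x ∘ₗ c.mulMap y)
      (by intros; ext; simp) (by intros; ext; simp) (by intros; ext; simp) (by intros; ext; simp)
  have h : L = R := by
    refine c.basis.ext fun p => c.basis.ext fun q => c.basis.ext fun r => ?_
    change c.mulMap (c.mulMap (c.basis p) (c.basis q)) (c.basis r) =
      c.mulMap (c.basis p) (c.mulMap (c.basis q) (c.basis r))
    rw [mulMap_basis, mulMap_basis]
    obtain ⟨g, i⟩ := p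
    obtain ⟨h, j⟩ := q
    obtain ⟨k, l⟩ := r
    have key := congrArg (Units.val) (c.cocycle l g h k)
    simp only [Units.val_mul] at key
    by_cases h1 : j = c.act k l
    · subst h1
      by_cases h2 : i = c.act h (c.act k l)
      · subst h2
        simp [basisMul, mulMap_basis, c.act_mul, smul_smul, mul_assoc, ← key, mul_comm]
      · simp [basisMul, mulMap_basis, c.act_mul, h2]
    · by_cases h2 : i = c.act h j <;> simp [basisMul, mulMap_basis, h1, h2]
  exact LinearMap.congr_fun (LinearMap.congr_fun (LinearMap.congr_fun h x) y) z

variable [Fintype I]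

/-- The identity element `∑ 1 ⊗ e(i)`. -/
def unit : c.Alg := ∑ i : I, c.basis (1, i)

theorem unit_mulMap (x : c.Alg) : c.mulMap c.unit x = x := by
  have h : c.mulMap c.unit = LinearMap.id := by
    refine c.basis.ext fun p => ?_
    rw [unit, map_sum, LinearMap.sum_apply, Finset.sum_eq_single (c.act p.1 p.2)]
    · simp [mulMap_basis, basisMul, c.one_left]
    · intro i _ hi
      simp [mulMap_basis, basisMul, hi]
    · simp
  exact LinearMap.congr_fun h x

theorem mulMap_unit (x : c.Alg) : c.mulMap x c.unit = x := by
  have h : c.mulMap.flip c.unit = LinearMap.id := by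
    refine c.basis.ext fun p => ?_
    rw [LinearMap.flip_apply, unit, map_sum, Finset.sum_eq_single p.2]
    · simp [mulMap_basis, basisMul, c.one_right, c.act_one]
    · intro i _ hi
      simp [mulMap_basis, basisMul, c.act_one, hi.symm]
    · simp
  exact LinearMap.congr_fun h x

instance : Ring c.Alg :=
  { (inferInstance : AddCommGroup c.Alg) with
    mul := fun x y => c.mulMap x y
    one := c.unit
    left_distrib := fun x y z => map_add (c.mulMap x) y z
    right_distrib := fun x y z => by
      change c.mulMap (x + y) z = c.mulMap x z + c.mulMap y z
      simp
    zero_mul := fun x => by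
      change c.mulMap 0 x = 0
      simp
    mul_zero := fun x => map_zero (c.mulMap x)
    mul_assoc := c.mulMap_assoc
    one_mul := c.unit_mulMap
    mul_one := c.mulMap_unit }

instance : Algebra ℂ c.Alg :=
  Algebra.ofModule
    (fun r x y => by
      change c.mulMap (r • x) y = r • c.mulMap x y
      simp)
    (fun r x y => by
      change c.mulMap x (r • y) = r • c.mulMap x y
      simp)

theorem basis_mul_basis (p q : G × I) : c.basis p * c.basis q = c.basisMul p q :=
  c.mulMap_basis p q

theorem one_eq : (1 : c.Alg) = ∑ i : I, c.basis (1, i) := rfl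

/-- Operators multiplying like the basis vectors give a representation of the algebra. -/
def lift {N : Type*} [AddCommGroup N] [Module ℂ N] (op : G × I → Module.End ℂ N)
    (hone : ∑ i : I, op (1, i) = 1)
    (hmul : ∀ g h j, op (g, c.act h j) * op (h, j) = (c.α j g h : ℂ) • op (g * h, j))
    (hzero : ∀ g h i j, i ≠ c.act h j → op (g, i) * op (h, j) = 0) :
    c.Alg →ₐ[ℂ] Module.End ℂ N :=
  AlgHom.ofLinearMap (c.basis.constr ℂ op) (by rw [one_eq]; simp [hone]) (by
    intro x y
    let F := c.basis.constr ℂ op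
    have h : (LinearMap.mul ℂ c.Alg).compr₂ F =
        (LinearMap.mul ℂ (Module.End ℂ N)).compl₁₂ F F := by
      refine c.basis.ext fun p => c.basis.ext fun q => ?_
      change F (c.basis p * c.basis q) = F (c.basis p) * F (c.basis q)
      rw [basis_mul_basis]
      obtain ⟨g, i⟩ := p
      obtain ⟨h, j⟩ := q
      by_cases h1 : i = c.act h j
      · subst h1
        simp [F, basisMul, hmul]
      · simp [F, basisMul, h1, hzero g h i j h1]
    exact LinearMap.congr_fun (LinearMap.congr_fun h x) y)

end ActionCocycle

/-! ### Isomorphism classes of simple modules -/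

/-- Two maximal left ideals `I`, `I'` are equivalent if the simple modules `A ⧸ I`, `A ⧸ I'` are
isomorphic. -/
def simpleSetoid (A : Type u) [Ring A] : Setoid {I : Submodule A A // IsCoatom I} where
  r I I' := Nonempty ((A ⧸ I.1) ≃ₗ[A] (A ⧸ I'.1))
  iseqv := ⟨fun _ => ⟨LinearEquiv.refl _ _⟩, fun ⟨e⟩ => ⟨e.symm⟩, fun ⟨e⟩ ⟨e'⟩ => ⟨e.trans e'⟩⟩

/-- The set of isomorphism classes of simple `A`-modules (every simple module is a quotient of `A`
by a maximal left ideal); for a finite-dimensional semisimple algebra over `ℂ` it is in bijection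
with the set of irreducible characters. -/
def SimpleClass (A : Type u) [Ring A] : Type u := Quotient (simpleSetoid A)

/-- A simple module `W_λ` in the class `λ`. -/
abbrev SimpleClass.Rep {A : Type u} [Ring A] (cl : SimpleClass A) : Type u :=
  A ⧸ (Quotient.out cl : {I : Submodule A A // IsCoatom I}).1

/-! ### Dual pairs -/

section DualPair

variable {V : Type u} [AddCommGroup V] [Module ℂ V] [VertexAlgebra V]

/-- The actions of `A` and of the vertex algebra `V` on `M` commute. -/
def VertexAlgebra.TwistedModule.Commutes {M : Type v} [AddCommGroup M] [Module ℂ M]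
    {g : VertexAlgebra.Aut V} (X : VertexAlgebra.TwistedModule g M) (A : Type w) [Ring A]
    [Module A M] : Prop :=
  ∀ (a : A) (u : V) (n : ℚ) (x : M), a • X.Y u n x = X.Y u n (a • x)

/-- `(A, V)` is a dual pair on the `V`-module `M`: the algebra `A` is finite-dimensional and
semisimple, its action on `M` commutes with that of `V`, and the multiplicity spaces
`Hom_A(W_λ, M)` of the simple `A`-modules are irreducible and pairwise inequivalent. -/
def IsDualPair (A : Type w) [Ring A] [Algebra ℂ A] {M : Type v} [AddCommGroup M] [Module ℂ M]
    [Module A M] [IsScalarTower ℂ A M]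
    (X : VertexAlgebra.TwistedModule (1 : VertexAlgebra.Aut V) M) : Prop :=
  FiniteDimensional ℂ A ∧ IsSemisimpleRing A ∧
  ∃ hA : X.Commutes A,
    (∀ cl : SimpleClass A, (X.multiplicity hA cl.Rep).IsIrreducible) ∧
    (∀ cl cl' : SimpleClass A,
      (X.multiplicity hA cl.Rep).Iso (X.multiplicity hA cl'.Rep) ↔ cl = cl')

end DualPair

/-! ### Finite stable sets of twisted modules -/

open VertexAlgebra

section Stable

variable {V : Type u} [AddCommGroup V] [Module ℂ V] [VertexAlgebra V]

theorem center_comm {G : Subgroup (Aut V)} (σ : Subgroup.center G) (h : G) :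
    ((σ : G) : Aut V) * (h : Aut V) = (h : Aut V) * ((σ : G) : Aut V) :=
  (congrArg Subtype.val (Subgroup.mem_center_iff.mp σ.2 h)).symm

theorem orderOf_coe_pos {G : Subgroup (Aut V)} [Finite G] (σ : G) : 0 < orderOf (σ : Aut V) := by
  rw [Subgroup.orderOf_coe]
  exact orderOf_pos σ

/-- A family, indexed by `I`, of pairwise inequivalent irreducible `σ`-twisted modules that is
stable under `M ↦ M ∘ h` for `h ∈ G`; here `σ` is a central element of `G`. -/
structure StableFamily (G : Subgroup (Aut V)) (σ : Subgroup.center G) (I : Type w) where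
  M : I → Type v
  [instAddCommGroup : ∀ i, AddCommGroup (M i)]
  [instModule : ∀ i, Module ℂ (M i)]
  X : ∀ i, TwistedModule ((σ : G) : Aut V) (M i)
  irreducible : ∀ i, (X i).IsIrreducible
  inequivalent : ∀ i j, (X i).Iso (X j) → i = j
  stable : ∀ (i : I) (h : G), ∃ j, (X j).Iso ((X i).conj h (center_comm σ h))

attribute [instance] StableFamily.instAddCommGroup StableFamily.instModule

namespace StableFamily

variable {G : Subgroup (Aut V)} {σ : Subgroup.center G} {I : Type w}
  (S : StableFamily.{u, v, w} G σ I)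

/-- The space `ℳ`, the direct sum of the finitely many modules of the family. -/
abbrev Total : Type (max v w) := ∀ i, S.M i

/-- The `V^G`-module `ℳ`. -/
def total [Finite G] [Finite I] : TwistedModule (1 : Aut (fixed G)) S.Total :=
  TwistedModule.pi fun i => (S.X i).restrict G (σ : G).2 (orderOf_coe_pos (σ : G))

/-- The stabilizer `G_M = {g | M ∘ g ≅ M}` of a module of the family. -/
def stab (j : I) : Subgroup G where
  carrier := {g | ((S.X j).conj g (center_comm σ g)).Iso (S.X j)}
  mul_mem' := by
    rintro a b ⟨f, hf⟩ ⟨f', hf'⟩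
    refine ⟨f.trans f', fun u n x => ?_⟩
    have h1 : f ((S.X j).Y (a • b • u) n x) = (S.X j).Y (b • u) n (f x) := hf (b • u) n x
    have h2 : f' ((S.X j).Y (b • u) n (f x)) = (S.X j).Y u n (f' (f x)) := hf' u n (f x)
    rw [LinearEquiv.trans_apply, LinearEquiv.trans_apply, ← h2, ← h1]
    rfl
  one_mem' := ⟨LinearEquiv.refl ℂ _, fun _ _ _ => rfl⟩
  inv_mem' := by
    rintro a ⟨f, hf⟩
    refine ⟨f.symm, fun u n x => ?_⟩
    have h1 : f ((S.X j).Y (a • a⁻¹ • u) n (f.symm x)) = (S.X j).Y (a⁻¹ • u) n (f (f.symm x)) :=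
      hf (a⁻¹ • u) n (f.symm x)
    rw [smul_inv_smul, LinearEquiv.apply_symm_apply] at h1
    change f.symm ((S.X j).Y (a⁻¹ • u) n x) = _
    rw [LinearEquiv.symm_apply_eq]
    exact h1.symm

open scoped Classical in
/-- The inclusion of a summand into the direct sum. -/
def incl (i : I) : S.M i →ₗ[ℂ] S.Total := LinearMap.single ℂ S.M i

/-- The projection of the direct sum onto a summand. -/
def proj (i : I) : S.Total →ₗ[ℂ] S.M i := LinearMap.proj i

theorem proj_incl (i : I) (x : S.M i) : S.proj i (S.incl i x) = x := by
  simp [proj, incl]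

theorem proj_incl_ne {i j : I} (h : i ≠ j) (x : S.M i) : S.proj j (S.incl i x) = 0 := by
  simp [proj, incl, h]

theorem sum_incl_proj [Fintype I] (x : S.Total) : ∑ i, S.incl i (S.proj i x) = x := by
  classical
  simp only [proj, incl, LinearMap.proj_apply, LinearMap.single_apply]
  exact Finset.univ_sum_single x

/-- A choice, for all `g ∈ G` and all modules `N = M_i` of the family, of a linear isomorphism
`φ_N(g) : N → M`, where `M = M_{tgt g i}` is the module of the family with `N ≅ M ∘ g`, such that
`φ_N(g) Y_N(u, z) = Y_M(g u, z) φ_N(g)`, and such that `φ_N(1)` is the identity of `N` (written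
as an equality in the direct sum). -/
structure Transport where
  tgt : G → I → I
  φ : ∀ (g : G) (i : I), S.M i ≃ₗ[ℂ] S.M (tgt g i)
  intertwine : ∀ (g : G) (i : I) (u : V) (n : ℚ) (x : S.M i),
    φ g i ((S.X i).Y u n x) = (S.X (tgt g i)).Y (g • u) n (φ g i x)
  φ_one : ∀ (i : I) (x : S.M i), S.incl (tgt 1 i) (φ 1 i x) = S.incl i x

variable {S}

theorem incl_eq_smul {i j : I} {x : S.M i} {y : S.M j} {a : ℂ} (hx : x ≠ 0)
    (h : S.incl i x = a • S.incl j y) : i = j := by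
  by_contra hij
  have h1 := congrArg (S.proj i) h
  rw [map_smul, proj_incl, proj_incl_ne S (Ne.symm hij), smul_zero] at h1
  exact hx h1

theorem exists_ne (S : StableFamily.{u, v, w} G σ I) (i : I) : ∃ x : S.M i, x ≠ 0 := by
  have := (S.irreducible i).1
  exact _root_.exists_ne 0

namespace Transport

variable (φ : S.Transport)

/-- The operator `w ↦ δ_{M,N} φ_N(g) w`, for `w ∈ N`, on the direct sum, where `M = M_i` for the
pair `p = (g, i)`. -/
def op (p : G × I) : Module.End ℂ S.Total :=
  S.incl (φ.tgt p.1 p.2) ∘ₗ (φ.φ p.1 p.2 : S.M p.2 →ₗ[ℂ] S.M (φ.tgt p.1 p.2)) ∘ₗ S.proj p.2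

theorem op_apply (g : G) (i : I) (x : S.Total) :
    φ.op (g, i) x = S.incl (φ.tgt g i) (φ.φ g i (S.proj i x)) := rfl

/-- The scalars `α_N(g, h)` with `φ_M(g) φ_N(h) = α_N(g, h) φ_N(gh)`, where `φ_N(h) : N → M`
(written as an equality in the direct sum). -/
structure Scalars where
  α : I → G → G → ℂˣ
  rel : ∀ (g h : G) (j : I) (x : S.M j),
    S.incl (φ.tgt g (φ.tgt h j)) (φ.φ g (φ.tgt h j) (φ.φ h j x)) =
      (α j g h : ℂ) • S.incl (φ.tgt (g * h) j) (φ.φ (g * h) j x)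

variable {φ}

namespace Scalars

variable (s : φ.Scalars)

theorem ne_zero {g : G} {j : I} {x : S.M j} (hx : x ≠ 0) : φ.φ g j x ≠ 0 :=
  (LinearEquiv.map_ne_zero_iff _).mpr hx

theorem incl_inj {i : I} {x y : S.M i} (h : S.incl i x = S.incl i y) : x = y := by
  have := congrArg (S.proj i) h
  rwa [proj_incl, proj_incl] at this

theorem incl_ne {i : I} {x : S.M i} (hx : x ≠ 0) : S.incl i x ≠ 0 := fun h =>
  hx (incl_inj (h.trans (map_zero _).symm))

theorem tgt_one (φ : S.Transport) (i : I) : φ.tgt 1 i = i := by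
  obtain ⟨x, hx⟩ := S.exists_ne i
  exact incl_eq_smul (a := 1) (ne_zero hx) ((φ.φ_one i x).trans (one_smul ℂ _).symm)

theorem tgt_mul (s : φ.Scalars) (g h : G) (i : I) : φ.tgt (g * h) i = φ.tgt g (φ.tgt h i) := by
  obtain ⟨x, hx⟩ := S.exists_ne i
  exact (incl_eq_smul (ne_zero (ne_zero hx)) (s.rel g h i x)).symm

/-- The composition rule of the operators. -/
theorem op_op (g h : G) (i j : I) (x : S.Total) (hij : i = φ.tgt h j) :
    φ.op (g, i) (φ.op (h, j) x) = (s.α j g h : ℂ) • φ.op (g * h, j) x := by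
  subst hij
  rw [op_apply, op_apply, proj_incl, s.rel]
  rfl

theorem op_one (i : I) (x : S.Total) : φ.op (1, i) x = S.incl i (S.proj i x) :=
  φ.φ_one i _

theorem op_ne {g : G} {i : I} {x : S.M i} (hx : x ≠ 0) : φ.op (g, i) (S.incl i x) ≠ 0 := by
  rw [op_apply, proj_incl]
  exact incl_ne (ne_zero hx)

/-- The action of `G` on the index set and the cocycle `α`. -/
def cocycle : ActionCocycle G I where
  act := φ.tgt
  act_one := tgt_one φ
  act_mul := s.tgt_mul
  α := s.α
  one_left j h := by
    obtain ⟨x, hx⟩ := S.exists_ne j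
    have h1 := s.op_op 1 h _ j (S.incl j x) rfl
    rw [op_one, one_mul, op_apply, proj_incl, proj_incl] at h1
    have h2 := smul_left_injective ℂ (incl_ne (ne_zero hx)) ((one_smul ℂ _).trans h1)
    exact Units.ext h2.symm
  one_right j g := by
    obtain ⟨x, hx⟩ := S.exists_ne j
    have h1 := s.op_op g 1 j j (S.incl j x) (tgt_one φ j).symm
    rw [op_one, mul_one, proj_incl] at h1
    have h2 := smul_left_injective ℂ (op_ne hx) ((one_smul ℂ _).trans h1)
    exact Units.ext h2.symm
  cocycle j g h k := by
    obtain ⟨x, hx⟩ := S.exists_ne j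
    have h1 := s.op_op h k _ j (S.incl j x) rfl
    have h2 := s.op_op g (h * k) _ j (S.incl j x) rfl
    have h3 := s.op_op g h (φ.tgt h (φ.tgt k j)) _ (φ.op (k, j) (S.incl j x)) rfl
    have h4 := s.op_op (g * h) k _ j (S.incl j x) rfl
    rw [h1, map_smul, h4, ← s.tgt_mul, h2, mul_assoc, smul_smul, smul_smul] at h3
    have h5 := smul_left_injective ℂ (op_ne hx) h3
    apply Units.ext
    rw [Units.val_mul, Units.val_mul, mul_comm]
    exact h5

/-- The algebra `𝒜_α(G, 𝒮)`, with basis `g ⊗ e(M)`. -/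
abbrev Alg : Type (max u w) := s.cocycle.Alg

theorem tgt_stab (φ : S.Transport) {g : G} {j : I} (hg : g ∈ S.stab j) : φ.tgt g j = j := by
  obtain ⟨f, hf⟩ := hg
  refine (S.inequivalent j _ ⟨f.trans (φ.φ g j), fun u n x => ?_⟩).symm
  have h1 : f ((S.X j).Y (g • g⁻¹ • u) n x) = (S.X j).Y (g⁻¹ • u) n (f x) := hf (g⁻¹ • u) n x
  rw [smul_inv_smul] at h1
  have h2 := φ.intertwine g j (g⁻¹ • u) n (f x)
  rw [smul_inv_smul] at h2
  rw [LinearEquiv.trans_apply, h1, h2]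
  rfl

/-- The restriction of the cocycle `α_M` to the stabilizer `G_M`, where `M = M_j`. -/
def stabCocycle (j : I) : ActionCocycle (S.stab j) Unit where
  act _ i := i
  act_one _ := rfl
  act_mul _ _ _ := rfl
  α _ g h := s.α j g h
  one_left _ h := s.cocycle.one_left j h
  one_right _ g := s.cocycle.one_right j g
  cocycle _ g h k := by
    have h1 := s.cocycle.cocycle j g h k
    have h2 : s.cocycle.act k j = j := tgt_stab φ k.2
    rw [h2] at h1
    exact h1

/-- The twisted group algebra `ℂ^{α_M}[G_M]`, with basis `ḡ` for `g ∈ G_M` and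
`ḡ h̄ = α_M(g, h) (gh)‾`, where `M = M_j`. -/
abbrev StabAlg (j : I) : Type u := (s.stabCocycle j).Alg

theorem op_op_ne (φ : S.Transport) (g h : G) {i j : I} (x : S.Total) (hij : i ≠ φ.tgt h j) :
    φ.op (g, i) (φ.op (h, j) x) = 0 := by
  rw [op_apply, op_apply, proj_incl_ne S (Ne.symm hij), map_zero, map_zero]

section Action

variable [Fintype I]

/-- The representation of `𝒜_α(G, 𝒮)` on `ℳ`: for `w ∈ N`, `(g ⊗ e(M)) w = δ_{M,N} φ_N(g) w`. -/
def rep : s.Alg →ₐ[ℂ] Module.End ℂ S.Total :=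
  s.cocycle.lift φ.op
    (by
      refine LinearMap.ext fun x => ?_
      simp only [LinearMap.sum_apply, op_one, sum_incl_proj]
      rfl)
    (fun g h j => LinearMap.ext fun x => s.op_op g h _ j x rfl)
    (fun g h _ _ hij => LinearMap.ext fun x => op_op_ne φ g h x hij)

instance : Module s.Alg S.Total := Module.compHom S.Total s.rep.toRingHom

theorem smul_def (a : s.Alg) (x : S.Total) : a • x = s.rep a x := rfl

instance : IsScalarTower ℂ s.Alg S.Total where
  smul_assoc r a x := by
    rw [smul_def, smul_def, map_smul]
    rfl

theorem rep_basis (p : G × I) : s.rep (s.cocycle.basis p) = φ.op p :=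
  s.cocycle.basis.constr_basis ℂ φ.op p

theorem total_Y [Finite G] (u : fixed G) (n : ℚ) (x : S.Total) (i : I) :
    S.proj i (S.total.Y u n x) = (S.X i).Y u n (S.proj i x) := rfl

theorem total_incl [Finite G] (u : fixed G) (n : ℚ) (i : I) (x : S.M i) :
    S.total.Y u n (S.incl i x) = S.incl i ((S.X i).Y u n x) := by
  refine funext fun k => ?_
  change S.proj k (S.total.Y u n (S.incl i x)) = S.proj k (S.incl i ((S.X i).Y u n x))
  rw [total_Y]
  by_cases h : i = k
  · subst h
    rw [proj_incl, proj_incl]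
  · rw [proj_incl_ne S h, proj_incl_ne S h, map_zero]

theorem op_total [Finite G] (φ : S.Transport) (p : G × I) (u : fixed G) (n : ℚ) (x : S.Total) :
    φ.op p (S.total.Y u n x) = S.total.Y u n (φ.op p x) := by
  obtain ⟨g, i⟩ := p
  have hu : g • (u : V) = u := u.2 (g : Aut V) g.2
  rw [op_apply, op_apply, total_incl, total_Y, φ.intertwine, hu]

/-- The actions of `𝒜_α(G, 𝒮)` and `V^G` on `ℳ` commute. -/
theorem total_commutes [Finite G] : (S.total).Commutes s.Alg := by
  intro a u n x
  let F : s.Alg →ₗ[ℂ] Module.End ℂ S.Total := s.rep.toLinearMap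
  have h : (LinearMap.mulRight ℂ (S.total.Y u n)) ∘ₗ F =
      (LinearMap.mulLeft ℂ (S.total.Y u n)) ∘ₗ F := by
    refine s.cocycle.basis.ext fun p => LinearMap.ext fun y => ?_
    change s.rep (s.cocycle.basis p) (S.total.Y u n y) =
      S.total.Y u n (s.rep (s.cocycle.basis p) y)
    rw [rep_basis, op_total]
  exact LinearMap.congr_fun (LinearMap.congr_fun h a) x

end Action

/-- The operator `φ_M(g)` on `M = M_j`, for `g` in the stabilizer of `M`. -/
def stabOp (φ : S.Transport) (j : I) (g : S.stab j) : Module.End ℂ (S.M j) :=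
  S.proj j ∘ₗ φ.op (g, j) ∘ₗ S.incl j

theorem incl_stabOp (φ : S.Transport) (j : I) (g : S.stab j) (x : S.M j) :
    S.incl j (stabOp φ j g x) = φ.op (g, j) (S.incl j x) := by
  have key : ∀ (i : I), i = j → ∀ y : S.M i, S.incl j (S.proj j (S.incl i y)) = S.incl i y := by
    rintro i rfl y
    rw [proj_incl]
  exact key _ (tgt_stab φ g.2) _

/-- The representation `ḡ ↦ φ_M(g)` of `ℂ^{α_M}[G_M]` on `M = M_j`. -/
def stabRep (j : I) : s.StabAlg j →ₐ[ℂ] Module.End ℂ (S.M j) :=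
  (s.stabCocycle j).lift (fun p => stabOp φ j p.1)
    (by
      refine LinearMap.ext fun x => incl_inj ?_
      simp only [Finset.univ_unique, Finset.sum_singleton, incl_stabOp]
      exact (op_one j _).trans (by rw [proj_incl]; rfl))
    (fun g h _ => LinearMap.ext fun x => incl_inj (by
      rw [Module.End.mul_apply, incl_stabOp, incl_stabOp, LinearMap.smul_apply, map_smul,
        incl_stabOp]
      exact s.op_op g h j j _ (tgt_stab φ h.2).symm))
    (fun _ _ _ _ hij => absurd rfl hij)

instance (j : I) : Module (s.StabAlg j) (S.M j) :=
  Module.compHom (S.M j) (s.stabRep j).toRingHom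

theorem stab_smul_def (j : I) (a : s.StabAlg j) (x : S.M j) : a • x = s.stabRep j a x := rfl

instance (j : I) : IsScalarTower ℂ (s.StabAlg j) (S.M j) where
  smul_assoc r a x := by
    rw [stab_smul_def, stab_smul_def, map_smul]
    rfl

end Scalars
end Transport

/-- The `V^G`-module `M = M_j`. -/
def resX [Finite G] (S : StableFamily.{u, v, w} G σ I) (j : I) :
    TwistedModule (1 : Aut (fixed G)) (S.M j) :=
  (S.X j).restrict G (σ : G).2 (orderOf_coe_pos (σ : G))

namespace Transport
namespace Scalars

variable {φ : S.Transport} (s : φ.Scalars)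

/-- The actions of `ℂ^{α_M}[G_M]` and `V^G` on `M = M_j` commute. -/
theorem res_commutes [Finite G] [Fintype I] (j : I) : (S.resX j).Commutes (s.StabAlg j) := by
  intro a u n x
  let F : s.StabAlg j →ₗ[ℂ] Module.End ℂ (S.M j) := (s.stabRep j).toLinearMap
  have h : (LinearMap.mulRight ℂ ((S.resX j).Y u n)) ∘ₗ F =
      (LinearMap.mulLeft ℂ ((S.resX j).Y u n)) ∘ₗ F := by
    refine (s.stabCocycle j).basis.ext fun p => LinearMap.ext fun y => incl_inj ?_
    have e : s.stabRep j ((s.stabCocycle j).basis p) = stabOp φ j p.1 :=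
      (s.stabCocycle j).basis.constr_basis ℂ _ p
    change S.incl j (s.stabRep j ((s.stabCocycle j).basis p) ((S.X j).Y u n y)) =
      S.incl j ((S.X j).Y u n (s.stabRep j ((s.stabCocycle j).basis p) y))
    rw [e, incl_stabOp, ← total_incl, op_total, ← total_incl, incl_stabOp]
  exact LinearMap.congr_fun (LinearMap.congr_fun h a) x

/-- The multiplicity space `M_λ = Hom(W_λ, M)`, for the twisted group algebra of the stabilizer
of `M = M_j`. -/
abbrev MultSpace (j : I) (cl : SimpleClass (s.StabAlg j)) : Type (max u v) :=
  cl.Rep →ₗ[s.StabAlg j] S.M j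

/-- The `V^G`-module structure on the multiplicity space `M_λ`. -/
def mult [Finite G] [Fintype I] (j : I) (cl : SimpleClass (s.StabAlg j)) :
    TwistedModule (1 : Aut (fixed G)) (s.MultSpace j cl) :=
  (S.resX j).multiplicity (s.res_commutes j) cl.Rep

/-! #### Induction from `S(M) = ℂ^{α_M}[G_M]` to `D(M)` -/

/-- The map `S(M) → 𝒜_α(G, 𝒮)`, `ḡ ↦ g ⊗ e(M)`. -/
def stabIncl (j : I) : s.StabAlg j →ₗ[ℂ] s.Alg :=
  (s.stabCocycle j).basis.constr ℂ fun p => s.cocycle.basis (p.1, j)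

section Induction

variable [Fintype I]

/-- `D(M) = Span {g ⊗ e(M) | g ∈ G}`, a left ideal of `𝒜_α(G, 𝒮)`. -/
def D (j : I) : Submodule s.Alg s.Alg :=
  { Submodule.span ℂ (Set.range fun g : G => s.cocycle.basis (g, j)) with
    smul_mem' := by
      intro a x hx
      change a * x ∈ Submodule.span ℂ _
      change x ∈ Submodule.span ℂ _ at hx
      induction hx using Submodule.span_induction with
      | mem x hx =>
        obtain ⟨g, rfl⟩ := hx
        have h : (⊤ : Submodule ℂ s.Alg) ≤
            (Submodule.span ℂ (Set.range fun g : G => s.cocycle.basis (g, j))).comap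
              (LinearMap.mulRight ℂ (s.cocycle.basis (g, j))) := by
          rw [← s.cocycle.basis.span_eq, Submodule.span_le]
          rintro _ ⟨p, rfl⟩
          change s.cocycle.basis p * s.cocycle.basis (g, j) ∈ Submodule.span ℂ _
          rw [ActionCocycle.basis_mul_basis, ActionCocycle.basisMul]
          split_ifs
          · exact Submodule.smul_mem _ _ (Submodule.subset_span ⟨p.1 * g, rfl⟩)
          · exact zero_mem _
        exact h (Submodule.mem_top (x := a))
      | zero => rw [mul_zero]; exact zero_mem _
      | add x y _ _ hx hy => rw [mul_add]; exact add_mem hx hy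
      | smul r x _ hx => rw [mul_smul_comm]; exact Submodule.smul_mem _ _ hx }

theorem mul_stabIncl_mem (j : I) (x : s.D j) (a : s.StabAlg j) :
    (x : s.Alg) * s.stabIncl j a ∈ s.D j := by
  refine (s.D j).smul_mem _ ?_
  have h : (⊤ : Submodule ℂ (s.StabAlg j)) ≤
      (Submodule.span ℂ (Set.range fun g : G => s.cocycle.basis (g, j))).comap
        (s.stabIncl j) := by
    rw [← (s.stabCocycle j).basis.span_eq, Submodule.span_le]
    rintro _ ⟨p, rfl⟩
    change s.stabIncl j _ ∈ Submodule.span ℂ _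
    rw [stabIncl, Module.Basis.constr_basis]
    exact Submodule.subset_span ⟨p.1, rfl⟩
  exact h (Submodule.mem_top (x := a))

variable (j : I) (W : Type*) [AddCommGroup W] [Module ℂ W] [Module (s.StabAlg j) W]

/-- The relations `x a ⊗ w = x ⊗ a w`, for `x ∈ D(M)`, `a ∈ S(M)`, `w ∈ W`, of the tensor product
over `S(M)`. -/
def indRel : Submodule s.Alg (s.D j ⊗[ℂ] W) :=
  Submodule.span s.Alg {t | ∃ (x : s.D j) (a : s.StabAlg j) (y : W),
    t = (⟨(x : s.Alg) * s.stabIncl j a, s.mul_stabIncl_mem j x a⟩ : s.D j) ⊗ₜ[ℂ] y -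
      x ⊗ₜ[ℂ] (a • y)}

/-- The induced module `D(M) ⊗_{S(M)} W`, a module for `𝒜_α(G, 𝒮)`. -/
abbrev Ind : Type _ := (s.D j ⊗[ℂ] W) ⧸ s.indRel j W

end Induction

end Scalars
end Transport

end StableFamily

end Stable

namespace StableFamily

variable {V : Type u} [AddCommGroup V] [Module ℂ V] [VertexAlgebra V]
  {G : Subgroup (Aut V)} {σ : Subgroup.center G} {I : Type w}
  {S : StableFamily.{u, v, w} G σ I}

/-- A set of representatives `M^j`, `j ∈ J`, of the orbits `{M^j ∘ g | g ∈ G}` of `G` on the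
isomorphism classes of the modules of the family. -/
def IsTransversal (S : StableFamily.{u, v, w} G σ I) (J : Set I) : Prop :=
  ∀ i, ∃! j, j ∈ J ∧ ∃ g : G, (S.X i).Iso ((S.X j).conj g (center_comm σ g))

namespace Transport
namespace Scalars

variable {φ : S.Transport} (s : φ.Scalars)

/-- The pairs `(j, λ)` of an orbit representative `j ∈ J` and an irreducible character `λ` of the
twisted group algebra of the stabilizer of `M^j`. -/
abbrev Index (J : Set I) : Type (max u w) := Σ j : J, SimpleClass (s.StabAlg j)

variable {s} {J : Set I} [Fintype I]

/-- The `𝒜_α(G, 𝒮)`-module `W^j_λ`, induced from the simple module `W_{j,λ}`. -/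
abbrev Index.W (p : s.Index J) : Type _ := s.Ind p.1 p.2.Rep

/-- The multiplicity space `M^j_λ` of `W_{j,λ}` in `M^j`. -/
abbrev Index.MultSpace (p : s.Index J) : Type (max u v) := s.MultSpace p.1 p.2

/-- The multiplicity space `M^j_λ`, as a `V^G`-module. -/
def Index.mult [Finite G] (p : s.Index J) :
    TwistedModule (1 : Aut (fixed G)) p.MultSpace :=
  s.mult p.1 p.2

variable (s J)

open scoped DirectSum in
open scoped Classical in
/-- `ℳ` is isomorphic to `⨁ W^j_λ ⊗ M^j_λ` as a module for `𝒜_α(G, 𝒮) ⊗ V^G`, where `𝒜_α(G, 𝒮)`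
acts on the first and `V^G` on the second tensor factor. -/
def Decomposes [Finite G] : Prop :=
  ∃ Θ : (⨁ p : s.Index J, p.W ⊗[ℂ] p.MultSpace) ≃ₗ[s.Alg] S.Total,
    ∀ (p : s.Index J) (y : p.W) (f : p.MultSpace) (u : fixed G) (n : ℚ),
      Θ (DirectSum.of (fun p : s.Index J => p.W ⊗[ℂ] p.MultSpace) p (y ⊗ₜ[ℂ] p.mult.Y u n f)) =
        S.total.Y u n
          (Θ (DirectSum.of (fun p : s.Index J => p.W ⊗[ℂ] p.MultSpace) p (y ⊗ₜ[ℂ] f)))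

end Scalars
end Transport
end StableFamily

/-- A module is a direct sum of finitely many irreducible submodules. -/
def VertexAlgebra.TwistedModule.IsFiniteSumOfIrreducibles {V : Type u} [AddCommGroup V]
    [Module ℂ V] [VertexAlgebra V] {g : Aut V} {M : Type v} [AddCommGroup M] [Module ℂ M]
    (X : TwistedModule g M) : Prop :=
  ∃ (k : ℕ) (N : Fin k → Submodule ℂ M) (hN : ∀ i, X.IsInvariant (N i)),
    DirectSum.IsInternal N ∧ ∀ i, (X.sub (N i) (hN i)).IsIrreducible

end

/-!
Throughout, `ℳ` is the direct sum of the modules of a finite `G`-stable family of irreducible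
`σ`-twisted `V`-modules, and `𝒜 = 𝒜_α(G, 𝒮)` acts on it. The theorem follows from the double
centralizer principle: `𝒜` is semisimple, and the modes of `V^G` are dense in the commutant of `𝒜`
on `ℳ`.

*Density.* By the twisted Jacobi identity, the image of a vector under a product `u_m v_n` of modes
is a combination of its images under single modes, so the span of the images of a vector under
single modes is already invariant (`isInvariant_orbitSpan`). Since `V` has countable dimension, so
does every irreducible twisted module, so Schur's lemma holds for it over `ℂ`
(`IsIrreducible.exists_eq_smul`). The Jacobson density theorem then shows that sums of single modes
of `V` are dense in the block-diagonal operators on `ℳ`. Averaging over `G` turns a mode of `v ∈ V`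
into a mode of `V^G`, and an operator commuting with `𝒜` is fixed by the averaging; hence on finite
sets of vectors it agrees with combinations of modes of `V^G` (`exists_total_modeSpan_eq`).

*Semisimplicity.* The algebra of a cocycle has a separability idempotent, the average over `G` of
the elements `g ⊗ g⁻¹`, corrected by scalars. Maschke's argument applies
(`ActionCocycle.isSemisimpleRing`) to `𝒜` as well as to the twisted group algebras of stabilizers.

Given these two facts, a nonzero `𝒜`-homomorphism `W → ℳ` from a simple module `W` can be moved to
any other by an operator in the commutant of `𝒜`, hence by modes of `V^G`. So `Hom_𝒜(W, ℳ)` is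
irreducible (`multiplicity_isIrreducible`), and a `V^G`-isomorphism between two such spaces forces
an isomorphism of the simple modules (`nonempty_equiv_of_multiplicity_iso`).

*Nonvanishing.* It must be shown that every simple `𝒜`-module occurs in `ℳ`. Because `V` is simple,
`∑ Y_M(v_i, z) x_i = 0` with linearly independent `x_i` forces all `v_i` to vanish
(`eq_zero_of_sum_mode_eq_zero`): the relation persists when the `x_i` are moved by modes, so by
density each `v_i` acts by zero, and such vectors form a proper ideal of `V`. Elements of `G` are
distinct operators on `V`, so applying this to a relation `∑ c_g φ_M(g) = 0` gives all `c_g = 0`,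
in the manner of Dedekind's independence of characters. Thus the twisted group algebra of the
stabilizer acts faithfully on `M` (`eq_zero_of_stab_smul_eq_zero`), and all its simple modules
occur in `M` (`nontrivial_multSpace`).

*Classification of simple modules.* Cutting with the idempotent `e(M) = 1 ⊗ e(M)` inverts induction
from the twisted group algebra of the stabilizer of `M`: a simple `𝒜`-module `L` is induced from
`e(M) L` as soon as that is nonzero (`exists_equiv_ind`), and Frobenius reciprocity (`frobenius`)
identifies the multiplicity space of `W_λ` in `M` with that of the induced module in `ℳ`. The
decomposition of `ℳ` is the canonical one of a semisimple module. For the last claim, the finitely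
many modules `M ∘ g` form a stable family whose sum is a finitely generated semisimple module for
the modes of `V^G`, with `M` as a quotient.
-/

noncomputable section

open scoped TensorProduct

/-! ### Schur's lemma in countable dimension -/

section Schur

variable {M : Type*} [AddCommGroup M] [Module ℂ M]

theorem injective_aeval_of_forall_bijective {f : Module.End ℂ M}
    (hf : ∀ c : ℂ, Function.Bijective (f - algebraMap ℂ (Module.End ℂ M) c))
    {p : Polynomial ℂ} (hp : p ≠ 0) :
    Function.Injective (Polynomial.aeval f p) := by
  have hspec : spectrum ℂ f = ∅ := by
    refine Set.eq_empty_iff_forall_notMem.mpr fun c hc => ?_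
    rw [spectrum.mem_iff, ← IsUnit.neg_iff, neg_sub, Module.End.isUnit_iff] at hc
    exact hc (hf c)
  rcases lt_or_ge 0 p.degree with h | h
  · have h1 := spectrum.map_polynomial_aeval_of_degree_pos f p h
    rw [hspec, Set.image_empty] at h1
    have h2 := Set.eq_empty_iff_forall_notMem.mp h1 0
    rw [spectrum.zero_notMem_iff, Module.End.isUnit_iff] at h2
    exact h2.1
  · rw [Polynomial.eq_C_of_degree_le_zero h] at hp ⊢
    rw [Polynomial.aeval_C]
    intro x y hxy
    exact smul_right_injective M (by simpa using hp) (by simpa using hxy)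

/-- The vectors `(f - c)⁻¹ w`, for `c ∈ ℂ`, are linearly independent, which is impossible in
countable dimension. -/
theorem exists_not_bijective_sub_algebraMap [Nontrivial M] (hM : Module.rank ℂ M ≤ Cardinal.aleph0)
    (f : Module.End ℂ M) : ∃ c : ℂ, ¬ Function.Bijective (f - algebraMap ℂ (Module.End ℂ M) c) := by
  classical
  by_contra! hf
  obtain ⟨w, hw⟩ := exists_ne (0 : M)
  choose v hv using fun c => (hf c).2 w
  -- a relation between the `(f - c)⁻¹ w` becomes `q(f) w = 0` after multiplying by `∏ (f - d)`
  have key : LinearIndependent ℂ v := by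
    rw [linearIndependent_iff']
    intro s a hs c hc
    let q : Polynomial ℂ := ∑ b ∈ s, Polynomial.C (a b) *
      ∏ d ∈ s.erase b, (Polynomial.X - Polynomial.C d)
    have hq : Polynomial.aeval f q w = 0 := by
      have h1 := congrArg (Polynomial.aeval f (∏ d ∈ s, (Polynomial.X - Polynomial.C d))) hs
      rw [map_zero, map_sum] at h1
      rw [← h1]
      simp only [q, map_sum, LinearMap.sum_apply]
      refine Finset.sum_congr rfl fun b hb => ?_
      rw [← Finset.prod_erase_mul s _ hb, map_mul, map_mul, Polynomial.aeval_C, map_smul,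
        Module.End.mul_apply, Module.End.mul_apply, Module.algebraMap_end_apply]
      simp only [map_sub, Polynomial.aeval_X, Polynomial.aeval_C] at *
      rw [hv]
    have hq0 : q = 0 := by
      by_contra h
      exact hw (injective_aeval_of_forall_bijective hf h (hq.trans (map_zero _).symm))
    have h2 := congrArg (Polynomial.eval c) hq0
    simp only [q, Polynomial.eval_finsetSum, Polynomial.eval_mul, Polynomial.eval_C,
      Polynomial.eval_prod, Polynomial.eval_sub, Polynomial.eval_X, Polynomial.eval_zero] at h2
    rw [Finset.sum_eq_single c] at h2
    · refine (mul_eq_zero.mp h2).resolve_right (Finset.prod_ne_zero_iff.mpr fun d hd => ?_)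
      exact sub_ne_zero.mpr (Finset.ne_of_mem_erase hd).symm
    · intro b _ hbc
      rw [Finset.prod_eq_zero (i := c), mul_zero]
      · exact Finset.mem_erase.mpr ⟨hbc.symm, hc⟩
      · exact sub_self c
    · exact fun h => absurd hc h
  have h3 := key.cardinal_lift_le_rank
  rw [Cardinal.mk_complex] at h3
  have h4 := h3.trans (Cardinal.lift_le.mpr hM)
  rw [Cardinal.lift_continuum, Cardinal.lift_aleph0] at h4
  exact absurd h4 (not_le.mpr Cardinal.aleph0_lt_continuum)

end Schur

/-! ### Semisimplicity and multiplicity spaces -/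

/-- An algebra with a separability idempotent `∑ x_k ⊗ y_k` is semisimple: averaging a linear
projection with it gives a projection of modules. -/
theorem isSemisimpleRing_of_separability {A : Type*} [Ring A] [Algebra ℂ A] {κ : Type*}
    [Fintype κ] (x y : κ → A) (hxy : ∑ k, x k * y k = 1)
    (hcomm : ∀ a, ∑ k, (a * x k) ⊗ₜ[ℂ] y k = ∑ k, x k ⊗ₜ[ℂ] (y k * a)) :
    IsSemisimpleRing A := by
  refine (isSemisimpleModule_iff A A).mpr ⟨fun N => ?_⟩
  obtain ⟨π₀, hπ₀⟩ := LinearMap.exists_leftInverse_of_injective (N.restrictScalars ℂ).subtype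
    (Submodule.ker_subtype _)
  let π : A →ₗ[ℂ] A := (N.restrictScalars ℂ).subtype ∘ₗ π₀
  have hπN : ∀ z, π z ∈ N := fun z => (π₀ z).2
  have hπ : ∀ z ∈ N, π z = z := fun z hz =>
    congrArg Subtype.val (LinearMap.congr_fun hπ₀ (⟨z, hz⟩ : N.restrictScalars ℂ))
  let F : A →ₗ[A] A :=
    { toFun := fun z => ∑ k, x k * π (y k * z)
      map_add' := by intros; simp [mul_add, Finset.sum_add_distrib]
      map_smul' := by
        intro a z
        let T : A ⊗[ℂ] A →ₗ[ℂ] A := LinearMap.mul' ℂ A ∘ₗ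
          TensorProduct.map LinearMap.id (π ∘ₗ LinearMap.mulRight ℂ z)
        have h := congrArg T (hcomm a)
        simp only [map_sum, T, LinearMap.comp_apply, TensorProduct.map_tmul, LinearMap.id_apply,
          LinearMap.mul'_apply, LinearMap.mulRight_apply] at h
        simp only [smul_eq_mul, RingHom.id_apply, Finset.mul_sum, ← mul_assoc]
        rw [← h] }
  have hF : ∀ z, F z ∈ N := fun z => N.sum_mem fun k _ => N.smul_mem _ (hπN _)
  refine ⟨_, LinearMap.isCompl_of_proj (f := F.codRestrict N hF) fun n => Subtype.ext ?_⟩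
  change ∑ k, x k * π (y k * (n : A)) = n
  have h : ∀ k, π (y k * (n : A)) = y k * n := fun k => hπ _ (N.smul_mem _ n.2)
  simp only [h, ← mul_assoc, ← Finset.sum_mul, hxy, one_mul]

section Classes

/-- Every simple module is isomorphic to the chosen representative of its class. -/
theorem SimpleClass.exists_rep_equiv {A : Type u} [Ring A] (L : Type*) [AddCommGroup L]
    [Module A L] [IsSimpleModule A L] : ∃ cl : SimpleClass A, Nonempty (L ≃ₗ[A] cl.Rep) := by
  obtain ⟨m, hm, ⟨e⟩⟩ := isSimpleModule_iff_quot_maximal.mp (‹IsSimpleModule A L›)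
  let x : {I : Submodule A A // IsCoatom I} := ⟨m, hm.out⟩
  obtain ⟨e'⟩ : (simpleSetoid A).r (Quotient.out (Quotient.mk (simpleSetoid A) x)) x :=
    Quotient.mk_out x
  exact ⟨Quotient.mk _ x, ⟨e.trans e'.symm⟩⟩

instance SimpleClass.isSimpleModule_rep {A : Type u} [Ring A] (cl : SimpleClass A) :
    IsSimpleModule A cl.Rep :=
  isSimpleModule_iff_isCoatom.mpr (Quotient.out cl : {I : Submodule A A // IsCoatom I}).2

theorem SimpleClass.eq_of_rep_equiv {A : Type u} [Ring A] {cl cl' : SimpleClass A}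
    (h : Nonempty (cl.Rep ≃ₗ[A] cl'.Rep)) : cl = cl' := by
  rw [← Quotient.out_eq cl, ← Quotient.out_eq cl']
  exact Quotient.sound (s := simpleSetoid A) h

/-- Simple submodules are images of members of a complete set of representatives `W p`. -/
theorem exists_range_eq_of_isSimpleModule {A : Type u} [Ring A] {κ : Type*} {W : κ → Type*}
    [∀ p, AddCommGroup (W p)] [∀ p, Module A (W p)]
    (hexh : ∀ cl : SimpleClass A, ∃ p, Nonempty (cl.Rep ≃ₗ[A] W p))
    {L : Type*} [AddCommGroup L] [Module A L] (S : Submodule A L) (hS : IsSimpleModule A S) :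
    ∃ p, ∃ h : W p →ₗ[A] L, LinearMap.range h = S := by
  obtain ⟨cl, ⟨e⟩⟩ := SimpleClass.exists_rep_equiv (A := A) S
  obtain ⟨p, ⟨e'⟩⟩ := hexh cl
  refine ⟨p, S.subtype ∘ₗ (e'.symm.trans e.symm).toLinearMap, ?_⟩
  rw [LinearMap.range_comp, LinearEquiv.range, Submodule.map_top, Submodule.range_subtype]

end Classes

section Canonical

variable {A : Type*} [Ring A] [Algebra ℂ A]

section Contraction

variable {W : Type*} [AddCommGroup W] [Module ℂ W] [Module A W] [IsScalarTower ℂ A W]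
  {H : Type*} [AddCommGroup H] [Module ℂ H]

variable (A W) in
/-- The contraction `W ⊗ H → W`, `y ⊗ f ↦ ξ(f) y`, with a linear form `ξ` on `H`. -/
def contract (ξ : H →ₗ[ℂ] ℂ) : W ⊗[ℂ] H →ₗ[A] W :=
  (TensorProduct.AlgebraTensorModule.rid ℂ A W).toLinearMap ∘ₗ
    TensorProduct.AlgebraTensorModule.map LinearMap.id ξ

@[simp]
theorem contract_tmul (ξ : H →ₗ[ℂ] ℂ) (y : W) (f : H) : contract A W ξ (y ⊗ₜ f) = ξ f • y := by
  simp [contract]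

theorem eq_of_contract_eq {s t : W ⊗[ℂ] H} (h : ∀ ξ, contract A W ξ s = contract A W ξ t) :
    s = t := by
  classical
  let b := Module.Basis.ofVectorSpace ℂ H
  apply (TensorProduct.equivFinsuppOfBasisRight (M := W) b).injective
  ext i
  have h1 : ∀ z : W ⊗[ℂ] H, TensorProduct.equivFinsuppOfBasisRight b z i =
      contract A W (b.coord i) z := by
    intro z
    induction z using TensorProduct.induction_on with
    | zero => simp
    | tmul y f => simp
    | add y z hy hz => simp [hy, hz]
  rw [h1, h1, h]

/-- If `W` has only scalar endomorphisms, then every homomorphism `W → W ⊗ H` is of the form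
`y ↦ y ⊗ f`. -/
theorem exists_eq_tmul_of_scalar_end (hW : ∀ F : W →ₗ[A] W, ∃ c : ℂ, ∀ y, F y = c • y)
    (h : W →ₗ[A] W ⊗[ℂ] H) : ∃ f : H, ∀ y, h y = y ⊗ₜ f := by
  rcases subsingleton_or_nontrivial W with hs | hn
  · exact ⟨0, fun y => by rw [Subsingleton.elim y 0]; simp⟩
  obtain ⟨y₀, hy₀⟩ := exists_ne (0 : W)
  obtain ⟨η, hη⟩ := Module.Projective.exists_dual_eq_one ℂ hy₀
  let f : H := TensorProduct.lid ℂ H (TensorProduct.map η LinearMap.id (h y₀))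
  refine ⟨f, fun y => eq_of_contract_eq (A := A) fun ξ => ?_⟩
  obtain ⟨c, hc⟩ := hW (contract A W ξ ∘ₗ h)
  have hf : ∀ t : W ⊗[ℂ] H, ξ (TensorProduct.lid ℂ H (TensorProduct.map η LinearMap.id t)) =
      η (contract A W ξ t) := by
    intro t
    induction t using TensorProduct.induction_on with
    | zero => simp
    | tmul y f => simp [mul_comm]
    | add y z hy hz => simp only [map_add, hy, hz]
  have h1 : ξ f = c := by
    have h2 := hc y₀
    rw [LinearMap.comp_apply] at h2
    rw [hf, h2, map_smul, hη, smul_eq_mul, mul_one]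
  rw [contract_tmul, h1]
  exact hc y

end Contraction

open scoped DirectSum

/-- Over a semisimple algebra, with a complete set `W p` of representatives of the simple
modules, every module `P` is the direct sum of the `W p ⊗ Hom_A(W p, P)`. -/
theorem exists_directSum_tensor_equiv [IsSemisimpleRing A] {κ : Type*} [DecidableEq κ]
    {W : κ → Type*}
    [∀ p, AddCommGroup (W p)] [∀ p, Module ℂ (W p)] [∀ p, Module A (W p)]
    [∀ p, IsScalarTower ℂ A (W p)] [∀ p, IsSimpleModule A (W p)]
    (hscal : ∀ p (F : W p →ₗ[A] W p), ∃ c : ℂ, ∀ y, F y = c • y)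
    (hirr : ∀ p q, Nonempty (W p ≃ₗ[A] W q) → p = q)
    (hexh : ∀ cl : SimpleClass A, ∃ p, Nonempty (cl.Rep ≃ₗ[A] W p))
    {P : Type*} [AddCommGroup P] [Module ℂ P] [Module A P] [IsScalarTower ℂ A P]
    {H : κ → Type*} [∀ p, AddCommGroup (H p)] [∀ p, Module ℂ (H p)]
    (τ : ∀ p, H p ≃ₗ[ℂ] (W p →ₗ[A] P)) :
    ∃ Θ : (⨁ p, W p ⊗[ℂ] H p) ≃ₗ[A] P, ∀ p y f,
      Θ (DirectSum.of (fun p => W p ⊗[ℂ] H p) p (y ⊗ₜ f)) = τ p f y := by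
  let θ : ∀ p, W p ⊗[ℂ] H p →ₗ[A] P := fun p => TensorProduct.AlgebraTensorModule.lift
    { toFun := fun y =>
        { toFun := fun f => τ p f y
          map_add' := by intros; simp
          map_smul' := by intros; simp }
      map_add' := by intros; ext; simp
      map_smul' := by intros; ext; simp }
  let Θ : (⨁ p, W p ⊗[ℂ] H p) →ₗ[A] P := DirectSum.toModule A κ P θ
  have hΘ : ∀ p y f, Θ (DirectSum.of (fun p => W p ⊗[ℂ] H p) p (y ⊗ₜ f)) = τ p f y :=
    fun p y f => (DirectSum.toModule_lof (M := fun p => W p ⊗[ℂ] H p) (φ := θ) A p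
      (y ⊗ₜ[ℂ] f)).trans (TensorProduct.AlgebraTensorModule.lift_tmul _ _ _)
  have hsurj : LinearMap.range Θ = ⊤ := by
    rw [← top_le_iff, ← IsSemisimpleModule.sSup_simples_eq_top A P]
    refine sSup_le fun S hS => ?_
    obtain ⟨p, h, rfl⟩ := exists_range_eq_of_isSimpleModule hexh S hS
    rintro _ ⟨y, rfl⟩
    exact ⟨DirectSum.of (fun p => W p ⊗[ℂ] H p) p (y ⊗ₜ (τ p).symm h), by
      rw [hΘ, LinearEquiv.apply_symm_apply]⟩
  have hinj : LinearMap.ker Θ = ⊥ := by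
    refine (IsSemisimpleModule.eq_bot_or_exists_simple_le (LinearMap.ker Θ)).resolve_right ?_
    rintro ⟨S, hSK, hS⟩
    obtain ⟨q, h, hh⟩ := exists_range_eq_of_isSimpleModule hexh S hS
    -- by Schur's lemma, a simple submodule of the kernel is of the form `W q ⊗ f`
    have hcomp : ∀ p, p ≠ q → ∀ y, h y p = 0 := by
      intro p hpq y
      refine eq_of_contract_eq (A := A) fun ξ => ?_
      let F : W q →ₗ[A] W p := contract A (W p) ξ ∘ₗ
        DirectSum.component A κ (fun p => W p ⊗[ℂ] H p) p ∘ₗ h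
      have hF : F = 0 := F.bijective_or_eq_zero.resolve_left fun hb =>
        hpq (hirr q p ⟨LinearEquiv.ofBijective F hb⟩).symm
      rw [map_zero]
      exact LinearMap.congr_fun hF y
    obtain ⟨f, hf⟩ := exists_eq_tmul_of_scalar_end (A := A) (hscal q)
      (DirectSum.component A κ (fun p => W p ⊗[ℂ] H p) q ∘ₗ h)
    have hy : ∀ y, h y = DirectSum.of (fun p => W p ⊗[ℂ] H p) q (y ⊗ₜ f) := by
      intro y
      refine DirectSum.ext_component A fun p => ?_
      by_cases hpq : p = q
      · subst hpq
        refine (hf y).trans ?_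
        exact (DirectSum.of_eq_same (β := fun p => W p ⊗[ℂ] H p) p (y ⊗ₜ f)).symm
      · refine (hcomp p hpq y).trans ?_
        exact (DirectSum.of_eq_of_ne (β := fun p => W p ⊗[ℂ] H p) _ _ (y ⊗ₜ f) hpq).symm
    have hf0 : f = 0 := by
      refine (τ q).map_eq_zero_iff.mp (LinearMap.ext fun y => ?_)
      have h1 : h y ∈ LinearMap.ker Θ := hSK (hh ▸ LinearMap.mem_range_self h y)
      rw [← hΘ, ← hy]
      exact h1
    have h0 : h = 0 := LinearMap.ext fun y => by rw [hy, hf0]; simp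
    rw [h0, LinearMap.range_zero] at hh
    have := IsSimpleModule.nontrivial A S
    exact (Submodule.nontrivial_iff_ne_bot.mp this) hh.symm
  exact ⟨LinearEquiv.ofBijective Θ ⟨LinearMap.ker_eq_bot.mp hinj, LinearMap.range_eq_top.mp hsurj⟩,
    hΘ⟩
end Canonical

/-! ### Consequences of the twisted Jacobi identity -/

/-- Downward induction in steps of one. -/
theorem Rat.downward_induction {P : ℚ → Prop} (hbdd : ∃ N : ℚ, ∀ n, N ≤ n → P n)
    (step : ∀ n, (∀ i : ℕ, P (n + (i + 1 : ℕ))) → P n) (n : ℚ) : P n := by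
  obtain ⟨N, hN⟩ := hbdd
  have key : ∀ (K : ℕ) (n : ℚ), N ≤ n + K → P n := by
    intro K
    induction K with
    | zero => exact fun n hn => hN n (by simpa using hn)
    | succ K ih =>
      refine fun n hn => step n fun i => ih _ ?_
      push_cast at hn ⊢
      have : (0 : ℚ) ≤ i := Nat.cast_nonneg i
      linarith
  obtain ⟨K, hK⟩ := exists_nat_ge (N - n)
  exact key K n (by linarith)

/-- If a finite sum and all its terms but the first are in a subspace, then so is the first. -/
theorem zero_term_mem_of_finsum_mem {M : Type*} [AddCommGroup M] [Module ℂ M] (N : Submodule ℂ M)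
    {f : ℕ → M} (hf : ∃ K : ℕ, ∀ i, K ≤ i → f i = 0) (hsum : ∑ᶠ i, f i ∈ N)
    (hsucc : ∀ i, f (i + 1) ∈ N) : f 0 ∈ N := by
  obtain ⟨K, hK⟩ := hf
  rw [finsum_eq_sum_of_support_subset (s := Finset.range (K + 1)), Finset.sum_range_succ'] at hsum
  · exact (N.add_mem_iff_right (N.sum_mem fun i _ => hsucc i)).mp hsum
  · intro i hi
    rw [Finset.coe_range, Set.mem_Iio]
    by_contra h
    exact hi (hK i (by omega))

namespace VertexAlgebra

theorem aut_smul_smul {V : Type u} [AddCommGroup V] [Module ℂ V] [VertexAlgebra V] (g : Aut V)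
    (c : ℂ) (v : V) : g • c • v = c • g • v :=
  (g : V ≃ₗ[ℂ] V).map_smul c v

/-- An automorphism of finite order is diagonalizable. -/
theorem exists_sum_eigen {V : Type u} [AddCommGroup V] [Module ℂ V] [VertexAlgebra V] (g : Aut V)
    (hg : 0 < orderOf g) (v : V) : ∃ c : ℕ → V, (∀ r, c r ∈ eigen g r) ∧
      v = ∑ r ∈ Finset.range (orderOf g), c r := by
  have hT : orderOf g ≠ 0 := hg.ne'
  let ζ : ℂ := Complex.exp (2 * Real.pi * Complex.I / (orderOf g : ℂ))
  have hζ : IsPrimitiveRoot ζ (orderOf g) := Complex.isPrimitiveRoot_exp _ hT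
  let F : ℕ → ℕ → V := fun r k => ζ ^ (r * k) • (g ^ k) • v
  refine ⟨fun r => (orderOf g : ℂ)⁻¹ • ∑ k ∈ Finset.range (orderOf g), F r k, fun r => ?_, ?_⟩
  · have h1 : ∀ k, ζ ^ r • g • F r k = F r (k + 1) := by
      intro k
      simp only [F, aut_smul_smul, smul_smul, ← pow_succ', mul_add, pow_add, mul_one]
      rw [mul_comm]
    have h2 : F r (orderOf g) = F r 0 := by
      simp only [F, pow_orderOf_eq_one, mul_zero, pow_zero]
      rw [mul_comm, pow_mul, hζ.pow_eq_one, one_pow]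
    have h3 : ζ ^ r • g • ∑ k ∈ Finset.range (orderOf g), F r k =
        ∑ k ∈ Finset.range (orderOf g), F r k := by
      rw [Finset.smul_sum, Finset.smul_sum, Finset.sum_congr rfl fun k _ => h1 k]
      have h4 := Finset.sum_range_succ (F r) (orderOf g)
      rw [Finset.sum_range_succ', h2] at h4
      exact add_right_cancel h4
    have h5 : Complex.exp (-2 * Real.pi * Complex.I * (r : ℂ) / (orderOf g : ℂ)) * ζ ^ r = 1 := by
      rw [← Complex.exp_nat_mul, ← Complex.exp_add, ← Complex.exp_zero]
      congr 1
      ring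
    change g • _ • _ = _ • _ • _
    rw [aut_smul_smul]
    conv_rhs => rw [← h3, smul_comm, smul_smul, smul_smul, mul_assoc, h5, mul_one]
  · rw [← Finset.smul_sum, Finset.sum_comm, Finset.sum_eq_single 0]
    · have hT' : (orderOf g : ℂ) ≠ 0 := Nat.cast_ne_zero.mpr hT
      simp [F, ← Nat.cast_smul_eq_nsmul ℂ, smul_smul, hT']
    · intro k hk hk0
      simp only [F, ← Finset.sum_smul]
      have h1 : ζ ^ k ≠ 1 := hζ.pow_ne_one_of_pos_of_lt hk0 (Finset.mem_range.mp hk)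
      have h2 : ∑ r ∈ Finset.range (orderOf g), ζ ^ (r * k) = 0 := by
        have h3 := geom_sum_mul (ζ ^ k) (orderOf g)
        rw [← pow_mul, mul_comm k, pow_mul, hζ.pow_eq_one, one_pow, sub_self] at h3
        have h4 := (mul_eq_zero.mp h3).resolve_right (sub_ne_zero.mpr h1)
        rw [← h4]
        exact Finset.sum_congr rfl fun r _ => by rw [← pow_mul, mul_comm]
      rw [h2, zero_smul]
    · exact fun h => absurd (Finset.mem_range.mpr hg) h

namespace TwistedModule

section

variable {V : Type u} [AddCommGroup V] [Module ℂ V] [VertexAlgebra V] {g : Aut V}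
  {M : Type v} [AddCommGroup M] [Module ℂ M] (X : TwistedModule g M)

theorem trunc_nat (u : V) (x : M) (n : ℚ) : ∃ K : ℕ, ∀ i : ℕ, K ≤ i → X.Y u (n + i) x = 0 := by
  obtain ⟨B, hB⟩ := X.trunc u x
  obtain ⟨K, hK⟩ := exists_nat_ge (B - n)
  refine ⟨K, fun i hi => hB _ ?_⟩
  have : (K : ℚ) ≤ i := by exact_mod_cast hi
  linarith

/-- A linear map on operators sends all modes into a subspace if it does so for the modes of the
eigenvectors of `g` with exponents in the appropriate coset of `ℤ`, for which the Jacobi identity is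
available. -/
theorem mode_mem_of_eigen (hg : 0 < orderOf g) (N : Submodule ℂ M) (F : Module.End ℂ M →ₗ[ℂ] M)
    (h : ∀ r < orderOf g, ∀ u ∈ eigen g r, ∀ n : ℚ,
      (∃ k : ℤ, n = (r : ℚ) / (orderOf g : ℚ) + k) → F (X.Y u n) ∈ N) (u : V) (n : ℚ) :
    F (X.Y u n) ∈ N := by
  obtain ⟨c, hc, rfl⟩ := exists_sum_eigen g hg u
  rw [map_sum, Finset.sum_apply, map_sum]
  refine N.sum_mem fun r hr => ?_
  by_cases hn : ∃ k : ℤ, n = (r : ℚ) / (orderOf g : ℚ) + k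
  · exact h r (Finset.mem_range.mp hr) _ (hc r) n hn
  · rw [X.support r (Finset.mem_range.mp hr) _ (hc r) n hn, map_zero]
    exact N.zero_mem

/-- The span of the vectors `v_n w`, for a fixed vector `w`. -/
def orbitSpan (w : M) : Submodule ℂ M := Submodule.span ℂ (Set.range fun p : V × ℚ => X.Y p.1 p.2 w)

theorem mode_mem_orbitSpan (v : V) (n : ℚ) (w : M) : X.Y v n w ∈ X.orbitSpan w :=
  Submodule.subset_span ⟨(v, n), rfl⟩

theorem self_mem_orbitSpan (w : M) : w ∈ X.orbitSpan w := by
  have h := X.mode_mem_orbitSpan vac (-1) w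
  rwa [X.vacuum, if_pos rfl] at h

/-- Associativity: the span of the vectors `v_n w` is a submodule. -/
theorem isInvariant_orbitSpan (hg : 0 < orderOf g) (w : M) : X.IsInvariant (X.orbitSpan w) := by
  intro u p x hx
  induction hx using Submodule.span_induction with
  | zero => rw [map_zero]; exact zero_mem _
  | add x y _ _ hx hy => rw [map_add]; exact add_mem hx hy
  | smul c x _ hx => rw [map_smul]; exact Submodule.smul_mem _ c hx
  | mem x hx =>
    obtain ⟨⟨v, n⟩, rfl⟩ := hx
    refine X.mode_mem_of_eigen hg _ (LinearMap.applyₗ (X.Y v n w)) (fun r hr u hu p hp => ?_) u p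
    change X.Y u p (X.Y v n w) ∈ _
    revert p
    refine Rat.downward_induction (P := fun n => ∀ p : ℚ,
      (∃ k : ℤ, p = (r : ℚ) / (orderOf g : ℚ) + k) → X.Y u p (X.Y v n w) ∈ X.orbitSpan w)
      ?_ ?_ n
    · obtain ⟨N, hN⟩ := X.trunc v w
      refine ⟨N, fun n hn p _ => ?_⟩
      rw [hN n hn, map_zero]
      exact zero_mem _
    · intro n ih p ⟨k, hp⟩
      obtain ⟨K, hK⟩ := X.trunc_nat u w p
      -- with `m = p + K`, all the terms `u_{m+i} w` of the Jacobi identity vanish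
      have key := X.jacobi r hr u hu v w (-K) (p + K) n ⟨k + K, by rw [hp]; push_cast; ring⟩
      have hzero : ∀ i : ℕ, X.Y u (p + K + i) w = 0 := fun i => by
        have h := hK (K + i) (Nat.le_add_right _ _)
        push_cast at h
        rwa [← add_assoc] at h
      simp only [hzero, map_zero, smul_zero, finsum_zero, sub_zero] at key
      have h0 := zero_term_mem_of_finsum_mem (X.orbitSpan w) ?_ (key.symm ▸ ?_ :
        ∑ᶠ i : ℕ, ((-1 : ℂ) ^ i * (Ring.choose (-K : ℤ) i : ℤ)) •
          X.Y u (p + K + (-K : ℤ) - i) (X.Y v (n + i) w) ∈ X.orbitSpan w) fun i => ?_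
      · simpa using h0
      · obtain ⟨K', hK'⟩ := X.trunc_nat v w n
        exact ⟨K', fun i hi => by rw [hK' i hi, map_zero, smul_zero]⟩
      · exact finsum_induction (· ∈ X.orbitSpan w) (zero_mem _) (fun _ _ h h' => add_mem h h')
          (fun i => Submodule.smul_mem _ _ (X.mode_mem_orbitSpan _ _ _))
      · refine Submodule.smul_mem _ _ (ih i _ ⟨k - (i + 1), ?_⟩)
        rw [hp]
        push_cast
        ring

/-- Commutativity: a relation `∑ Y(v_j, z) w_j = 0` implies `∑ Y(v_j, z) u_m w_j = 0`. -/
theorem sum_mode_mode_eq_zero (hg : 0 < orderOf g) {ι : Type*} [Fintype ι] (v : ι → V) (w : ι → M)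
    (h : ∀ n, ∑ j, X.Y (v j) n (w j) = 0) (u : V) (m n : ℚ) :
    ∑ j, X.Y (v j) n (X.Y u m (w j)) = 0 := by
  let F : ℚ → Module.End ℂ M →ₗ[ℂ] M := fun n =>
    ∑ j, X.Y (v j) n ∘ₗ LinearMap.applyₗ (w j)
  have hF : ∀ n A, F n A = ∑ j, X.Y (v j) n (A (w j)) := by
    intro n A
    simp [F]
  rw [← hF, ← Submodule.mem_bot ℂ]
  refine X.mode_mem_of_eigen hg _ (F n) (fun r hr u hu m hm => ?_) u m
  rw [Submodule.mem_bot, hF]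
  revert hm n
  refine Rat.downward_induction (P := fun m => ∀ n : ℚ,
    (∃ k : ℤ, m = (r : ℚ) / (orderOf g : ℚ) + k) → ∑ j, X.Y (v j) n (X.Y u m (w j)) = 0) ?_ ?_ m
  · choose N hN using fun j => X.trunc u (w j)
    obtain ⟨B, hB⟩ := (Set.finite_range N).bddAbove
    exact ⟨B, fun m hm n _ => Finset.sum_eq_zero fun j _ => by
      rw [hN j m ((hB ⟨j, rfl⟩).trans hm), map_zero]⟩
  · intro m ih n ⟨k, hm⟩
    choose L hL using fun j => mode_trunc u (v j)
    obtain ⟨l, hl⟩ := (Set.finite_range L).bddAbove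
    -- for this `l` the right hand sides of the Jacobi identities vanish
    have hzero : ∀ j (i : ℕ), mode u (l + i) (v j) = 0 := fun j i =>
      hL j _ ((hl ⟨j, rfl⟩).trans (by omega))
    have key := fun j => X.jacobi r hr u hu (v j) (w j) l m (n - l) ⟨k, hm⟩
    simp only [hzero, map_zero, Pi.zero_apply, LinearMap.zero_apply, smul_zero, finsum_zero] at key
    have hfin1 : ∀ j, ∃ K : ℕ, ∀ i, K ≤ i → X.Y (v j) (n - l + i) (w j) = 0 := fun j =>
      X.trunc_nat _ _ _
    have hfin2 : ∀ j, ∃ K : ℕ, ∀ i : ℕ, K ≤ i → X.Y u (m + i) (w j) = 0 := fun j =>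
      X.trunc_nat _ _ _
    have hsupp : ∀ {f : ℕ → M}, (∃ K : ℕ, ∀ i, K ≤ i → f i = 0) → f.support.Finite := by
      rintro f ⟨K, hK⟩
      refine (Set.finite_lt_nat K).subset fun i hi => ?_
      by_contra hlt
      exact hi (hK i (not_lt.mp hlt))
    have hsum := Finset.sum_congr rfl fun j (_ : j ∈ Finset.univ) => sub_eq_zero.mp (key j)
    rw [← finsum_sum_comm, ← finsum_sum_comm] at hsum
    · simp only [← Finset.smul_sum, ← map_sum, h, map_zero, smul_zero, finsum_zero] at hsum
      have h0 := zero_term_mem_of_finsum_mem ⊥ ?_ (hsum ▸ zero_mem ⊥) fun i => ?_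
      · have h1 : ((-1 : ℂ) ^ l) ≠ 0 := zpow_ne_zero _ (by norm_num)
        simpa [h1] using h0
      · choose K hK using hfin2
        obtain ⟨B, hB⟩ := (Set.finite_range K).bddAbove
        refine ⟨B, fun i hi => ?_⟩
        rw [Finset.sum_eq_zero, smul_zero]
        exact fun j _ => by rw [hK j i ((hB ⟨j, rfl⟩).trans hi), map_zero]
      · rw [Submodule.mem_bot, ih i _ ⟨k + (i + 1), ?_⟩, smul_zero]
        rw [hm]
        push_cast
        ring
    · intro j _
      obtain ⟨K, hK⟩ := hfin2 j
      exact hsupp ⟨K, fun i hi => by rw [hK i hi, map_zero, smul_zero]⟩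
    · intro j _
      obtain ⟨K, hK⟩ := hfin1 j
      exact hsupp ⟨K, fun i hi => by rw [hK i hi, map_zero, smul_zero]⟩

/-- The vectors acting by zero form an ideal, so that in the simple case only `0` acts by zero. -/
theorem eq_zero_of_modes_eq_zero [Nontrivial M] (hg : 0 < orderOf g) (hV : IsSimple V) {v : V}
    (hv : ∀ n, X.Y v n = 0) : v = 0 := by
  let I : Submodule ℂ V := LinearMap.ker X.Y
  have hI : ∀ u, u ∈ I ↔ ∀ n, X.Y u n = 0 := fun u => LinearMap.mem_ker.trans funext_iff
  -- if `u` or `v` acts by zero, then the left hand side of the Jacobi identity vanishes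
  have key : ∀ r < orderOf g, ∀ u ∈ eigen g r, ∀ v : V, (u ∈ I ∨ v ∈ I) → ∀ l : ℤ,
      mode u l v ∈ I := by
    intro r hr u hu v huv l
    suffices h : ∀ q : ℚ, ∀ l : ℤ, q = l → mode u l v ∈ I from h l l rfl
    refine fun q => Rat.downward_induction
      (P := fun q => ∀ l : ℤ, q = l → mode u l v ∈ I) ?_ ?_ q
    · obtain ⟨N, hN⟩ := mode_trunc u v
      refine ⟨N, fun q hq l hl => ?_⟩
      rw [hN l (by rw [hl] at hq; exact_mod_cast hq)]
      exact zero_mem I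
    · rintro _ ih l rfl
      rw [hI]
      refine fun n => LinearMap.ext fun x => ?_
      have h := X.jacobi r hr u hu v x l ((r : ℚ) / (orderOf g : ℚ))
        (n - (r : ℚ) / (orderOf g : ℚ)) ⟨0, by simp⟩
      have hleft : ∀ p q y, X.Y u p (X.Y v q y) = 0 ∧ X.Y v p (X.Y u q y) = 0 := by
        intro p q y
        rcases huv with huv | huv <;> simp [(hI _).mp huv]
      simp only [(hleft _ _ _).1, (hleft _ _ _).2, smul_zero, finsum_zero, sub_zero] at h
      have h0 := zero_term_mem_of_finsum_mem ⊥ ?_ (h ▸ zero_mem ⊥) fun i => ?_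
      · simpa using h0
      · obtain ⟨K, hK⟩ := mode_trunc_nat u v l
        exact ⟨K, fun i hi => by simp [hK i hi]⟩
      · have h1 := (hI _).mp (ih i (l + (i + 1 : ℕ)) (by push_cast; ring))
        rw [h1]
        simp
  -- the modes of the components of `u` for `g` have disjoint sets of exponents
  have hcomp : ∀ c : ℕ → V, (∀ r, c r ∈ eigen g r) →
      ∑ r ∈ Finset.range (orderOf g), c r ∈ I → ∀ r < orderOf g, c r ∈ I := by
    intro c hc hsum r hr
    rw [hI] at hsum ⊢
    intro n
    by_cases hn : ∃ k : ℤ, n = (r : ℚ) / (orderOf g : ℚ) + k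
    · have h := hsum n
      rw [map_sum, Finset.sum_apply, Finset.sum_eq_single r] at h
      · exact h
      · intro r' hr' hne
        refine X.support r' (Finset.mem_range.mp hr') _ (hc r') n ?_
        rintro ⟨k', hk'⟩
        obtain ⟨k, hk⟩ := hn
        have hT : (orderOf g : ℚ) ≠ 0 := Nat.cast_ne_zero.mpr hg.ne'
        rw [hk] at hk'
        field_simp at hk'
        have h1 : (r : ℤ) + orderOf g * k = r' + orderOf g * k' := by exact_mod_cast hk'
        have h2 : (r : ℤ) % orderOf g = r' % orderOf g := by
          have := congrArg (· % (orderOf g : ℤ)) h1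
          simpa using this
        rw [Int.emod_eq_of_lt (by positivity) (by exact_mod_cast hr),
          Int.emod_eq_of_lt (by positivity)
            (by exact_mod_cast Finset.mem_range.mp hr')] at h2
        exact hne (by exact_mod_cast h2.symm)
      · exact fun h' => absurd (Finset.mem_range.mpr hr) h'
    · exact X.support r hr _ (hc r) n hn
  have hideal : ∀ (u v : V) (n : ℤ), v ∈ I → mode u n v ∈ I ∧ mode v n u ∈ I := by
    intro u v n hv
    have hsum : ∀ (c : ℕ → V) (y : V),
        mode (∑ r ∈ Finset.range (orderOf g), c r) n y =
          ∑ r ∈ Finset.range (orderOf g), mode (c r) n y := by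
      intro c y
      simp [mode]
    constructor
    · obtain ⟨c, hc, rfl⟩ := exists_sum_eigen g hg u
      rw [hsum]
      exact I.sum_mem fun r hr => key r (Finset.mem_range.mp hr) _ (hc r) v (Or.inr hv) n
    · obtain ⟨c, hc, rfl⟩ := exists_sum_eigen g hg v
      rw [hsum]
      exact I.sum_mem fun r hr => key r (Finset.mem_range.mp hr) _ (hc r) u
        (Or.inl (hcomp c hc hv r (Finset.mem_range.mp hr))) n
  rcases hV.2 I hideal with h | h
  · have h1 : v ∈ I := (hI v).mpr hv
    rwa [h, Submodule.mem_bot] at h1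
  · have h1 : (vac : V) ∈ I := h ▸ Submodule.mem_top
    have h2 := (hI _).mp h1 (-1)
    rw [X.vacuum, if_pos rfl] at h2
    exact absurd h2 one_ne_zero

end

end TwistedModule
end VertexAlgebra

/-! ### Density of the modes -/

namespace VertexAlgebra

/-- The free associative algebra on the modes `v_n`, over which every twisted module is a
module. -/
abbrev ModeAlgebra (V : Type u) : Type u := FreeAlgebra ℂ (V × ℚ)

namespace TwistedModule

section

variable {V : Type u} [AddCommGroup V] [Module ℂ V] [VertexAlgebra V] {g : Aut V}
  {M : Type v} [AddCommGroup M] [Module ℂ M] (X : TwistedModule g M)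
  {M' : Type w} [AddCommGroup M'] [Module ℂ M'] (X' : TwistedModule g M')

/-- The action of the words in the modes on a twisted module. -/
def freeRep : ModeAlgebra V →ₐ[ℂ] Module.End ℂ M := FreeAlgebra.lift ℂ fun p => X.Y p.1 p.2

theorem freeRep_ι (p : V × ℚ) : X.freeRep (FreeAlgebra.ι ℂ p) = X.Y p.1 p.2 :=
  FreeAlgebra.lift_ι_apply _ _

variable {X} in
theorem IsInvariant.freeRep_mem {N : Submodule ℂ M} (hN : X.IsInvariant N) (a : ModeAlgebra V) :
    ∀ x ∈ N, X.freeRep a x ∈ N := by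
  induction a using FreeAlgebra.induction with
  | grade0 c =>
    intro x hx
    rw [AlgHom.commutes]
    exact N.smul_mem c hx
  | grade1 p =>
    intro x hx
    rw [freeRep_ι]
    exact hN _ _ x hx
  | mul a b ha hb =>
    intro x hx
    rw [map_mul]
    exact ha _ (hb x hx)
  | add a b ha hb =>
    intro x hx
    rw [map_add]
    exact N.add_mem (ha x hx) (hb x hx)

variable {X X'} in
theorem map_freeRep (F : M →ₗ[ℂ] M') (hF : ∀ u n x, F (X.Y u n x) = X'.Y u n (F x))
    (a : ModeAlgebra V) : ∀ x, F (X.freeRep a x) = X'.freeRep a (F x) := by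
  induction a using FreeAlgebra.induction with
  | grade0 c => intro x; simp
  | grade1 p => intro x; rw [freeRep_ι, freeRep_ι, hF]
  | mul a b ha hb => intro x; simp [ha, hb]
  | add a b ha hb => intro x; simp [ha, hb]

/-- A twisted module as a module over the free algebra on the modes. -/
@[reducible]
def freeModule : Module (ModeAlgebra V) M := Module.compHom M X.freeRep.toRingHom

theorem freeModule_smul (a : ModeAlgebra V) (x : M) :
    letI := X.freeModule
    a • x = X.freeRep a x := rfl

/-- An invariant subspace as a submodule over the free algebra on the modes. -/
def IsInvariant.toSubmodule {X : TwistedModule g M} {N : Submodule ℂ M} (hN : X.IsInvariant N) :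
    letI := X.freeModule
    Submodule (ModeAlgebra V) M :=
  letI := X.freeModule
  { N with smul_mem' := fun a x hx => hN.freeRep_mem a x hx }

/-- An intertwining map as a homomorphism of modules over the free algebra on the modes. -/
def freeHom {X : TwistedModule g M} {X' : TwistedModule g M'} (F : M →ₗ[ℂ] M')
    (hF : ∀ u n x, F (X.Y u n x) = X'.Y u n (F x)) :
    letI := X.freeModule
    letI := X'.freeModule
    M →ₗ[ModeAlgebra V] M' :=
  letI := X.freeModule
  letI := X'.freeModule
  { F with map_smul' := fun a x => map_freeRep F hF a x }

/-- A module homomorphism over the free algebra on the modes is a linear intertwining map. -/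
theorem exists_linearMap_of_freeHom {X : TwistedModule g M} {X' : TwistedModule g M'} :
    letI := X.freeModule
    letI := X'.freeModule
    ∀ F : M →ₗ[ModeAlgebra V] M', ∃ F' : M →ₗ[ℂ] M', (∀ x, F' x = F x) ∧
      ∀ u n x, F' (X.Y u n x) = X'.Y u n (F' x) := by
  let _ := X.freeModule
  let _ := X'.freeModule
  intro F
  refine ⟨{ F with map_smul' := fun c x => ?_ }, fun _ => rfl, fun u n x => ?_⟩
  · have h := F.map_smul (algebraMap ℂ _ c) x
    rw [freeModule_smul, freeModule_smul, AlgHom.commutes, AlgHom.commutes] at h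
    exact h
  · have h := F.map_smul (FreeAlgebra.ι ℂ (u, n)) x
    rw [freeModule_smul, freeModule_smul, freeRep_ι, freeRep_ι] at h
    exact h

theorem exists_invariant_of_submodule :
    letI := X.freeModule
    ∀ N : Submodule (ModeAlgebra V) M, ∃ N' : Submodule ℂ M, X.IsInvariant N' ∧
      ∀ x, x ∈ N' ↔ x ∈ N := by
  let _ := X.freeModule
  intro N
  refine ⟨{ N with smul_mem' := fun c x hx => ?_ }, fun u n x hx => ?_, fun _ => Iff.rfl⟩
  · have h := N.smul_mem (algebraMap ℂ _ c) hx
    rw [freeModule_smul, AlgHom.commutes] at h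
    exact h
  · have h := N.smul_mem (FreeAlgebra.ι ℂ (u, n)) hx
    rw [freeModule_smul, freeRep_ι] at h
    exact h

theorem isIrreducible_iff_isSimpleModule :
    letI := X.freeModule
    X.IsIrreducible ↔ IsSimpleModule (ModeAlgebra V) M := by
  let _ := X.freeModule
  constructor
  · rintro ⟨_, h⟩
    refine (isSimpleModule_iff (ModeAlgebra V) M).mpr { eq_bot_or_eq_top := fun N => ?_ }
    obtain ⟨N', hN', hmem⟩ := X.exists_invariant_of_submodule N
    rcases h N' hN' with h | h
    · left
      ext x
      rw [← hmem, h, Submodule.mem_bot, Submodule.mem_bot]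
    · right
      ext x
      rw [← hmem, h]
      simp
  · intro h
    refine ⟨IsSimpleModule.nontrivial (ModeAlgebra V) M, fun N hN => ?_⟩
    rcases eq_bot_or_eq_top hN.toSubmodule with h | h
    · left
      ext x
      exact (iff_of_eq (congrArg (x ∈ ·) h)).trans (by simp)
    · right
      ext x
      exact (iff_of_eq (congrArg (x ∈ ·) h)).trans (by simp)

/-- The space of finite linear combinations of modes. -/
def modeSpan : Submodule ℂ (Module.End ℂ M) :=
  Submodule.span ℂ (Set.range fun p : V × ℚ => X.Y p.1 p.2)

theorem exists_modeSpan_of_mem_orbitSpan {ι : Type*} [Finite ι] (w z : ι → M)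
    (hz : z ∈ (pi fun _ : ι => X).orbitSpan w) : ∃ d ∈ X.modeSpan, ∀ i, z i = d (w i) := by
  induction hz using Submodule.span_induction with
  | mem z hz =>
    obtain ⟨p, rfl⟩ := hz
    exact ⟨_, Submodule.subset_span ⟨p, rfl⟩, fun _ => rfl⟩
  | zero => exact ⟨0, zero_mem _, fun _ => rfl⟩
  | add x y _ _ hx hy =>
    obtain ⟨d, hd, h⟩ := hx
    obtain ⟨d', hd', h'⟩ := hy
    exact ⟨d + d', add_mem hd hd', fun i => by simp [h, h']⟩
  | smul c x _ hx =>
    obtain ⟨d, hd, h⟩ := hx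
    exact ⟨c • d, Submodule.smul_mem _ c hd, fun i => by simp [h]⟩

/-- On finitely many vectors, every word in the modes is a linear combination of single modes:
the span of the `v_n w`, for `w` in a finite power of `M`, is a submodule. -/
theorem exists_modeSpan_eq_freeRep (hg : 0 < orderOf g) (a : ModeAlgebra V) (s : Finset M) :
    ∃ d ∈ X.modeSpan, ∀ x ∈ s, X.freeRep a x = d x := by
  let w : s → M := fun x => x
  have h1 := ((pi fun _ : s => X).isInvariant_orbitSpan hg w).freeRep_mem a _
    ((pi fun _ : s => X).self_mem_orbitSpan w)
  obtain ⟨d, hd, h⟩ := X.exists_modeSpan_of_mem_orbitSpan w _ h1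
  refine ⟨d, hd, fun x hx => ?_⟩
  rw [← h ⟨x, hx⟩]
  exact (map_freeRep (X := pi fun _ : s => X) (X' := X)
    (LinearMap.proj (φ := fun _ : s => M) ⟨x, hx⟩) (fun _ _ _ => rfl) a w).symm

/-- Density: on a semisimple twisted module, an operator in the double commutant of the modes
agrees on every finite set with a linear combination of modes. -/
theorem exists_modeSpan_eq_of_commute (hg : 0 < orderOf g)
    (hss : letI := X.freeModule; IsSemisimpleModule (ModeAlgebra V) M) (f : Module.End ℂ M)
    (hf : ∀ F : Module.End ℂ M, (∀ u n x, F (X.Y u n x) = X.Y u n (F x)) →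
      ∀ x, f (F x) = F (f x)) (s : Finset M) : ∃ d ∈ X.modeSpan, ∀ x ∈ s, f x = d x := by
  let _ := X.freeModule
  let f' : Module.End (Module.End (ModeAlgebra V) M) M :=
    { toFun := f
      map_add' := map_add f
      map_smul' := fun F x => by
        obtain ⟨F', hF', hY⟩ := exists_linearMap_of_freeHom (X := X) (X' := X) F
        have h := hf F' hY x
        rw [hF', hF'] at h
        exact h }
  obtain ⟨a, ha⟩ := jacobson_density f' s
  obtain ⟨d, hd, h⟩ := X.exists_modeSpan_eq_freeRep hg a s
  exact ⟨d, hd, fun x hx => (ha x hx).trans (h x hx)⟩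

/-- Irreducible twisted modules have countable dimension if `V` has. -/
theorem IsIrreducible.rank_le {X : TwistedModule g M} (hX : X.IsIrreducible) (hg : 0 < orderOf g)
    (hV : Module.rank ℂ V ≤ Cardinal.aleph0) : Module.rank ℂ M ≤ Cardinal.aleph0 := by
  obtain ⟨_, hirr⟩ := hX
  obtain ⟨w, hw⟩ := exists_ne (0 : M)
  have htop : X.orbitSpan w = ⊤ := by
    refine (hirr _ (X.isInvariant_orbitSpan hg w)).resolve_left fun h => hw ?_
    have h1 := X.self_mem_orbitSpan w
    rwa [h, Submodule.mem_bot] at h1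
  let b := Module.Basis.ofVectorSpace ℂ V
  have hb : Countable (Module.Basis.ofVectorSpaceIndex ℂ V) := by
    rw [← Cardinal.mk_le_aleph0_iff, b.mk_eq_rank'']
    exact hV
  let S : Set M := Set.range fun p : Module.Basis.ofVectorSpaceIndex ℂ V × ℚ => X.Y (b p.1) p.2 w
  have hS : Submodule.span ℂ S = ⊤ := by
    rw [← top_le_iff, ← htop, orbitSpan, Submodule.span_le]
    rintro _ ⟨⟨v, n⟩, rfl⟩
    let F : V →ₗ[ℂ] M := LinearMap.applyₗ w ∘ₗ LinearMap.proj n ∘ₗ X.Y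
    have h : (⊤ : Submodule ℂ V) ≤ (Submodule.span ℂ S).comap F := by
      rw [← b.span_eq, Submodule.span_le]
      rintro _ ⟨i, rfl⟩
      exact Submodule.subset_span ⟨(i, n), rfl⟩
    exact h (Submodule.mem_top (x := v))
  have h := rank_span_le (R := ℂ) S
  rw [hS, rank_top] at h
  exact h.trans (Cardinal.mk_le_aleph0_iff.mpr (Set.countable_range _).to_subtype)

/-- Schur's lemma for irreducible twisted modules. -/
theorem IsIrreducible.exists_eq_smul {X : TwistedModule g M} (hX : X.IsIrreducible)
    (hg : 0 < orderOf g) (hV : Module.rank ℂ V ≤ Cardinal.aleph0) (F : Module.End ℂ M)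
    (hF : ∀ u n x, F (X.Y u n x) = X.Y u n (F x)) : ∃ c : ℂ, ∀ x, F x = c • x := by
  have hM := hX.rank_le hg hV
  obtain ⟨_, hirr⟩ := hX
  obtain ⟨c, hc⟩ := exists_not_bijective_sub_algebraMap hM F
  let D : Module.End ℂ M := F - algebraMap ℂ _ c
  have hD : ∀ u n x, D (X.Y u n x) = X.Y u n (D x) := by
    intro u n x
    simp [D, hF]
  have hker : X.IsInvariant (LinearMap.ker D) := by
    intro u n x hx
    rw [LinearMap.mem_ker] at hx ⊢
    rw [hD, hx, map_zero]
  have hrange : X.IsInvariant (LinearMap.range D) := by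
    rintro u n _ ⟨x, rfl⟩
    exact ⟨_, hD u n x⟩
  rcases hirr _ hker with h | h
  · rcases hirr _ hrange with h' | h'
    · rw [LinearMap.range_eq_bot] at h'
      rw [h', LinearMap.ker_zero] at h
      exact absurd h.symm bot_ne_top
    · exact absurd ⟨LinearMap.ker_eq_bot.mp h, LinearMap.range_eq_top.mp h'⟩ hc
  · refine ⟨c, fun x => ?_⟩
    have h1 : D x = 0 := LinearMap.mem_ker.mp (h ▸ Submodule.mem_top)
    exact sub_eq_zero.mp h1

/-- `Y(v, z)` separates `V ⊗ M` for an irreducible twisted module `M` of a simple vertex algebra: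
if `∑ Y(v_j, z) w_j = 0` with linearly independent `w_j`, then all `v_j` vanish. -/
theorem IsIrreducible.eq_zero_of_sum_mode_eq_zero {X : TwistedModule g M} (hX : X.IsIrreducible)
    (hg : 0 < orderOf g) (hV : Module.rank ℂ V ≤ Cardinal.aleph0) (hsimple : IsSimple V)
    {ι : Type*} [Fintype ι] (v : ι → V) (w : ι → M) (hw : LinearIndependent ℂ w)
    (h : ∀ n, ∑ j, X.Y (v j) n (w j) = 0) (j : ι) : v j = 0 := by
  classical
  have := hX.1
  refine X.eq_zero_of_modes_eq_zero hg hsimple fun n => LinearMap.ext fun x => ?_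
  have hss : letI := X.freeModule; IsSemisimpleModule (ModeAlgebra V) M := by
    let _ := X.freeModule
    have := X.isIrreducible_iff_isSimpleModule.mp hX
    infer_instance
  -- an operator with `w_j ↦ x` and `w_i ↦ 0` for `i ≠ j`
  obtain ⟨f, hf⟩ : ∃ f : Module.End ℂ M, ∀ i, f (w i) = if i = j then x else 0 := by
    let b := Module.Basis.span hw
    obtain ⟨f, hf⟩ := LinearMap.exists_extend (b.constr ℂ fun i => if i = j then x else 0)
    refine ⟨f, fun i => ?_⟩
    have h1 := LinearMap.congr_fun hf (b i)
    rw [b.constr_basis] at h1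
    rw [← h1]
    simp [b, Module.Basis.span_apply]
  obtain ⟨d, hd, hdf⟩ := X.exists_modeSpan_eq_of_commute hg hss f (fun F hF y => by
    obtain ⟨c, hc⟩ := hX.exists_eq_smul hg hV F hF
    rw [hc, hc, map_smul]) (Finset.univ.image w)
  have hsum : ∀ d ∈ X.modeSpan, ∑ i, X.Y (v i) n (d (w i)) = 0 := by
    intro d hd
    induction hd using Submodule.span_induction with
    | mem d hd =>
      obtain ⟨p, rfl⟩ := hd
      exact X.sum_mode_mode_eq_zero hg v w h p.1 p.2 n
    | zero => simp
    | add x y _ _ hx hy => simp [Finset.sum_add_distrib, hx, hy]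
    | smul c x _ hx => simp [← Finset.smul_sum, hx]
  have h1 := hsum d hd
  simp only [← fun i => hdf (w i) (Finset.mem_image_of_mem w (Finset.mem_univ i)), hf] at h1
  simpa [apply_ite] using h1

end

end TwistedModule
end VertexAlgebra

/-! ### Operators on a stable family -/

namespace VertexAlgebra.TwistedModule

section

variable {V : Type u} [AddCommGroup V] [Module ℂ V] [VertexAlgebra V] {g : Aut V}
  {M : Type v} [AddCommGroup M] [Module ℂ M] {M' : Type w} [AddCommGroup M'] [Module ℂ M']

theorem IsIrreducible.bijective_of_ne_zero {X : TwistedModule g M} {X' : TwistedModule g M'}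
    (hX : X.IsIrreducible) (hX' : X'.IsIrreducible) (F : M →ₗ[ℂ] M')
    (hF : ∀ u n x, F (X.Y u n x) = X'.Y u n (F x)) (h0 : F ≠ 0) : Function.Bijective F := by
  have hker : X.IsInvariant (LinearMap.ker F) := by
    intro u n x hx
    rw [LinearMap.mem_ker] at hx ⊢
    rw [hF, hx, map_zero]
  have hrange : X'.IsInvariant (LinearMap.range F) := by
    rintro u n _ ⟨x, rfl⟩
    exact ⟨_, hF u n x⟩
  refine ⟨LinearMap.ker_eq_bot.mp ((hX.2 _ hker).resolve_right fun h => h0 ?_),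
    LinearMap.range_eq_top.mp ((hX'.2 _ hrange).resolve_left fun h => h0 ?_)⟩
  · exact LinearMap.ker_eq_top.mp h
  · exact LinearMap.range_eq_bot.mp h

/-- If `∑ Y(v_j, z) w_j = 0`, then `∑ v_j ⊗ w_j = 0`, expressed by linear forms on `V`. -/
theorem IsIrreducible.sum_dual_smul_eq_zero {X : TwistedModule g M} (hX : X.IsIrreducible)
    (hg : 0 < orderOf g) (hV : Module.rank ℂ V ≤ Cardinal.aleph0) (hsimple : IsSimple V)
    {ι : Type*} [Fintype ι] (v : ι → V) (w : ι → M)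
    (h : ∀ n, ∑ j, X.Y (v j) n (w j) = 0) (ξ : Module.Dual ℂ V) : ∑ j, ξ (v j) • w j = 0 := by
  let N : Submodule ℂ M := Submodule.span ℂ (Set.range w)
  have : FiniteDimensional ℂ N := FiniteDimensional.span_of_finite ℂ (Set.finite_range w)
  let b := Module.finBasis ℂ N
  let a : ι → Fin (Module.finrank ℂ N) → ℂ := fun j k =>
    b.repr ⟨w j, Submodule.subset_span ⟨j, rfl⟩⟩ k
  have hw : ∀ j, w j = ∑ k, a j k • (b k : M) := by
    intro j
    have h1 := congrArg Subtype.val (b.sum_repr ⟨w j, Submodule.subset_span ⟨j, rfl⟩⟩)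
    rw [Submodule.coe_sum] at h1
    exact h1.symm
  have hb : LinearIndependent ℂ fun k => (b k : M) :=
    b.linearIndependent.map' N.subtype (Submodule.ker_subtype N)
  have hzero := hX.eq_zero_of_sum_mode_eq_zero hg hV hsimple (fun k => ∑ j, a j k • v j) _ hb
    (fun n => by
      rw [← h n]
      conv_rhs => enter [2, j]; rw [hw j]
      simp only [map_sum, map_smul, Finset.sum_apply, LinearMap.sum_apply, Pi.smul_apply,
        LinearMap.smul_apply]
      exact Finset.sum_comm)
  conv_lhs => enter [2, j]; rw [hw j]
  simp only [Finset.smul_sum, smul_smul]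
  rw [Finset.sum_comm]
  refine Finset.sum_eq_zero fun k _ => ?_
  rw [← Finset.sum_smul]
  have h2 := congrArg ξ (hzero k)
  simp only [map_sum, map_smul, smul_eq_mul, map_zero] at h2
  simp only [mul_comm (ξ _), h2, zero_smul]

end

end VertexAlgebra.TwistedModule

open VertexAlgebra

namespace StableFamily

variable {V : Type u} [AddCommGroup V] [Module ℂ V] [VertexAlgebra V]
  {G : Subgroup (Aut V)} {σ : Subgroup.center G} {I : Type w}
  {S : StableFamily.{u, v, w} G σ I}

theorem pi_incl [Finite I] (u : V) (n : ℚ) (i : I) (x : S.M i) :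
    (TwistedModule.pi S.X).Y u n (S.incl i x) = S.incl i ((S.X i).Y u n x) := by
  refine funext fun k => ?_
  change (S.X k).Y u n (S.proj k (S.incl i x)) = S.proj k (S.incl i ((S.X i).Y u n x))
  by_cases h : i = k
  · subst h
    rw [proj_incl, proj_incl]
  · rw [proj_incl_ne S h, proj_incl_ne S h, map_zero]

theorem proj_pi [Finite I] (u : V) (n : ℚ) (i : I) (x : S.Total) :
    S.proj i ((TwistedModule.pi S.X).Y u n x) = (S.X i).Y u n (S.proj i x) := rfl

theorem isSemisimpleModule_total [Fintype I] :
    letI := (TwistedModule.pi S.X).freeModule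
    IsSemisimpleModule (ModeAlgebra V) S.Total := by
  let _ := (TwistedModule.pi S.X).freeModule
  let _ := fun i => (S.X i).freeModule
  have hs : ∀ i, IsSimpleModule (ModeAlgebra V) (S.M i) := fun i =>
    (S.X i).isIrreducible_iff_isSimpleModule.mp (S.irreducible i)
  let F : ∀ i, S.M i →ₗ[ModeAlgebra V] S.Total := fun i =>
    TwistedModule.freeHom (S.incl i) fun u n x => (pi_incl u n i x).symm
  refine isSemisimpleModule_of_isSemisimpleModule_submodule' (p := fun i => LinearMap.range (F i))
    (fun i => IsSemisimpleModule.range _) ?_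
  rw [← top_le_iff]
  intro x _
  rw [← S.sum_incl_proj x]
  exact Submodule.sum_mem _ fun i _ => Submodule.mem_iSup_of_mem i ⟨_, rfl⟩

section

variable [Finite G] (hcount : Module.rank ℂ V ≤ Cardinal.aleph0)

include hcount

/-- The commutant of the modes of `V` on the sum of the family: since its members are pairwise
inequivalent, an intertwining operator is a scalar on each of them. -/
theorem exists_eq_smul_of_intertwining [Fintype I] (F : Module.End ℂ S.Total)
    (hF : ∀ u n x, F ((TwistedModule.pi S.X).Y u n x) = (TwistedModule.pi S.X).Y u n (F x))
    (i : I) : ∃ c : ℂ, ∀ x, F (S.incl i x) = c • S.incl i x := by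
  have hcomp : ∀ j u n x, (S.proj j ∘ₗ F ∘ₗ S.incl i) ((S.X i).Y u n x) =
      (S.X j).Y u n ((S.proj j ∘ₗ F ∘ₗ S.incl i) x) := by
    intro j u n x
    simp only [LinearMap.comp_apply]
    rw [← pi_incl, hF, proj_pi]
  obtain ⟨c, hc⟩ := (S.irreducible i).exists_eq_smul (orderOf_coe_pos (σ : G)) hcount _ (hcomp i)
  refine ⟨c, fun x => funext fun j => ?_⟩
  change (S.proj j ∘ₗ F ∘ₗ S.incl i) x = S.proj j (c • S.incl i x)
  by_cases h : i = j
  · subst h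
    rw [hc, map_smul, proj_incl]
  · rw [map_smul, proj_incl_ne S h, smul_zero]
    have h0 : S.proj j ∘ₗ F ∘ₗ S.incl i = 0 := by
      by_contra h0
      have hb := (S.irreducible i).bijective_of_ne_zero (S.irreducible j) _ (hcomp j) h0
      exact h (S.inequivalent i j ⟨LinearEquiv.ofBijective _ hb, hcomp j⟩)
    rw [h0, LinearMap.zero_apply]

/-- The modes of `V` are dense in the block diagonal operators. -/
theorem exists_modeSpan_eq [Fintype I] (f : Module.End ℂ S.Total)
    (hf : ∀ i x, f (S.incl i (S.proj i x)) = S.incl i (S.proj i (f x))) (t : Finset S.Total) :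
    ∃ d ∈ (TwistedModule.pi S.X).modeSpan, ∀ x ∈ t, f x = d x := by
  refine TwistedModule.exists_modeSpan_eq_of_commute _ (orderOf_coe_pos (σ : G))
    isSemisimpleModule_total f (fun F hF x => ?_) t
  choose c hc using exists_eq_smul_of_intertwining hcount F hF
  have hF' : ∀ y, F y = ∑ i, c i • S.incl i (S.proj i y) := by
    intro y
    conv_lhs => rw [← S.sum_incl_proj y, map_sum]
    simp only [hc]
  rw [hF', hF', map_sum]
  simp only [map_smul, hf]

omit hcount [Finite G] in
/-- The module with `N ≅ M ∘ g` is unique. -/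
theorem eq_of_intertwine {g : G} {i j k : I} (e : S.M i ≃ₗ[ℂ] S.M j) (e' : S.M i ≃ₗ[ℂ] S.M k)
    (he : ∀ u n x, e ((S.X i).Y u n x) = (S.X j).Y (g • u) n (e x))
    (he' : ∀ u n x, e' ((S.X i).Y u n x) = (S.X k).Y (g • u) n (e' x)) : j = k := by
  refine S.inequivalent j k ⟨e.symm.trans e', fun u n x => ?_⟩
  have h1 : e.symm ((S.X j).Y u n x) = (S.X i).Y (g⁻¹ • u) n (e.symm x) := by
    rw [LinearEquiv.symm_apply_eq, he, smul_inv_smul, LinearEquiv.apply_symm_apply]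
  rw [LinearEquiv.trans_apply, h1, he', smul_inv_smul, LinearEquiv.trans_apply]

/-- Two intertwining isomorphisms for the same group element differ by a scalar. -/
theorem exists_unit_of_intertwine {g : G} {i j k : I} (e : S.M i ≃ₗ[ℂ] S.M j)
    (e' : S.M i ≃ₗ[ℂ] S.M k)
    (he : ∀ u n x, e ((S.X i).Y u n x) = (S.X j).Y (g • u) n (e x))
    (he' : ∀ u n x, e' ((S.X i).Y u n x) = (S.X k).Y (g • u) n (e' x)) :
    ∃ c : ℂˣ, ∀ x, S.incl j (e x) = (c : ℂ) • S.incl k (e' x) := by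
  obtain rfl := eq_of_intertwine e e' he he'
  obtain ⟨c, hc⟩ := (S.irreducible i).exists_eq_smul (orderOf_coe_pos (σ : G)) hcount
    (e.trans e'.symm).toLinearMap (fun u n x => by
      change e'.symm (e _) = _
      rw [LinearEquiv.symm_apply_eq, he, he']
      change _ = (S.X j).Y (g • u) n (e' (e'.symm (e x)))
      rw [LinearEquiv.apply_symm_apply])
  have hc' : ∀ x, e x = c • e' x := by
    intro x
    have h : e'.symm (e x) = c • x := hc x
    rw [LinearEquiv.symm_apply_eq, map_smul] at h
    exact h
  have hc0 : c ≠ 0 := by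
    rintro rfl
    obtain ⟨x, hx⟩ := S.exists_ne i
    exact hx (by simpa using hc' x)
  exact ⟨Units.mk0 c hc0, fun x => by rw [hc', map_smul, Units.val_mk0]⟩

omit hcount [Finite G] in
theorem nonempty_transport (S : StableFamily.{u, v, w} G σ I) : Nonempty S.Transport := by
  have h : ∀ (g : G) (i : I), ∃ (j : I) (e : S.M i ≃ₗ[ℂ] S.M j),
      (∀ u n x, e ((S.X i).Y u n x) = (S.X j).Y (g • u) n (e x)) ∧
      (g = 1 → ∀ x, S.incl j (e x) = S.incl i x) := by
    intro g i
    by_cases hg : g = 1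
    · subst hg
      exact ⟨i, LinearEquiv.refl ℂ _, fun u n x => by simp, fun _ _ => rfl⟩
    · obtain ⟨j, f, hf⟩ := S.stable i g⁻¹
      refine ⟨j, f.symm, fun u n x => ?_, fun h => absurd h hg⟩
      rw [LinearEquiv.symm_apply_eq]
      refine Eq.trans ?_ (hf (g • u) n (f.symm x)).symm
      rw [LinearEquiv.apply_symm_apply]
      change _ = (S.X i).Y (g⁻¹ • g • u) n x
      rw [inv_smul_smul]
  choose tgt e he h1 using h
  exact ⟨⟨tgt, e, he, fun i x => h1 1 i rfl x⟩⟩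

theorem Transport.nonempty_scalars (φ : S.Transport) : Nonempty φ.Scalars := by
  have h : ∀ (j : I) (g h : G), ∃ c : ℂˣ, ∀ x : S.M j,
      S.incl (φ.tgt g (φ.tgt h j)) (φ.φ g (φ.tgt h j) (φ.φ h j x)) =
        (c : ℂ) • S.incl (φ.tgt (g * h) j) (φ.φ (g * h) j x) := by
    intro j g h
    exact exists_unit_of_intertwine hcount (g := g * h)
      ((φ.φ h j).trans (φ.φ g (φ.tgt h j))) (φ.φ (g * h) j) (fun u n x => by
        rw [LinearEquiv.trans_apply, φ.intertwine, φ.intertwine, mul_smul]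
        rfl) (fun u n x => φ.intertwine _ _ _ _ _)
  choose c hc using h
  exact ⟨⟨c, fun g h j x => hc j g h x⟩⟩

end

namespace Transport

variable (φ : S.Transport)

theorem op_pi [Finite I] (g : G) (i : I) (u : V) (n : ℚ) (x : S.Total) :
    φ.op (g, i) ((TwistedModule.pi S.X).Y u n x) =
      (TwistedModule.pi S.X).Y (g • u) n (φ.op (g, i) x) := by
  rw [op_apply, op_apply, proj_pi, φ.intertwine, pi_incl]

/-- The operator `⨁ φ_N(g)` on the sum of the family. -/
def totalOp [Fintype I] (g : G) : Module.End ℂ S.Total := ∑ i, φ.op (g, i)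

theorem totalOp_pi [Fintype I] (g : G) (u : V) (n : ℚ) (x : S.Total) :
    φ.totalOp g ((TwistedModule.pi S.X).Y u n x) =
      (TwistedModule.pi S.X).Y (g • u) n (φ.totalOp g x) := by
  simp only [totalOp, LinearMap.sum_apply, op_pi, map_sum]

theorem totalOp_incl [Fintype I] (g : G) (i : I) (x : S.M i) :
    φ.totalOp g (S.incl i x) = φ.op (g, i) (S.incl i x) := by
  rw [totalOp, LinearMap.sum_apply, Finset.sum_eq_single i]
  · intro j _ hj
    rw [op_apply, proj_incl_ne S hj.symm, map_zero, map_zero]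
  · simp

namespace Scalars

variable {φ} (s : φ.Scalars)

include s in
theorem totalOp_surjective [Fintype I] (g : G) : Function.Surjective (φ.totalOp g) := by
  rw [← LinearMap.range_eq_top, ← top_le_iff]
  intro x _
  rw [← S.sum_incl_proj x]
  refine Submodule.sum_mem _ fun i _ => ?_
  have h1 := s.op_op g g⁻¹ _ i (S.incl i (S.proj i x)) rfl
  rw [mul_inv_cancel, op_one, proj_incl, op_apply φ g⁻¹, ← totalOp_incl] at h1
  have h2 : S.incl i (S.proj i x) =
      ((s.α i g g⁻¹)⁻¹ : ℂˣ).val • ((s.α i g g⁻¹ : ℂ) • S.incl i (S.proj i x)) := by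
    rw [smul_smul, Units.inv_mul, one_smul]
  rw [h2, ← h1]
  exact Submodule.smul_mem _ _ ⟨_, rfl⟩

section

variable [Fintype I]

theorem basis_smul (p : G × I) (x : S.Total) : s.cocycle.basis p • x = φ.op p x := by
  rw [smul_def, rep_basis]

variable [Finite G]

/-- The conjugates of a combination of modes of `V` by the operators `⨁ φ_N(g)` add up to a
combination of modes of `V^G`. -/
theorem modeSpan_average [Fintype G] (φ : S.Transport) {d : Module.End ℂ S.Total}
    (hd : d ∈ (TwistedModule.pi S.X).modeSpan) : ∃ D : G → Module.End ℂ S.Total,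
      (∀ g x, D g (φ.totalOp g x) = φ.totalOp g (d x)) ∧ ∑ g, D g ∈ S.total.modeSpan := by
  induction hd using Submodule.span_induction with
  | mem d hd =>
    obtain ⟨⟨u, n⟩, rfl⟩ := hd
    refine ⟨fun g => (TwistedModule.pi S.X).Y (g • u) n, fun g x => (φ.totalOp_pi g u n x).symm, ?_⟩
    let a : fixed G := ⟨∑ g : G, g • u, fun h hh => by
      rw [Finset.smul_sum]
      refine Fintype.sum_equiv (Equiv.mulLeft (⟨h, hh⟩ : G)) _ _ fun g => ?_
      rw [Equiv.coe_mulLeft, mul_smul]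
      rfl⟩
    have h : ∑ g : G, (TwistedModule.pi S.X).Y (g • u) n = S.total.Y a n := by
      rw [← Finset.sum_apply, ← map_sum]
      rfl
    rw [h]
    exact Submodule.subset_span ⟨(a, n), rfl⟩
  | zero => exact ⟨0, fun g x => by simp, by simp⟩
  | add x y _ _ hx hy =>
    obtain ⟨D, h, hD⟩ := hx
    obtain ⟨D', h', hD'⟩ := hy
    exact ⟨D + D', fun g x => by simp [h, h'], by
      simpa [Finset.sum_add_distrib] using add_mem hD hD'⟩
  | smul c x _ hx =>
    obtain ⟨D, h, hD⟩ := hx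
    exact ⟨c • D, fun g x => by simp [h], by
      simpa [← Finset.smul_sum] using Submodule.smul_mem _ c hD⟩

/-- The modes of `V^G` are dense in the commutant of `𝒜_α(G, 𝒮)`: average over `G` a combination
of modes of `V` that agrees with the given operator on a `G`-stable finite set. -/
theorem exists_total_modeSpan_eq (hcount : Module.rank ℂ V ≤ Cardinal.aleph0)
    (f : S.Total →ₗ[s.Alg] S.Total) (t : Finset S.Total) :
    ∃ d ∈ S.total.modeSpan, ∀ x ∈ t, f x = d x := by
  classical
  have := Fintype.ofFinite G
  have hop : ∀ p x, f (φ.op p x) = φ.op p (f x) := by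
    intro p x
    rw [← s.basis_smul, map_smul, s.basis_smul]
  have htotal : ∀ g x, f (φ.totalOp g x) = φ.totalOp g (f x) := by
    intro g x
    simp only [totalOp, LinearMap.sum_apply, map_sum, hop]
  let f' : Module.End ℂ S.Total := f.restrictScalars ℂ
  choose y hy using s.totalOp_surjective
  obtain ⟨d, hd, hdf⟩ := exists_modeSpan_eq hcount f' (fun i x => by
    rw [← op_one (φ := φ), ← op_one (φ := φ)]
    exact hop _ x) (Finset.univ.biUnion fun g : G => t.image (y g))
  obtain ⟨D, hD, hDS⟩ := modeSpan_average φ hd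
  refine ⟨(Fintype.card G : ℂ)⁻¹ • ∑ g, D g, Submodule.smul_mem _ _ hDS, fun x hx => ?_⟩
  have h : ∀ g, D g x = f x := by
    intro g
    have h1 : f (y g x) = d (y g x) := hdf _ (Finset.mem_biUnion.mpr
      ⟨g, Finset.mem_univ g, Finset.mem_image_of_mem _ hx⟩)
    conv_lhs => rw [← hy g x]
    rw [hD, ← h1, ← htotal, hy]
  have hcard : (Fintype.card G : ℂ) ≠ 0 := Nat.cast_ne_zero.mpr Fintype.card_ne_zero
  simp [LinearMap.sum_apply, h, ← Nat.cast_smul_eq_nsmul ℂ, smul_smul, hcard]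

end

/-! ### Faithfulness of the twisted group algebras -/

theorem stabOp_Y [Finite I] (j : I) (g : S.stab j) (u : V) (n : ℚ) (x : S.M j) :
    stabOp φ j g ((S.X j).Y u n x) = (S.X j).Y ((g : G) • u) n (stabOp φ j g x) := by
  apply incl_inj
  rw [incl_stabOp, ← pi_incl, op_pi, ← incl_stabOp, pi_incl]

/-- The operators `φ_M(g)`, for `g` in the stabilizer of `M`, are linearly independent.  As in
Dedekind's lemma, a relation with coefficients `c_g` gives, by means of
`φ_M(g) Y(u, z) = Y(g u, z) φ_M(g)`, the relations with coefficients `c_g ξ(g u)`. -/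
theorem eq_zero_of_sum_stabOp_eq_zero [Finite G] [Finite I] (φ : S.Transport)
    (hcount : Module.rank ℂ V ≤ Cardinal.aleph0) (hsimple : IsSimple V) (j : I)
    [Fintype (S.stab j)] (c : S.stab j → ℂ) (hc : ∀ x, ∑ g, c g • stabOp φ j g x = 0) :
    c = 0 := by
  classical
  suffices h : ∀ t : Finset (S.stab j), ∀ c : S.stab j → ℂ, (∀ g ∉ t, c g = 0) →
      (∀ x, ∑ g, c g • stabOp φ j g x = 0) → c = 0 from
    h Finset.univ c (fun g hg => absurd (Finset.mem_univ g) hg) hc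
  intro t
  induction t using Finset.induction_on with
  | empty => exact fun c h _ => funext fun g => h g (Finset.notMem_empty g)
  | insert g₁ t hg₁ ih =>
    intro c hct hc
    have hrel : ∀ (ξ : Module.Dual ℂ V) (u : V) (x : S.M j),
        ∑ g : S.stab j, (c g * ξ ((g : G) • u)) • stabOp φ j g x = 0 := by
      intro ξ u x
      have h := (S.irreducible j).sum_dual_smul_eq_zero (orderOf_coe_pos (σ : G)) hcount hsimple
        (fun g : S.stab j => (g : G) • u) (fun g => c g • stabOp φ j g x) (fun n => by
          simp only [map_smul, ← stabOp_Y]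
          exact hc _) ξ
      simpa only [smul_smul, mul_comm] using h
    have hsub : ∀ (ξ : Module.Dual ℂ V) (u : V) (g : S.stab j),
        c g * (ξ ((g : G) • u) - ξ ((g₁ : G) • u)) = 0 := by
      intro ξ u
      refine congrFun (ih (fun g => c g * (ξ ((g : G) • u) - ξ ((g₁ : G) • u))) ?_ fun x => ?_)
      · intro g hg
        by_cases h : g = g₁
        · simp [h]
        · rw [hct g (by simp [h, hg]), zero_mul]
      · have h1 := hrel ξ u x
        have h2 := congrArg (ξ ((g₁ : G) • u) • ·) (hc x)
        simp only [smul_zero, Finset.smul_sum, smul_smul] at h2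
        simp only [mul_sub, sub_smul, Finset.sum_sub_distrib, h1]
        simpa only [zero_sub, neg_eq_zero, mul_comm] using h2
    have hct' : ∀ g, g ≠ g₁ → c g = 0 := by
      intro g hg
      by_contra hcg
      refine hg (Subtype.ext (Subtype.ext (Subtype.ext (LinearEquiv.ext fun u => ?_))))
      by_contra hne
      obtain ⟨ξ, hξ⟩ := Module.Projective.exists_dual_ne_zero ℂ (sub_ne_zero.mpr hne)
      have h := (mul_eq_zero.mp (hsub ξ u g)).resolve_left hcg
      rw [← map_sub] at h
      exact hξ h
    obtain ⟨x, hx⟩ := S.exists_ne j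
    have h := hc x
    rw [Finset.sum_eq_single g₁ (fun g _ hg => by rw [hct' g hg, zero_smul])
      (fun h => absurd (Finset.mem_univ _) h)] at h
    have h1 : stabOp φ j g₁ x ≠ 0 := fun h0 => op_ne (φ := φ) (g := (g₁ : G)) hx (by
      rw [← incl_stabOp, h0, map_zero])
    funext g
    by_cases hg : g = g₁
    · rw [hg]
      exact (smul_eq_zero.mp h).resolve_right h1
    · exact hct' g hg

/-- The twisted group algebra `ℂ^{α_M}[G_M]` acts faithfully on `M`. -/
theorem eq_zero_of_stab_smul_eq_zero [Finite G] [Finite I]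
    (hcount : Module.rank ℂ V ≤ Cardinal.aleph0) (hsimple : IsSimple V) (j : I)
    {a : s.StabAlg j} (ha : ∀ x : S.M j, a • x = 0) : a = 0 := by
  have := Fintype.ofFinite (S.stab j)
  let b := (s.stabCocycle j).basis
  have hrepr := b.sum_repr a
  have h : (fun g : S.stab j => b.repr a (g, ())) = 0 := by
    refine eq_zero_of_sum_stabOp_eq_zero φ hcount hsimple j _ fun x => ?_
    rw [← ha x, stab_smul_def]
    conv_rhs => rw [← hrepr, map_sum, LinearMap.sum_apply]
    rw [Fintype.sum_prod_type]
    refine Finset.sum_congr rfl fun g _ => ?_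
    rw [Fintype.sum_unique, map_smul, LinearMap.smul_apply]
    congr 1
    have e : s.stabRep j (b (g, ())) = stabOp φ j g :=
      (s.stabCocycle j).basis.constr_basis ℂ _ (g, ())
    rw [e]
  rw [← hrepr]
  exact Finset.sum_eq_zero fun p _ => by
    have h1 : b.repr a p = 0 := congrFun h p.1
    rw [h1, zero_smul]

end Scalars
end Transport
end StableFamily

/-! ### Semisimplicity of the algebras of a cocycle -/

namespace ActionCocycle

variable {G : Type u} [Group G] {I : Type v} (c : ActionCocycle G I)

theorem basis_mul_basis_of_eq {g h : G} {i j : I} (hij : i = c.act h j) [Fintype I] :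
    c.basis (g, i) * c.basis (h, j) = (c.α j g h : ℂ) • c.basis (g * h, j) := by
  rw [basis_mul_basis, basisMul, if_pos hij]

theorem basis_mul_basis_of_ne {g h : G} {i j : I} (hij : i ≠ c.act h j) [Fintype I] :
    c.basis (g, i) * c.basis (h, j) = 0 := by
  rw [basis_mul_basis, basisMul, if_neg hij]

theorem act_injective (g : G) : Function.Injective (c.act g) := fun i j h => by
  rw [← c.act_one i, ← c.act_one j, ← inv_mul_cancel g, c.act_mul, c.act_mul, h]

/-- The action of a group element as a permutation. -/
def actEquiv (g : G) : I ≃ I where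
  toFun := c.act g
  invFun := c.act g⁻¹
  left_inv i := by rw [← c.act_mul, inv_mul_cancel, c.act_one]
  right_inv i := by rw [← c.act_mul, mul_inv_cancel, c.act_one]

theorem α_inv_right (g : G) (i : I) : c.α (c.act g i) g g⁻¹ = c.α i g⁻¹ g := by
  have h := c.cocycle i g g⁻¹ g
  rwa [inv_mul_cancel, mul_inv_cancel, c.one_right, c.one_left, one_mul, mul_one, eq_comm] at h

variable [Fintype I]

/-- The inverse of `g ⊗ e(i)` in the groupoid of basis vectors. -/
def invBasis (p : G × I) : c.Alg :=
  ((c.α p.2 p.1⁻¹ p.1)⁻¹ : ℂˣ).val • c.basis (p.1⁻¹, c.act p.1 p.2)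

theorem basis_mul_invBasis (g : G) (i : I) :
    c.basis (g, i) * c.invBasis (g, i) = c.basis (1, c.act g i) := by
  rw [invBasis, mul_smul_comm, basis_mul_basis_of_eq, α_inv_right, smul_smul, Units.inv_mul,
    one_smul, mul_inv_cancel]
  rw [← c.act_mul, inv_mul_cancel, c.act_one]

theorem invBasis_mul_basis (g : G) (i : I) :
    c.invBasis (g, i) * c.basis (g, i) = c.basis (1, i) := by
  rw [invBasis, smul_mul_assoc, basis_mul_basis_of_eq c rfl, smul_smul, Units.inv_mul,
    one_smul, inv_mul_cancel]

/-- A form of Maschke's theorem: `|G|⁻¹ ∑ (g ⊗ e(i)) ⊗ (g ⊗ e(i))⁻¹` is a separability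
idempotent, where the inverses are taken in the groupoid of basis vectors. -/
theorem isSemisimpleRing [Finite G] : IsSemisimpleRing c.Alg := by
  have := Fintype.ofFinite G
  have hcard : (Fintype.card G : ℂ) ≠ 0 := Nat.cast_ne_zero.mpr Fintype.card_ne_zero
  refine isSemisimpleRing_of_separability
    (fun p : G × I => (Fintype.card G : ℂ)⁻¹ • c.basis p) c.invBasis ?_ fun a => ?_
  · simp only [smul_mul_assoc, ← Finset.smul_sum, Fintype.sum_prod_type, basis_mul_invBasis]
    have h : ∀ g : G, ∑ i, c.basis (1, c.act g i) = 1 := fun g => by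
      rw [one_eq]
      exact Fintype.sum_equiv (c.actEquiv g) _ _ fun _ => rfl
    simp only [h, Finset.sum_const, Finset.card_univ, ← Nat.cast_smul_eq_nsmul ℂ, smul_smul,
      inv_mul_cancel₀ hcard, one_smul]
  · simp only [mul_smul_comm, ← TensorProduct.smul_tmul', ← Finset.smul_sum]
    congr 1
    let L : c.Alg →ₗ[ℂ] c.Alg ⊗[ℂ] c.Alg := ∑ p : G × I,
      (TensorProduct.mk ℂ c.Alg c.Alg).flip (c.invBasis p) ∘ₗ LinearMap.mulRight ℂ (c.basis p)
    let R : c.Alg →ₗ[ℂ] c.Alg ⊗[ℂ] c.Alg := ∑ p : G × I,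
      TensorProduct.mk ℂ c.Alg c.Alg (c.basis p) ∘ₗ LinearMap.mulLeft ℂ (c.invBasis p)
    have hLR : L = R := by
      refine c.basis.ext fun ⟨h, j⟩ => ?_
      simp only [L, R, LinearMap.sum_apply, LinearMap.comp_apply, LinearMap.flip_apply,
        LinearMap.mulRight_apply, LinearMap.mulLeft_apply, TensorProduct.mk_apply]
      refine Fintype.sum_equiv ((Equiv.mulLeft h).prodCongr (Equiv.refl I)) _ _ fun ⟨g, i⟩ => ?_
      change (c.basis (h, j) * c.basis (g, i)) ⊗ₜ[ℂ] c.invBasis (g, i) =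
        c.basis (h * g, i) ⊗ₜ[ℂ] (c.invBasis (h * g, i) * c.basis (h, j))
      by_cases hj : j = c.act g i
      · subst hj
        rw [basis_mul_basis_of_eq c rfl, invBasis, invBasis, smul_mul_assoc,
          basis_mul_basis_of_eq c (c.act_mul h g i), smul_smul, ← TensorProduct.smul_tmul',
          TensorProduct.tmul_smul, TensorProduct.tmul_smul, smul_smul]
        have h1 : (h * g)⁻¹ * h = g⁻¹ := by group
        have h2 := c.cocycle i (h * g)⁻¹ h g
        simp only [h1] at h2 ⊢
        congr 1
        rw [← Units.val_mul, ← Units.val_mul]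
        congr 1
        rw [mul_inv_eq_iff_eq_mul, mul_assoc, ← h2, inv_mul_cancel_left]
      · have hj' : c.act (h * g) i ≠ c.act h j := fun h' =>
          hj (c.act_injective h ((c.act_mul h g i).symm.trans h')).symm
        rw [basis_mul_basis_of_ne c hj, invBasis, invBasis, smul_mul_assoc,
          basis_mul_basis_of_ne c hj', smul_zero, TensorProduct.zero_tmul, TensorProduct.tmul_zero]
    have h := LinearMap.congr_fun hLR a
    simpa only [L, R, LinearMap.sum_apply, LinearMap.comp_apply, LinearMap.flip_apply,
      LinearMap.mulRight_apply, LinearMap.mulLeft_apply, TensorProduct.mk_apply] using h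

theorem finiteDimensional [Finite G] : FiniteDimensional ℂ c.Alg :=
  Module.Finite.of_basis c.basis

end ActionCocycle

/-! ### Induction from the twisted group algebra of a stabilizer -/

namespace StableFamily

variable {V : Type u} [AddCommGroup V] [Module ℂ V] [VertexAlgebra V]
  {G : Subgroup (Aut V)} {σ : Subgroup.center G} {I : Type w}
  {S : StableFamily.{u, v, w} G σ I}

theorem iso_conj_iff_tgt_eq (φ : S.Transport) (g : G) (i j : I) :
    (S.X i).Iso ((S.X j).conj g (center_comm σ g)) ↔ φ.tgt g i = j := by
  constructor
  · rintro ⟨f, hf⟩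
    exact eq_of_intertwine (φ.φ g i) f (φ.intertwine g i) hf
  · rintro rfl
    exact ⟨φ.φ g i, φ.intertwine g i⟩

theorem mem_stab_of_tgt_eq (φ : S.Transport) {g : G} {j : I} (h : φ.tgt g j = j) :
    g ∈ S.stab j := by
  obtain ⟨f, hf⟩ := (iso_conj_iff_tgt_eq φ g j j).mpr h
  refine ⟨f.symm, fun u n x => ?_⟩
  rw [LinearEquiv.symm_apply_eq, hf, LinearEquiv.apply_symm_apply]

namespace Transport
namespace Scalars

variable {φ : S.Transport} (s : φ.Scalars)

instance [Finite G] [Fintype I] : IsSemisimpleRing s.Alg := s.cocycle.isSemisimpleRing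

instance [Finite G] [Fintype I] : FiniteDimensional ℂ s.Alg := s.cocycle.finiteDimensional

instance [Finite G] (j : I) : IsSemisimpleRing (s.StabAlg j) :=
  (s.stabCocycle j).isSemisimpleRing

theorem stabIncl_basis (j : I) (g : S.stab j) :
    s.stabIncl j ((s.stabCocycle j).basis (g, ())) = s.cocycle.basis ((g : G), j) :=
  (s.stabCocycle j).basis.constr_basis ℂ _ (g, ())

/-- The idempotent `1 ⊗ e(M)`. -/
def idem (j : I) : s.Alg := s.cocycle.basis (1, j)

theorem stabIncl_one (j : I) : s.stabIncl j 1 = s.idem j := by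
  rw [ActionCocycle.one_eq, Fintype.sum_unique]
  exact s.stabIncl_basis j 1

section

variable [Fintype I] (j : I)

theorem idem_smul_total (x : S.Total) : s.idem j • x = S.incl j (S.proj j x) := by
  rw [idem, basis_smul, op_one]

theorem basis_mul_idem (g : G) : s.cocycle.basis (g, j) * s.idem j = s.cocycle.basis (g, j) := by
  rw [idem, ActionCocycle.basis_mul_basis_of_eq _ (s.cocycle.act_one j).symm, s.cocycle.one_right,
    Units.val_one, one_smul, mul_one]

theorem idem_mul_basis (g : G) :
    s.idem (φ.tgt g j) * s.cocycle.basis (g, j) = s.cocycle.basis (g, j) := by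
  rw [idem, ActionCocycle.basis_mul_basis_of_eq _ (rfl : φ.tgt g j = s.cocycle.act g j),
    s.cocycle.one_left, Units.val_one, one_smul, one_mul]

theorem idem_mul_basis_of_ne {g : G} {i : I} (h : φ.tgt g j ≠ i) :
    s.idem i * s.cocycle.basis (g, j) = 0 :=
  ActionCocycle.basis_mul_basis_of_ne _ (Ne.symm h)

theorem basis_mem_D (g : G) : s.cocycle.basis (g, j) ∈ s.D j :=
  Submodule.subset_span (R := ℂ) ⟨g, rfl⟩

/-- The element `1 ⊗ e(M)` of `D(M)`. -/
def idemD : s.D j := ⟨s.idem j, s.basis_mem_D j 1⟩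

theorem D_induction {p : s.Alg → Prop} (hb : ∀ g, p (s.cocycle.basis (g, j))) (h0 : p 0)
    (hadd : ∀ x y, p x → p y → p (x + y)) (hsmul : ∀ (c : ℂ) x, p x → p (c • x)) (x : s.D j) :
    p x := by
  obtain ⟨x, hx⟩ := x
  change x ∈ Submodule.span ℂ (Set.range fun g : G => s.cocycle.basis (g, j)) at hx
  change p x
  induction hx using Submodule.span_induction with
  | mem x hx =>
    obtain ⟨g, rfl⟩ := hx
    exact hb g
  | zero => exact h0
  | add x y _ _ hx hy => exact hadd x y hx hy
  | smul c x _ hx => exact hsmul c x hx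

theorem D_mul_idem (x : s.D j) : (x : s.Alg) * s.idem j = x := by
  refine s.D_induction j (p := fun x => x * s.idem j = x) (s.basis_mul_idem j) (zero_mul _)
    (fun x y hx hy => ?_) (fun c x hx => ?_) x
  · rw [add_mul, hx, hy]
  · rw [smul_mul_assoc, hx]

theorem stabIncl_mul (a b : s.StabAlg j) :
    s.stabIncl j (a * b) = s.stabIncl j a * s.stabIncl j b := by
  have h : (LinearMap.mul ℂ (s.StabAlg j)).compr₂ (s.stabIncl j) =
      (LinearMap.mul ℂ s.Alg).compl₁₂ (s.stabIncl j) (s.stabIncl j) := by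
    refine (s.stabCocycle j).basis.ext fun ⟨g, _⟩ => (s.stabCocycle j).basis.ext fun ⟨h, _⟩ => ?_
    change s.stabIncl j (_ * _) = s.stabIncl j _ * s.stabIncl j _
    rw [ActionCocycle.basis_mul_basis_of_eq _ rfl, map_smul]
    erw [s.stabIncl_basis j g, s.stabIncl_basis j h, s.stabIncl_basis j (g * h)]
    rw [ActionCocycle.basis_mul_basis_of_eq _ (tgt_stab φ h.2).symm]
    rfl
  exact LinearMap.congr_fun (LinearMap.congr_fun h a) b

theorem idem_mul_idem : s.idem j * s.idem j = s.idem j := by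
  rw [← stabIncl_one, ← stabIncl_mul, one_mul]

theorem idem_mul_stabIncl (a : s.StabAlg j) : s.idem j * s.stabIncl j a = s.stabIncl j a := by
  rw [← stabIncl_one, ← stabIncl_mul, one_mul]

/-- `e(M) D(M) = S(M)`. -/
theorem exists_stabIncl_eq (x : s.D j) : ∃ a, s.idem j * x = s.stabIncl j a := by
  refine s.D_induction j (p := fun x => ∃ a, s.idem j * x = s.stabIncl j a) (fun g => ?_)
    ⟨0, by simp⟩ ?_ ?_ x
  · by_cases hg : φ.tgt g j = j
    · refine ⟨(s.stabCocycle j).basis (⟨g, mem_stab_of_tgt_eq φ hg⟩, ()), ?_⟩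
      rw [stabIncl_basis]
      conv_rhs => rw [← idem_mul_basis, hg]
    · exact ⟨0, by rw [idem_mul_basis_of_ne _ _ hg, map_zero]⟩
  · rintro x y ⟨a, ha⟩ ⟨b, hb⟩
    exact ⟨a + b, by rw [mul_add, ha, hb, map_add]⟩
  · rintro c x ⟨a, ha⟩
    exact ⟨c • a, by rw [mul_smul_comm, ha, map_smul]⟩

/-- The subspace `e(M) L` of an `𝒜_α(G, 𝒮)`-module `L`, a module for `ℂ^{α_M}[G_M]`. -/
def Corner (L : Type*) [AddCommGroup L] [Module ℂ L] [Module s.Alg L] [IsScalarTower ℂ s.Alg L] :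
    Submodule ℂ L where
  carrier := {x | s.idem j • x = x}
  add_mem' := by
    intro x y (hx : _ = _) (hy : _ = _)
    change _ = _
    rw [smul_add, hx, hy]
  zero_mem' := smul_zero _
  smul_mem' := by
    intro c x (hx : _ = _)
    change _ = _
    rw [smul_comm, hx]

section Corner

variable (L : Type*) [AddCommGroup L] [Module ℂ L] [Module s.Alg L] [IsScalarTower ℂ s.Alg L]

theorem idem_smul_corner (x : s.Corner j L) : s.idem j • (x : L) = x := x.2

instance : Module (s.StabAlg j) (s.Corner j L) where
  smul a x := ⟨s.stabIncl j a • (x : L), by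
    change s.idem j • _ = _
    rw [smul_smul, idem_mul_stabIncl]⟩
  one_smul x := Subtype.ext (by
    change s.stabIncl j 1 • (x : L) = x
    rw [stabIncl_one, idem_smul_corner])
  mul_smul a b x := Subtype.ext (by
    change s.stabIncl j (a * b) • (x : L) = s.stabIncl j a • s.stabIncl j b • (x : L)
    rw [stabIncl_mul, mul_smul])
  smul_zero a := Subtype.ext (smul_zero (s.stabIncl j a))
  smul_add a x y := Subtype.ext (smul_add (s.stabIncl j a) (x : L) y)
  add_smul a b x := Subtype.ext (by
    change s.stabIncl j (a + b) • (x : L) = s.stabIncl j a • (x : L) + s.stabIncl j b • (x : L)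
    rw [map_add, add_smul])
  zero_smul x := Subtype.ext (by
    change s.stabIncl j 0 • (x : L) = 0
    rw [map_zero, zero_smul])

theorem coe_corner_smul (a : s.StabAlg j) (x : s.Corner j L) :
    ((a • x : s.Corner j L) : L) = s.stabIncl j a • (x : L) := rfl

instance : IsScalarTower ℂ (s.StabAlg j) (s.Corner j L) where
  smul_assoc c a x := Subtype.ext (by
    rw [coe_corner_smul, map_smul, smul_assoc]
    rfl)

end Corner

end

end Scalars
end Transport
end StableFamily

/-- Every simple module of a semisimple ring embeds into every faithful module. -/
theorem exists_hom_ne_zero_of_faithful {A : Type*} [Ring A] [IsSemisimpleRing A] {M : Type*}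
    [AddCommGroup M] [Module A M] (hM : ∀ a : A, (∀ x : M, a • x = 0) → a = 0) (W : Type*)
    [AddCommGroup W] [Module A W] [IsSimpleModule A W] : ∃ f : W →ₗ[A] M, f ≠ 0 := by
  obtain ⟨N, ⟨e⟩⟩ := IsSemisimpleRing.exists_linearEquiv_ideal_of_isSimpleModule A W
  have := IsSimpleModule.nontrivial A W
  obtain ⟨y, hy⟩ := _root_.exists_ne (0 : W)
  have h : ¬ ∀ x : M, (e y : A) • x = 0 := fun h =>
    hy (e.map_eq_zero_iff.mp (Subtype.ext (hM _ h)))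
  push Not at h
  obtain ⟨x, hx⟩ := h
  exact ⟨LinearMap.toSpanSingleton A M x ∘ₗ N.subtype ∘ₗ e.toLinearMap, fun h0 =>
    hx (LinearMap.congr_fun h0 y)⟩

namespace StableFamily

variable {V : Type u} [AddCommGroup V] [Module ℂ V] [VertexAlgebra V]
  {G : Subgroup (Aut V)} {σ : Subgroup.center G} {I : Type w}
  {S : StableFamily.{u, v, w} G σ I}

namespace Transport
namespace Scalars

variable {φ : S.Transport} (s : φ.Scalars)

section Induced

variable [Fintype I] (j : I) {W : Type*} [AddCommGroup W] [Module ℂ W] [Module (s.StabAlg j) W]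

/-- The map `W → D(M) ⊗ W`, `y ↦ e(M) ⊗ y`, to the induced module. -/
def indUnit : W →ₗ[ℂ] s.Ind j W where
  toFun y := Submodule.Quotient.mk (s.idemD j ⊗ₜ y)
  map_add' x y := by rw [TensorProduct.tmul_add]; rfl
  map_smul' c y := by rw [TensorProduct.tmul_smul]; rfl

theorem mk_tmul (x : s.D j) (y : W) :
    (Submodule.Quotient.mk (x ⊗ₜ y) : s.Ind j W) = (x : s.Alg) • s.indUnit j y := by
  change _ = Submodule.Quotient.mk ((x : s.Alg) • (s.idemD j ⊗ₜ[ℂ] y))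
  rw [TensorProduct.smul_tmul']
  congr 2
  exact Subtype.ext (s.D_mul_idem j x).symm

theorem stabIncl_mem_D (a : s.StabAlg j) : s.stabIncl j a ∈ s.D j := by
  have h := s.mul_stabIncl_mem j (s.idemD j) a
  have h1 : (s.idemD j : s.Alg) = s.idem j := rfl
  rwa [h1, idem_mul_stabIncl] at h

theorem stabIncl_smul_indUnit (a : s.StabAlg j) (y : W) :
    s.stabIncl j a • s.indUnit j y = s.indUnit j (a • y) := by
  rw [← s.mk_tmul j ⟨_, s.stabIncl_mem_D j a⟩ y]
  refine (Submodule.Quotient.eq _).mpr (Submodule.subset_span ⟨s.idemD j, a, y, ?_⟩)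
  congr 2
  exact Subtype.ext (s.idem_mul_stabIncl j a).symm

theorem idem_smul_indUnit (y : W) : s.idem j • s.indUnit j y = s.indUnit j y := by
  rw [← stabIncl_one, stabIncl_smul_indUnit, one_smul]

theorem ind_induction {p : s.Ind j W → Prop} (h0 : p 0) (hadd : ∀ x y, p x → p y → p (x + y))
    (hunit : ∀ (x : s.D j) (y : W), p ((x : s.Alg) • s.indUnit j y)) (t : s.Ind j W) : p t := by
  obtain ⟨t, rfl⟩ := Submodule.Quotient.mk_surjective _ t
  induction t using TensorProduct.induction_on with
  | zero => exact h0
  | tmul x y => rw [mk_tmul]; exact hunit x y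
  | add x y hx hy => exact hadd _ _ hx hy

/-- The vectors of `e(M) (D(M) ⊗ W)` are those of `e(M) ⊗ W`. -/
theorem exists_indUnit_eq (t : s.Ind j W) : ∃ y, s.idem j • t = s.indUnit j y := by
  refine s.ind_induction j (p := fun t => ∃ y, s.idem j • t = s.indUnit j y) ⟨0, by simp⟩ ?_ ?_ t
  · rintro x y ⟨a, ha⟩ ⟨b, hb⟩
    exact ⟨a + b, by rw [smul_add, ha, hb, map_add]⟩
  · intro x y
    obtain ⟨a, ha⟩ := s.exists_stabIncl_eq j x
    exact ⟨a • y, by rw [smul_smul, ha, stabIncl_smul_indUnit]⟩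

/-- If `e(M')` does not annihilate the module induced from `S(M)`, then `M'` is in the orbit
of `M`. -/
theorem exists_tgt_eq_of_idem_smul_ne_zero {i : I} {t : s.Ind j W} (ht : s.idem i • t ≠ 0) :
    ∃ g, φ.tgt g j = i := by
  by_contra! h
  refine ht (s.ind_induction j (p := fun t => s.idem i • t = 0) (smul_zero _) ?_ ?_ t)
  · intro x y hx hy
    rw [smul_add, hx, hy, add_zero]
  · intro x y
    rw [smul_smul]
    have hx : s.idem i * (x : s.Alg) = 0 := by
      refine s.D_induction j (p := fun x => s.idem i * x = 0)
        (fun g => s.idem_mul_basis_of_ne j (h g)) (mul_zero _) ?_ ?_ x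
      · intro x y hx hy
        rw [mul_add, hx, hy, add_zero]
      · intro c x hx
        rw [mul_smul_comm, hx, smul_zero]
    rw [hx, zero_smul]

theorem ind_hom_ext {L : Type*} [AddCommGroup L] [Module s.Alg L]
    {F F' : s.Ind j W →ₗ[s.Alg] L}
    (h : ∀ y, F (s.indUnit j y) = F' (s.indUnit j y)) : F = F' := by
  refine LinearMap.ext fun t => s.ind_induction j (p := fun t => F t = F' t) (by simp) ?_ ?_ t
  · intro x y hx hy
    rw [map_add, map_add, hx, hy]
  · intro x y
    rw [map_smul, map_smul, h]

section Lift

variable [IsScalarTower ℂ (s.StabAlg j) W] {L : Type*} [AddCommGroup L] [Module ℂ L]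
  [Module s.Alg L] [IsScalarTower ℂ s.Alg L]

/-- Frobenius reciprocity: a `ℂ^{α_M}[G_M]`-linear map `W → e(M) L` extends to the induced
module. -/
def indLift (f : W →ₗ[s.StabAlg j] s.Corner j L) : s.Ind j W →ₗ[s.Alg] L :=
  (s.indRel j W).liftQ (TensorProduct.AlgebraTensorModule.lift
    (LinearMap.toSpanSingleton s.Alg (W →ₗ[ℂ] L)
      ((s.Corner j L).subtype ∘ₗ f.restrictScalars ℂ) ∘ₗ (s.D j).subtype)) (by
    rw [indRel, Submodule.span_le]
    rintro _ ⟨x, a, y, rfl⟩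
    rw [SetLike.mem_coe, LinearMap.mem_ker, map_sub, sub_eq_zero]
    change ((x : s.Alg) * s.stabIncl j a) • (f y : L) = (x : s.Alg) • (f (a • y) : L)
    rw [f.map_smul, coe_corner_smul, mul_smul])

theorem indLift_indUnit (f : W →ₗ[s.StabAlg j] s.Corner j L) (y : W) :
    s.indLift j f (s.indUnit j y) = f y :=
  (f y).2

/-- The restriction of a homomorphism from the induced module to `W`. -/
def indRestrict (F : s.Ind j W →ₗ[s.Alg] L) : W →ₗ[s.StabAlg j] s.Corner j L where
  toFun y := ⟨F (s.indUnit j y), by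
    change s.idem j • _ = _
    rw [← map_smul, idem_smul_indUnit]⟩
  map_add' x y := Subtype.ext (by simp)
  map_smul' a y := Subtype.ext ((congrArg F (s.stabIncl_smul_indUnit j a y).symm).trans
    (F.map_smul _ _))

end Lift

section Simple

variable [IsSimpleModule (s.StabAlg j) W]

/-- Modules induced from simple modules are simple: of two complementary submodules, one contains
`e(M) ⊗ W`, which generates the induced module. -/
theorem isSimpleModule_ind [Finite G] [Nontrivial (s.Ind j W)] :
    IsSimpleModule s.Alg (s.Ind j W) := by
  -- the vectors `y` of `W` with `e(M) ⊗ y` in a submodule form `0` or `W`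
  have hdich : ∀ N : Submodule s.Alg (s.Ind j W),
      (∀ t ∈ N, s.idem j • t = 0) ∨ N = ⊤ := by
    intro N
    let K : Submodule (s.StabAlg j) W :=
      { carrier := {y | s.indUnit j y ∈ N}
        add_mem' := fun {x y} hx hy => by
          change s.indUnit j (x + y) ∈ N
          rw [map_add]
          exact N.add_mem hx hy
        zero_mem' := by
          change s.indUnit j 0 ∈ N
          rw [map_zero]
          exact N.zero_mem
        smul_mem' := fun a y hy => by
          change s.indUnit j (a • y) ∈ N
          rw [← stabIncl_smul_indUnit]
          exact N.smul_mem _ hy }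
    rcases eq_bot_or_eq_top K with h | h
    · left
      intro t ht
      obtain ⟨y, hy⟩ := s.exists_indUnit_eq j t
      have hyK : y ∈ K := by
        change s.indUnit j y ∈ N
        rw [← hy]
        exact N.smul_mem _ ht
      rw [h, Submodule.mem_bot] at hyK
      rw [hy, hyK, map_zero]
    · right
      rw [← top_le_iff]
      intro t _
      refine s.ind_induction j (p := (· ∈ N)) N.zero_mem (fun _ _ => N.add_mem)
        (fun x y => N.smul_mem _ ?_) t
      have hyK : y ∈ K := h ▸ Submodule.mem_top
      exact hyK
  refine (isSimpleModule_iff _ _).mpr { eq_bot_or_eq_top := fun N => ?_ }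
  obtain ⟨N', hN'⟩ := exists_isCompl N
  rcases hdich N with h | h
  · rcases hdich N' with h' | h'
    · exfalso
      have hzero : ∀ t : s.Ind j W, s.idem j • t = 0 := by
        intro t
        obtain ⟨a, ha, b, hb, rfl⟩ :=
          Submodule.mem_sup.mp (hN'.sup_eq_top ▸ Submodule.mem_top : t ∈ N ⊔ N')
        rw [smul_add, h a ha, h' b hb, add_zero]
      obtain ⟨t, ht⟩ := _root_.exists_ne (0 : s.Ind j W)
      refine ht (s.ind_induction j (p := fun t => t = 0) rfl
        (fun x y hx hy => by rw [hx, hy, add_zero]) (fun x y => ?_) t)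
      rw [← idem_smul_indUnit, hzero, smul_zero]
    · left
      exact (eq_bot_of_top_isCompl (h' ▸ hN'.symm))
  · exact Or.inr h

/-- A simple `ℂ^{α_M}[G_M]`-module `W` is recovered from the induced module as `e(M) Ind W`. -/
theorem nonempty_equiv_corner_ind [Nontrivial (s.Ind j W)] :
    Nonempty (W ≃ₗ[s.StabAlg j] s.Corner j (s.Ind j W)) := by
  let F : W →ₗ[s.StabAlg j] s.Corner j (s.Ind j W) := s.indRestrict j LinearMap.id
  have hF : ∀ y, (F y : s.Ind j W) = s.indUnit j y := fun _ => rfl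
  refine ⟨LinearEquiv.ofBijective F ⟨(F.injective_or_eq_zero).resolve_right fun h => ?_, ?_⟩⟩
  · obtain ⟨t, ht⟩ := _root_.exists_ne (0 : s.Ind j W)
    refine ht (s.ind_induction j (p := fun t => t = 0) rfl
      (fun x y hx hy => by rw [hx, hy, add_zero]) (fun x y => ?_) t)
    rw [← hF, h]
    simp
  · rintro ⟨t, ht⟩
    obtain ⟨y, hy⟩ := s.exists_indUnit_eq j t
    exact ⟨y, Subtype.ext ((hF y).trans (hy.symm.trans ht))⟩

end Simple

end Induced

section Corner

variable [Fintype I]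

/-- Isomorphic `𝒜_α(G, 𝒮)`-modules have isomorphic corners. -/
def cornerCongr (j : I) {L L' : Type*} [AddCommGroup L] [Module ℂ L] [Module s.Alg L]
    [IsScalarTower ℂ s.Alg L] [AddCommGroup L'] [Module ℂ L'] [Module s.Alg L']
    [IsScalarTower ℂ s.Alg L'] (e : L ≃ₗ[s.Alg] L') :
    s.Corner j L ≃ₗ[s.StabAlg j] s.Corner j L' where
  toFun x := ⟨e x, by
    change s.idem j • _ = _
    rw [← map_smul, idem_smul_corner]⟩
  invFun x := ⟨e.symm x, by
    change s.idem j • _ = _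
    rw [← map_smul, idem_smul_corner]⟩
  left_inv x := Subtype.ext (e.symm_apply_apply _)
  right_inv x := Subtype.ext (e.apply_symm_apply _)
  map_add' x y := Subtype.ext (map_add e _ _)
  map_smul' a x := Subtype.ext (e.map_smul _ _)

/-- The corner `e(M) ℳ` is `M`. -/
def cornerTotal (j : I) : S.M j ≃ₗ[s.StabAlg j] s.Corner j S.Total where
  toFun x := ⟨S.incl j x, by
    change s.idem j • _ = _
    rw [idem_smul_total, proj_incl]⟩
  invFun x := S.proj j x
  left_inv x := proj_incl S j x
  right_inv x := Subtype.ext ((s.idem_smul_total j x).symm.trans (s.idem_smul_corner j _ x))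
  map_add' x y := Subtype.ext (map_add _ _ _)
  map_smul' a x := Subtype.ext (by
    change S.incl j (a • x) = s.stabIncl j a • S.incl j x
    let F : s.StabAlg j →ₗ[ℂ] S.Total :=
      S.incl j ∘ₗ LinearMap.applyₗ x ∘ₗ (s.stabRep j).toLinearMap
    let F' : s.StabAlg j →ₗ[ℂ] S.Total :=
      LinearMap.applyₗ (S.incl j x) ∘ₗ s.rep.toLinearMap ∘ₗ s.stabIncl j
    have h : F = F' := by
      refine (s.stabCocycle j).basis.ext fun ⟨g, _⟩ => ?_
      change S.incl j (s.stabRep j ((s.stabCocycle j).basis (g, ())) x) =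
        s.stabIncl j ((s.stabCocycle j).basis (g, ())) • S.incl j x
      rw [stabIncl_basis, basis_smul, ← incl_stabOp]
      congr 1
      exact LinearMap.congr_fun ((s.stabCocycle j).basis.constr_basis ℂ _ (g, ())) x
    exact LinearMap.congr_fun h a)

/-- Frobenius reciprocity for `ℳ`: `Hom(W, M) ≃ Hom(Ind W, ℳ)`. -/
def frobenius (j : I) (W : Type*) [AddCommGroup W] [Module ℂ W] [Module (s.StabAlg j) W]
    [IsScalarTower ℂ (s.StabAlg j) W] :
    (W →ₗ[s.StabAlg j] S.M j) ≃ₗ[ℂ] (s.Ind j W →ₗ[s.Alg] S.Total) where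
  toFun f := s.indLift j ((s.cornerTotal j).toLinearMap ∘ₗ f)
  invFun F := (s.cornerTotal j).symm.toLinearMap ∘ₗ s.indRestrict j F
  left_inv f := LinearMap.ext fun y => by
    rw [LinearMap.comp_apply, LinearEquiv.coe_coe, LinearEquiv.symm_apply_eq]
    exact Subtype.ext (s.indLift_indUnit j _ y)
  right_inv F := s.ind_hom_ext j fun y => by
    rw [indLift_indUnit, LinearMap.comp_apply, LinearMap.comp_apply, LinearEquiv.coe_coe,
      LinearEquiv.coe_coe, LinearEquiv.apply_symm_apply]
    rfl
  map_add' f f' := s.ind_hom_ext j fun y => by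
    rw [LinearMap.add_apply, indLift_indUnit, indLift_indUnit, indLift_indUnit]
    exact map_add (S.incl j) _ _
  map_smul' c f := s.ind_hom_ext j fun y => by
    rw [LinearMap.smul_apply, indLift_indUnit, indLift_indUnit]
    exact map_smul (S.incl j) _ _

theorem frobenius_indUnit (j : I) {W : Type*} [AddCommGroup W] [Module ℂ W]
    [Module (s.StabAlg j) W] [IsScalarTower ℂ (s.StabAlg j) W] (f : W →ₗ[s.StabAlg j] S.M j)
    (y : W) : s.frobenius j W f (s.indUnit j y) = S.incl j (f y) :=
  s.indLift_indUnit j _ y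

variable [Finite G]

theorem nontrivial_multSpace (hcount : Module.rank ℂ V ≤ Cardinal.aleph0) (hsimple : IsSimple V)
    (j : I) (W : Type*) [AddCommGroup W] [Module (s.StabAlg j) W]
    [IsSimpleModule (s.StabAlg j) W] : Nontrivial (W →ₗ[s.StabAlg j] S.M j) := by
  obtain ⟨f, hf⟩ := exists_hom_ne_zero_of_faithful (M := S.M j)
    (fun a ha => s.eq_zero_of_stab_smul_eq_zero hcount hsimple j ha) W
  exact ⟨f, 0, hf⟩

theorem nontrivial_ind (hcount : Module.rank ℂ V ≤ Cardinal.aleph0) (hsimple : IsSimple V)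
    (j : I) (W : Type*) [AddCommGroup W] [Module ℂ W] [Module (s.StabAlg j) W]
    [IsScalarTower ℂ (s.StabAlg j) W] [IsSimpleModule (s.StabAlg j) W] :
    Nontrivial (s.Ind j W) := by
  have := s.nontrivial_multSpace hcount hsimple j W
  obtain ⟨f, hf⟩ := _root_.exists_ne (0 : W →ₗ[s.StabAlg j] S.M j)
  by_contra h
  rw [not_nontrivial_iff_subsingleton] at h
  refine hf ((s.frobenius j W).map_eq_zero_iff.mp (LinearMap.ext fun t => ?_))
  rw [Subsingleton.elim t 0, map_zero, map_zero]

/-- A simple `𝒜_α(G, 𝒮)`-module `L` with `e(M) L ≠ 0` is induced from a simple module of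
`ℂ^{α_M}[G_M]`. -/
theorem exists_equiv_ind (hcount : Module.rank ℂ V ≤ Cardinal.aleph0) (hsimple : IsSimple V)
    (j : I) (L : Type*) [AddCommGroup L] [Module ℂ L] [Module s.Alg L] [IsScalarTower ℂ s.Alg L]
    [IsSimpleModule s.Alg L] {x : L} (hx : s.idem j • x ≠ 0) :
    ∃ cl : SimpleClass (s.StabAlg j), Nonempty (L ≃ₗ[s.Alg] s.Ind j cl.Rep) := by
  have hne : (⊤ : Submodule (s.StabAlg j) (s.Corner j L)) ≠ ⊥ := by
    have hx' : s.idem j • s.idem j • x = s.idem j • x := by rw [smul_smul, idem_mul_idem]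
    intro h
    have h1 := (Submodule.mem_bot (s.StabAlg j)).mp
      (h ▸ Submodule.mem_top : (⟨s.idem j • x, hx'⟩ : s.Corner j L) ∈ (⊥ : Submodule _ _))
    exact hx (congrArg Subtype.val h1)
  obtain ⟨N, -, hN⟩ := (IsSemisimpleModule.eq_bot_or_exists_simple_le _).resolve_left hne
  obtain ⟨cl, ⟨e⟩⟩ := SimpleClass.exists_rep_equiv (A := s.StabAlg j) N
  have := s.nontrivial_ind hcount hsimple j cl.Rep
  have := s.isSimpleModule_ind j (W := cl.Rep)
  let f : cl.Rep →ₗ[s.StabAlg j] s.Corner j L := N.subtype ∘ₗ e.symm.toLinearMap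
  have h0 : s.indLift j f ≠ 0 := by
    intro h
    have := IsSimpleModule.nontrivial (s.StabAlg j) cl.Rep
    obtain ⟨y, hy⟩ := _root_.exists_ne (0 : cl.Rep)
    have h1 := LinearMap.congr_fun h (s.indUnit j y)
    rw [indLift_indUnit, LinearMap.zero_apply, Submodule.coe_eq_zero] at h1
    exact hy (e.symm.map_eq_zero_iff.mp (Subtype.ext h1))
  exact ⟨cl, ⟨(LinearEquiv.ofBijective _ (LinearMap.bijective_of_ne_zero h0)).symm⟩⟩

end Corner

end Scalars
end Transport
end StableFamily

/-! ### Multiplicity spaces of a dense action -/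

namespace VertexAlgebra.TwistedModule

section Iso

variable {V : Type u} [AddCommGroup V] [Module ℂ V] [VertexAlgebra V] {g : Aut V}
  {M₁ : Type*} [AddCommGroup M₁] [Module ℂ M₁] {X₁ : TwistedModule g M₁}
  {M₂ : Type*} [AddCommGroup M₂] [Module ℂ M₂] {X₂ : TwistedModule g M₂}
  {M₃ : Type*} [AddCommGroup M₃] [Module ℂ M₃] {X₃ : TwistedModule g M₃}

theorem Iso.symm (h : X₁.Iso X₂) : X₂.Iso X₁ := by
  obtain ⟨f, hf⟩ := h
  exact ⟨f.symm, fun u n x => by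
    rw [LinearEquiv.symm_apply_eq, hf, LinearEquiv.apply_symm_apply]⟩

theorem Iso.trans (h : X₁.Iso X₂) (h' : X₂.Iso X₃) : X₁.Iso X₃ := by
  obtain ⟨f, hf⟩ := h
  obtain ⟨f', hf'⟩ := h'
  exact ⟨f.trans f', fun u n x => by
    rw [LinearEquiv.trans_apply, hf, hf', LinearEquiv.trans_apply]⟩

theorem IsIrreducible.of_iso (hX : X₁.IsIrreducible) (h : X₁.Iso X₂) : X₂.IsIrreducible := by
  obtain ⟨f, hf⟩ := h
  obtain ⟨_, hirr⟩ := hX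
  refine ⟨f.symm.toEquiv.nontrivial, fun N hN => ?_⟩
  have hN' : X₁.IsInvariant (N.comap f.toLinearMap) := by
    intro u n x hx
    rw [Submodule.mem_comap, LinearEquiv.coe_coe] at hx ⊢
    rw [hf]
    exact hN u n _ hx
  rcases hirr _ hN' with h | h
  · left
    rw [eq_bot_iff]
    intro y hy
    have h1 : f.symm y ∈ N.comap f.toLinearMap := by simpa using hy
    rw [h, Submodule.mem_bot, LinearEquiv.symm_apply_eq, map_zero] at h1
    exact h1
  · right
    rw [eq_top_iff]
    intro y _
    have h1 : f.symm y ∈ N.comap f.toLinearMap := h ▸ Submodule.mem_top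
    simpa using h1

end Iso

section Multiplicity

variable {V : Type u} [AddCommGroup V] [Module ℂ V] [VertexAlgebra V] {g : Aut V}
  {P : Type*} [AddCommGroup P] [Module ℂ P] (X : TwistedModule g P)
  {A : Type*} [Ring A] [Algebra ℂ A] [Module A P] [IsScalarTower ℂ A P]

/-- The combinations of modes act on multiplicity spaces by composition, compatibly with
intertwining maps between these. -/
theorem exists_multiplicity_modeSpan (hA : X.Commutes A) {W : Type*} [AddCommGroup W]
    [Module A W] [Module.Finite A W] {W' : Type*} [AddCommGroup W']
    [Module A W'] [Module.Finite A W'] {d : Module.End ℂ P} (hd : d ∈ X.modeSpan) :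
    ∃ D ∈ (X.multiplicity hA W).modeSpan, ∃ D' ∈ (X.multiplicity hA W').modeSpan,
      (∀ f y, D f y = d (f y)) ∧ (∀ f y, D' f y = d (f y)) ∧
      ∀ θ : (W →ₗ[A] P) →ₗ[ℂ] (W' →ₗ[A] P),
        (∀ u n f, θ ((X.multiplicity hA W).Y u n f) = (X.multiplicity hA W').Y u n (θ f)) →
        ∀ f, θ (D f) = D' (θ f) := by
  induction hd using Submodule.span_induction with
  | mem d hd =>
    obtain ⟨p, rfl⟩ := hd
    exact ⟨_, Submodule.subset_span ⟨p, rfl⟩, _, Submodule.subset_span ⟨p, rfl⟩, fun _ _ => rfl,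
      fun _ _ => rfl, fun θ hθ f => hθ _ _ f⟩
  | zero => exact ⟨0, zero_mem _, 0, zero_mem _, fun _ _ => rfl, fun _ _ => rfl, by simp⟩
  | add x y _ _ hx hy =>
    obtain ⟨D, hD, D', hD', h, h', hθ⟩ := hx
    obtain ⟨E, hE, E', hE', k, k', kθ⟩ := hy
    exact ⟨D + E, add_mem hD hE, D' + E', add_mem hD' hE', fun f y => by simp [h, k],
      fun f y => by simp [h', k'], fun θ hY f => by simp [hθ θ hY, kθ θ hY]⟩
  | smul c x _ hx =>
    obtain ⟨D, hD, D', hD', h, h', hθ⟩ := hx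
    exact ⟨c • D, Submodule.smul_mem _ c hD, c • D', Submodule.smul_mem _ c hD',
      fun f y => by simp [h], fun f y => by simp [h'], fun θ hY f => by simp [hθ θ hY]⟩

theorem IsInvariant.modeSpan_mem {X : TwistedModule g P} {N : Submodule ℂ P}
    (hN : X.IsInvariant N) {d : Module.End ℂ P} (hd : d ∈ X.modeSpan) {x : P} (hx : x ∈ N) :
    d x ∈ N := by
  induction hd using Submodule.span_induction with
  | mem d hd =>
    obtain ⟨p, rfl⟩ := hd
    exact hN _ _ x hx
  | zero => exact N.zero_mem
  | add _ _ _ _ h h' => exact N.add_mem h h'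
  | smul c _ _ h => exact N.smul_mem c h

variable [IsSemisimpleRing A]

/-- If the modes are dense in the commutant of a semisimple algebra, then its nonzero multiplicity
spaces are irreducible. -/
theorem multiplicity_isIrreducible (hA : X.Commutes A)
    (hdense : ∀ (f : P →ₗ[A] P) (t : Finset P), ∃ d ∈ X.modeSpan, ∀ x ∈ t, f x = d x)
    (W : Type*) [AddCommGroup W] [Module A W] [IsSimpleModule A W] [Module.Finite A W]
    [hn : Nontrivial (W →ₗ[A] P)] : (X.multiplicity hA W).IsIrreducible := by
  have := IsSimpleModule.nontrivial A W
  obtain ⟨y₀, hy₀⟩ := exists_ne (0 : W)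
  refine ⟨hn, fun N hN => or_iff_not_imp_left.mpr fun h0 => ?_⟩
  obtain ⟨f, hfN, hf⟩ := N.exists_mem_ne_zero_of_ne_bot h0
  rw [eq_top_iff]
  intro h _
  -- an operator `F` in the commutant of `A` with `F ∘ f = h`
  obtain ⟨F, hF⟩ := IsSemisimpleModule.extension_property f (LinearMap.injective_of_ne_zero hf) h
  obtain ⟨d, hd, hdF⟩ := hdense F {f y₀}
  obtain ⟨D, hD, -, -, hDd, -, -⟩ := X.exists_multiplicity_modeSpan hA (W := W) (W' := W) hd
  have hDf : D f = h := by
    -- two homomorphisms from a simple module that agree on a nonzero vector are equal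
    by_contra hne
    refine hy₀ (LinearMap.injective_of_ne_zero (sub_ne_zero.mpr hne) ?_)
    rw [map_zero, LinearMap.sub_apply, hDd, ← hdF _ (Finset.mem_singleton_self _), ← hF]
    exact sub_self _
  rw [← hDf]
  exact hN.modeSpan_mem hD hfN

/-- If the modes are dense in the commutant of a semisimple algebra, then its nonzero multiplicity
spaces are isomorphic only for isomorphic simple modules. -/
theorem nonempty_equiv_of_multiplicity_iso (hA : X.Commutes A)
    (hdense : ∀ (f : P →ₗ[A] P) (t : Finset P), ∃ d ∈ X.modeSpan, ∀ x ∈ t, f x = d x)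
    (W : Type*) [AddCommGroup W] [Module A W] [IsSimpleModule A W] [Module.Finite A W]
    (W' : Type*) [AddCommGroup W'] [Module A W'] [IsSimpleModule A W'] [Module.Finite A W']
    [hn : Nontrivial (W →ₗ[A] P)] (h : (X.multiplicity hA W).Iso (X.multiplicity hA W')) :
    Nonempty (W ≃ₗ[A] W') := by
  have := IsSimpleModule.nontrivial A W
  have := IsSimpleModule.nontrivial A W'
  by_contra hW
  obtain ⟨θ, hθ⟩ := h
  obtain ⟨f, hf⟩ := exists_ne (0 : W →ₗ[A] P)
  let f' := θ f
  have hf' : f' ≠ 0 := θ.map_ne_zero_iff.mpr hf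
  obtain ⟨y, hy⟩ := exists_ne (0 : W)
  obtain ⟨y', hy'⟩ := exists_ne (0 : W')
  -- `f` remains nonzero modulo the image of `f'`, as `W` and `W'` are not isomorphic
  have hq : (LinearMap.range f').mkQ ∘ₗ f ≠ 0 := by
    intro h0
    have hle : ∀ z, f z ∈ LinearMap.range f' := fun z =>
      (Submodule.Quotient.mk_eq_zero _).mp (LinearMap.congr_fun h0 z)
    let e := LinearEquiv.ofInjective f' (LinearMap.injective_of_ne_zero hf')
    let k : W →ₗ[A] W' := e.symm.toLinearMap ∘ₗ f.codRestrict _ hle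
    have hk : k ≠ 0 := by
      intro hk
      have h1 := e.symm.map_eq_zero_iff.mp (LinearMap.congr_fun hk y)
      exact hy (LinearMap.injective_of_ne_zero hf
        ((congrArg Subtype.val h1).trans (map_zero f).symm))
    exact hW ⟨LinearEquiv.ofBijective k (LinearMap.bijective_of_ne_zero hk)⟩
  -- an operator in the commutant of `A` that fixes `f` and annihilates `f'`
  obtain ⟨F, hF⟩ := IsSemisimpleModule.extension_property _ (LinearMap.injective_of_ne_zero hq) f
  have hFf : ∀ z, (F ∘ₗ (LinearMap.range f').mkQ) (f z) = f z := LinearMap.congr_fun hF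
  have hFf' : ∀ z, (F ∘ₗ (LinearMap.range f').mkQ) (f' z) = 0 := by
    intro z
    have h1 : (LinearMap.range f').mkQ (f' z) = 0 :=
      (Submodule.Quotient.mk_eq_zero _).mpr ⟨z, rfl⟩
    rw [LinearMap.comp_apply, h1, map_zero]
  classical
  obtain ⟨d, hd, hdF⟩ := hdense (F ∘ₗ (LinearMap.range f').mkQ) {f y, f' y'}
  obtain ⟨D, -, D', -, hDd, hDd', hθD⟩ :=
    X.exists_multiplicity_modeSpan hA (W := W) (W' := W') hd
  have h1 : D f ≠ 0 := by
    intro h0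
    have h2 : d (f y) = 0 := by rw [← hDd, h0, LinearMap.zero_apply]
    rw [← hdF _ (by simp), hFf] at h2
    exact hy (LinearMap.injective_of_ne_zero hf (h2.trans (map_zero f).symm))
  have h2 : D' f' = 0 := by
    by_contra h0
    have h3 : D' f' y' = 0 := by rw [hDd', ← hdF _ (by simp), hFf']
    exact hy' (LinearMap.injective_of_ne_zero h0 (h3.trans (map_zero _).symm))
  exact h1 (θ.map_eq_zero_iff.mp ((hθD θ.toLinearMap hθ f).trans h2))

/-- If the modes are dense in the commutant of a semisimple algebra `A`, then `P` is a finite sum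
of irreducible modules, namely of images of multiplicity spaces of the simple left ideals in a
decomposition of `A`. -/
theorem isSemisimpleModule_and_finite (hA : X.Commutes A)
    (hdense : ∀ (f : P →ₗ[A] P) (t : Finset P), ∃ d ∈ X.modeSpan, ∀ x ∈ t, f x = d x) :
    letI := X.freeModule
    IsSemisimpleModule (ModeAlgebra V) P ∧ Module.Finite (ModeAlgebra V) P := by
  let _ := X.freeModule
  obtain ⟨n, L, e, hL⟩ := IsSemisimpleModule.exists_linearEquiv_fin_dfinsupp A A
  let _ := fun k => (X.multiplicity hA (L k)).freeModule
  let ev : ∀ k, (L k →ₗ[A] P) →ₗ[ModeAlgebra V] P := fun k =>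
    freeHom (LinearMap.applyₗ' ℂ (e 1 k)) fun _ _ _ => rfl
  have hev : ∀ k f, ev k f = f (e 1 k) := fun _ _ => rfl
  have htop : ⨆ k, LinearMap.range (ev k) = ⊤ := by
    rw [eq_top_iff]
    intro x _
    have h1 : x = ∑ k, e.symm (DFinsupp.single k (e 1 k)) • x := by
      rw [← Finset.sum_smul, ← map_sum]
      have h2 : ∑ k, DFinsupp.single k (e 1 k) = e 1 := by
        ext k
        simp [DFinsupp.single_apply]
      rw [h2, LinearEquiv.symm_apply_apply, one_smul]
    rw [h1]
    refine Submodule.sum_mem _ fun k _ => Submodule.mem_iSup_of_mem k ?_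
    exact ⟨LinearMap.toSpanSingleton A P x ∘ₗ e.symm.toLinearMap ∘ₗ
      DFinsupp.lsingle (R := A) (M := fun i => L i) k, rfl⟩
  have hsimple : ∀ k, IsSemisimpleModule (ModeAlgebra V) (L k →ₗ[A] P) ∧
      Module.Finite (ModeAlgebra V) (L k →ₗ[A] P) := by
    intro k
    have := hL k
    rcases subsingleton_or_nontrivial (L k →ₗ[A] P) with h | h
    · have hc : ComplementedLattice (Submodule (ModeAlgebra V) (L k →ₗ[A] P)) :=
        ⟨fun _ => ⟨⊤, disjoint_iff.mpr (Subsingleton.elim _ _),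
          codisjoint_iff.mpr (Subsingleton.elim _ _)⟩⟩
      exact ⟨(isSemisimpleModule_iff _ _).mpr hc, inferInstance⟩
    · have := (isIrreducible_iff_isSimpleModule _).mp (X.multiplicity_isIrreducible hA hdense (L k))
      exact ⟨inferInstance, inferInstance⟩
  refine ⟨isSemisimpleModule_of_isSemisimpleModule_submodule' (fun k => ?_) htop, ⟨?_⟩⟩
  · have := (hsimple k).1
    exact IsSemisimpleModule.range (ev k)
  · rw [← htop]
    refine Submodule.fg_iSup _ fun k => ?_
    have := (hsimple k).2
    exact Module.Finite.iff_fg.mp (Module.Finite.range (ev k))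

end Multiplicity

theorem isFiniteSumOfIrreducibles {V : Type u} [AddCommGroup V] [Module ℂ V] [VertexAlgebra V]
    {g : Aut V} {M : Type v} [AddCommGroup M] [Module ℂ M] (X : TwistedModule g M)
    (h : letI := X.freeModule
      IsSemisimpleModule (ModeAlgebra V) M ∧ Module.Finite (ModeAlgebra V) M) :
    X.IsFiniteSumOfIrreducibles := by
  let _ := X.freeModule
  obtain ⟨_, _⟩ := h
  have : IsScalarTower ℂ (ModeAlgebra V) M := ⟨fun c a x => by
    rw [freeModule_smul, freeModule_smul, map_smul]
    rfl⟩
  obtain ⟨s, hind, hsup, hs⟩ :=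
    IsSemisimpleModule.exists_sSupIndep_sSup_simples_eq_top (ModeAlgebra V) M
  rw [sSupIndep_iff] at hind
  have hfin : Finite s := WellFoundedGT.finite_of_iSupIndep hind fun N =>
    (Submodule.nontrivial_iff_ne_bot).mp (by
      have := hs N N.2
      exact IsSimpleModule.nontrivial (ModeAlgebra V) N)
  let E := (Finite.equivFin s).symm
  let N : Fin (Nat.card s) → Submodule (ModeAlgebra V) M := fun i => E i
  have hN : ∀ i, IsSimpleModule (ModeAlgebra V) (N i) := fun i => hs _ (E i).2
  have hinv : ∀ i, X.IsInvariant ((N i).restrictScalars ℂ) := by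
    intro i u n x hx
    have h1 := (N i).smul_mem (FreeAlgebra.ι ℂ (u, n)) hx
    rwa [freeModule_smul, freeRep_ι] at h1
  have hint : DirectSum.IsInternal N := by
    refine DirectSum.isInternal_submodule_of_iSupIndep_of_iSup_eq_top
      (hind.comp E.injective) ?_
    rw [← hsup, sSup_eq_iSup']
    exact E.iSup_comp (g := fun x : s => (x : Submodule (ModeAlgebra V) M))
  refine ⟨Nat.card s, fun i => (N i).restrictScalars ℂ, hinv, hint, fun i => ?_⟩
  rw [isIrreducible_iff_isSimpleModule]
  let _ := (X.sub _ (hinv i)).freeModule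
  let e : (N i).restrictScalars ℂ ≃ₗ[ModeAlgebra V] N i :=
    { (Equiv.refl _ : (N i).restrictScalars ℂ ≃ N i) with
      map_add' := fun _ _ => rfl
      map_smul' := fun a x => Subtype.ext
        (map_freeRep (X := X.sub _ (hinv i)) (X' := X) (Submodule.subtype _)
          (fun _ _ _ => rfl) a x) }
  exact IsSimpleModule.congr e

end VertexAlgebra.TwistedModule

/-! ### The dual pair -/

/-- Schur's lemma for the simple modules of a finite-dimensional algebra. -/
theorem exists_eq_smul_of_isSimpleModule {A : Type*} [Ring A] [Algebra ℂ A] [FiniteDimensional ℂ A]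
    {L : Type*} [AddCommGroup L] [Module ℂ L] [Module A L] [IsScalarTower ℂ A L]
    [IsSimpleModule A L] (F : L →ₗ[A] L) : ∃ c : ℂ, ∀ y, F y = c • y := by
  have : FiniteDimensional ℂ L := Module.Finite.trans A L
  obtain ⟨c, rfl⟩ :=
    (IsSimpleModule.algebraMap_end_bijective_of_isAlgClosed (A := A) (V := L) ℂ).2 F
  exact ⟨c, fun _ => rfl⟩

namespace StableFamily

variable {V : Type u} [AddCommGroup V] [Module ℂ V] [VertexAlgebra V]
  {G : Subgroup (Aut V)} {σ : Subgroup.center G} {I : Type w}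
  {S : StableFamily.{u, v, w} G σ I}

namespace Transport
namespace Scalars

variable {φ : S.Transport} (s : φ.Scalars) [Fintype I]

theorem exists_idem_smul_ne_zero {L : Type*} [AddCommGroup L] [Module s.Alg L] {x : L}
    (hx : x ≠ 0) : ∃ i, s.idem i • x ≠ 0 := by
  by_contra! h
  refine hx ?_
  rw [← one_smul s.Alg x, ActionCocycle.one_eq, Finset.sum_smul]
  exact Finset.sum_eq_zero fun i _ => h i

/-- Multiplication by `g ⊗ e(M)` carries `e(M) L` isomorphically to `e(M') L`, for
`M ≅ M' ∘ g`. -/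
theorem exists_idem_smul_ne_zero_of_tgt {L : Type*} [AddCommGroup L] [Module s.Alg L] {x : L}
    {i j : I} {g : G} (hg : φ.tgt g i = j) (hx : s.idem i • x ≠ 0) :
    ∃ y : L, s.idem j • y ≠ 0 := by
  subst hg
  refine ⟨s.cocycle.basis (g, i) • x, fun h => hx ?_⟩
  rw [smul_smul, idem_mul_basis] at h
  have h1 := congrArg (s.cocycle.invBasis (g, i) • ·) h
  simp only [smul_smul, ActionCocycle.invBasis_mul_basis, smul_zero] at h1
  exact h1

variable [Finite G]

/-- Frobenius reciprocity commutes with the modes of `V^G`. -/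
theorem frobenius_mode (j : I) (W : Type*) [AddCommGroup W] [Module ℂ W]
    [Module (s.StabAlg j) W] [IsScalarTower ℂ (s.StabAlg j) W] [Module.Finite (s.StabAlg j) W]
    (u : fixed G) (n : ℚ) (f : W →ₗ[s.StabAlg j] S.M j) (t : s.Ind j W) :
    s.frobenius j W (((S.resX j).multiplicity (s.res_commutes j) W).Y u n f) t =
      S.total.Y u n (s.frobenius j W f t) := by
  refine s.ind_induction j (p := fun t => s.frobenius j W
    (((S.resX j).multiplicity (s.res_commutes j) W).Y u n f) t =
      S.total.Y u n (s.frobenius j W f t)) (by simp) ?_ (fun x y => ?_) t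
  · intro x y hx hy
    rw [map_add, map_add, map_add, hx, hy]
  · rw [map_smul, map_smul, ← s.total_commutes, frobenius_indUnit, frobenius_indUnit, total_incl]
    rfl

/-- The multiplicity space of `W` in `M` is that of the induced module in `ℳ`. -/
theorem multiplicity_iso (j : I) (W : Type*) [AddCommGroup W] [Module ℂ W]
    [Module (s.StabAlg j) W] [IsScalarTower ℂ (s.StabAlg j) W] [Module.Finite (s.StabAlg j) W]
    [Module.Finite s.Alg (s.Ind j W)] :
    ((S.resX j).multiplicity (s.res_commutes j) W).Iso
      (S.total.multiplicity s.total_commutes (s.Ind j W)) :=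
  ⟨s.frobenius j W, fun u n f => LinearMap.ext fun t => s.frobenius_mode j W u n f t⟩

omit [Finite G] in
theorem nonempty_equiv_of_ind_equiv (j : I) {W W' : Type*} [AddCommGroup W] [Module ℂ W]
    [Module (s.StabAlg j) W] [IsSimpleModule (s.StabAlg j) W] [AddCommGroup W'] [Module ℂ W']
    [Module (s.StabAlg j) W'] [IsSimpleModule (s.StabAlg j) W'] [Nontrivial (s.Ind j W)]
    [Nontrivial (s.Ind j W')] (e : s.Ind j W ≃ₗ[s.Alg] s.Ind j W') :
    Nonempty (W ≃ₗ[s.StabAlg j] W') := by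
  obtain ⟨E⟩ := s.nonempty_equiv_corner_ind j (W := W)
  obtain ⟨E'⟩ := s.nonempty_equiv_corner_ind j (W := W')
  exact ⟨(E.trans (s.cornerCongr j e)).trans E'.symm⟩

omit [Finite G] in
theorem exists_tgt_eq_of_ind_equiv {j j' : I} {W W' : Type*} [AddCommGroup W] [Module ℂ W]
    [Module (s.StabAlg j) W] [AddCommGroup W'] [Module ℂ W']
    [Module (s.StabAlg j') W'] [Nontrivial (s.Ind j' W')]
    (e : s.Ind j W ≃ₗ[s.Alg] s.Ind j' W') : ∃ g, φ.tgt g j = j' := by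
  by_contra! h
  have hzero : ∀ y : W', s.indUnit j' y = 0 := by
    intro y
    by_contra hy
    obtain ⟨g, hg⟩ := s.exists_tgt_eq_of_idem_smul_ne_zero j (i := j')
      (t := e.symm (s.indUnit j' y)) (by
        rw [← map_smul, idem_smul_indUnit]
        exact e.symm.map_ne_zero_iff.mpr hy)
    exact h g hg
  obtain ⟨t, ht⟩ := _root_.exists_ne (0 : s.Ind j' W')
  refine ht (s.ind_induction j' (p := fun t => t = 0) rfl
    (fun x y hx hy => by rw [hx, hy, add_zero]) (fun x y => by rw [hzero, smul_zero]) t)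

variable (hcount : Module.rank ℂ V ≤ Cardinal.aleph0) (hsimple : IsSimple V)

include hcount hsimple

/-- Every simple `𝒜_α(G, 𝒮)`-module occurs in `ℳ`. -/
theorem nontrivial_hom_total (L : Type*) [AddCommGroup L] [Module ℂ L] [Module s.Alg L]
    [IsScalarTower ℂ s.Alg L] [IsSimpleModule s.Alg L] : Nontrivial (L →ₗ[s.Alg] S.Total) := by
  have := IsSimpleModule.nontrivial s.Alg L
  obtain ⟨x, hx⟩ := _root_.exists_ne (0 : L)
  obtain ⟨i, hi⟩ := s.exists_idem_smul_ne_zero hx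
  obtain ⟨cl, ⟨e⟩⟩ := s.exists_equiv_ind hcount hsimple i L hi
  have := s.nontrivial_multSpace hcount hsimple i cl.Rep
  obtain ⟨f, hf⟩ := _root_.exists_ne (0 : cl.Rep →ₗ[s.StabAlg i] S.M i)
  refine ⟨s.frobenius i cl.Rep f ∘ₗ e.toLinearMap, 0, fun h => hf ?_⟩
  refine (s.frobenius i cl.Rep).map_eq_zero_iff.mp (LinearMap.ext fun t => ?_)
  have h1 := LinearMap.congr_fun h (e.symm t)
  simpa using h1

theorem isDualPair : IsDualPair s.Alg S.total := by
  have hdense := s.exists_total_modeSpan_eq hcount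
  refine ⟨inferInstance, inferInstance, s.total_commutes, fun cl => ?_, fun cl cl' => ?_⟩
  · have := s.nontrivial_hom_total hcount hsimple cl.Rep
    exact S.total.multiplicity_isIrreducible s.total_commutes hdense cl.Rep
  · have := s.nontrivial_hom_total hcount hsimple cl.Rep
    refine ⟨fun h => SimpleClass.eq_of_rep_equiv
      (S.total.nonempty_equiv_of_multiplicity_iso s.total_commutes hdense _ _ h), ?_⟩
    rintro rfl
    exact ⟨LinearEquiv.refl ℂ _, fun _ _ _ => rfl⟩

variable {s} {J : Set I}

theorem Index.isSimpleModule (p : s.Index J) : IsSimpleModule s.Alg p.W :=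
  have := s.nontrivial_ind hcount hsimple p.1 p.2.Rep
  s.isSimpleModule_ind p.1

/-- The induced modules are pairwise inequivalent: the orbit is determined by the idempotents that
do not annihilate the module, and the inducing module is a corner. -/
theorem Index.eq_of_equiv (hJ : S.IsTransversal J) {p q : s.Index J}
    (h : Nonempty (p.W ≃ₗ[s.Alg] q.W)) : p = q := by
  obtain ⟨⟨j, hj⟩, cl⟩ := p
  obtain ⟨⟨j', hj'⟩, cl'⟩ := q
  obtain ⟨e⟩ := h
  have hn := s.nontrivial_ind hcount hsimple j cl.Rep
  have hn' := s.nontrivial_ind hcount hsimple j' cl'.Rep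
  obtain ⟨g, hg⟩ := s.exists_tgt_eq_of_ind_equiv e
  obtain rfl : j = j' := (hJ j).unique
    ⟨hj, 1, (iso_conj_iff_tgt_eq φ 1 j j).mpr (tgt_one φ j)⟩
    ⟨hj', g, (iso_conj_iff_tgt_eq φ g j j').mpr hg⟩
  obtain rfl : cl = cl' := SimpleClass.eq_of_rep_equiv (s.nonempty_equiv_of_ind_equiv j e)
  rfl

omit hcount hsimple [Finite G] in
/-- A nonzero module is not annihilated by all the idempotents of orbit representatives. -/
theorem exists_mem_idem_smul_ne_zero (hJ : S.IsTransversal J) (L : Type*) [AddCommGroup L]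
    [Module s.Alg L] [Nontrivial L] : ∃ (j : J) (y : L), s.idem (j : I) • y ≠ 0 := by
  obtain ⟨x, hx⟩ := _root_.exists_ne (0 : L)
  obtain ⟨i, hi⟩ := s.exists_idem_smul_ne_zero hx
  obtain ⟨j, ⟨hj, g, hg⟩, -⟩ := hJ i
  exact ⟨⟨j, hj⟩, s.exists_idem_smul_ne_zero_of_tgt ((iso_conj_iff_tgt_eq φ g i j).mp hg) hi⟩

theorem exists_index_equiv (hJ : S.IsTransversal J) (L : Type*) [AddCommGroup L] [Module ℂ L]
    [Module s.Alg L] [IsScalarTower ℂ s.Alg L] [IsSimpleModule s.Alg L] :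
    ∃ p : s.Index J, Nonempty (L ≃ₗ[s.Alg] p.W) := by
  have := IsSimpleModule.nontrivial s.Alg L
  obtain ⟨j, y, hy⟩ := exists_mem_idem_smul_ne_zero (s := s) hJ L
  obtain ⟨cl, h⟩ := s.exists_equiv_ind hcount hsimple j L hy
  exact ⟨⟨j, cl⟩, h⟩

theorem Index.nontrivial_multSpace (p : s.Index J) : Nontrivial p.MultSpace :=
  s.nontrivial_multSpace hcount hsimple p.1 p.2.Rep

theorem Index.isIrreducible_mult (p : s.Index J) : p.mult.IsIrreducible := by
  have := Index.isSimpleModule hcount hsimple p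
  have := s.nontrivial_hom_total hcount hsimple p.W
  exact (S.total.multiplicity_isIrreducible s.total_commutes (s.exists_total_modeSpan_eq hcount)
    p.W).of_iso (s.multiplicity_iso p.1 p.2.Rep).symm

theorem Index.mult_iso_iff (hJ : S.IsTransversal J) (p q : s.Index J) :
    p.mult.Iso q.mult ↔ p = q := by
  constructor
  · intro h
    have := Index.isSimpleModule hcount hsimple p
    have := Index.isSimpleModule hcount hsimple q
    have := s.nontrivial_hom_total hcount hsimple p.W
    exact Index.eq_of_equiv hcount hsimple hJ
      (S.total.nonempty_equiv_of_multiplicity_iso s.total_commutes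
        (s.exists_total_modeSpan_eq hcount) p.W q.W
        (((s.multiplicity_iso p.1 p.2.Rep).symm.trans h).trans (s.multiplicity_iso q.1 q.2.Rep)))
  · rintro rfl
    exact ⟨LinearEquiv.refl ℂ _, fun _ _ _ => rfl⟩

theorem decomposes (hJ : S.IsTransversal J) : s.Decomposes J := by
  classical
  have hs : ∀ p : s.Index J, IsSimpleModule s.Alg p.W := Index.isSimpleModule hcount hsimple
  have hscal : ∀ (p : s.Index J) (F : p.W →ₗ[s.Alg] p.W), ∃ c : ℂ, ∀ y, F y = c • y :=
    fun p => exists_eq_smul_of_isSimpleModule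
  obtain ⟨Θ, hΘ⟩ := exists_directSum_tensor_equiv (A := s.Alg) (W := fun p : s.Index J => p.W)
    (H := fun p : s.Index J => p.MultSpace) (P := S.Total) hscal
    (fun p q => Index.eq_of_equiv hcount hsimple hJ)
    (fun cl => exists_index_equiv hcount hsimple hJ cl.Rep)
    (fun p => s.frobenius p.1 p.2.Rep)
  refine ⟨Θ, fun p y f u n => ?_⟩
  have h := s.frobenius_mode p.1 p.2.Rep u n f y
  exact (hΘ p y (p.mult.Y u n f)).trans
    (h.trans (congrArg (S.total.Y u n) (hΘ p y f).symm))

end Scalars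
end Transport

/-! ### Orbits of irreducible modules -/

section Orbit

variable {M : Type v} [AddCommGroup M] [Module ℂ M]
  (X : TwistedModule ((σ : G) : Aut V) M)

/-- Elements `g`, `h` of `G` are equivalent if `M ∘ g ≅ M ∘ h`. -/
def orbitSetoid : Setoid G where
  r g h := (X.conj g (center_comm σ g)).Iso (X.conj h (center_comm σ h))
  iseqv := ⟨fun _ => ⟨LinearEquiv.refl ℂ _, fun _ _ _ => rfl⟩, TwistedModule.Iso.symm,
    TwistedModule.Iso.trans⟩

variable {X} in
theorem isIrreducible_conj (hX : X.IsIrreducible) (g : G) :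
    (X.conj g (center_comm σ g)).IsIrreducible := by
  refine ⟨hX.1, fun N hN => hX.2 N fun u n x hx => ?_⟩
  have h := hN ((g : Aut V)⁻¹ • u) n x hx
  change X.Y ((g : Aut V) • (g : Aut V)⁻¹ • u) n x ∈ N at h
  rwa [smul_inv_smul] at h

/-- The family of the pairwise inequivalent modules `M ∘ g`, for `g ∈ G`. -/
def orbit (hX : X.IsIrreducible) : StableFamily.{u, v, u} G σ (Quotient (orbitSetoid X)) where
  M _ := M
  X q := X.conj q.out (center_comm σ _)
  irreducible q := isIrreducible_conj hX q.out
  inequivalent q q' h := by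
    rw [← q.out_eq, ← q'.out_eq]
    exact Quotient.sound (s := orbitSetoid X) h
  stable q h := ⟨Quotient.mk (orbitSetoid X) (q.out * h),
    Quotient.mk_out (s := orbitSetoid X) (q.out * h)⟩

/-- An irreducible `σ`-twisted module is a quotient, over `V^G`, of the sum of the family of the
`M ∘ g`. -/
theorem isFiniteSumOfIrreducibles_restrict [Finite G]
    (hcount : Module.rank ℂ V ≤ Cardinal.aleph0) (hX : X.IsIrreducible) :
    (X.restrict G (σ : G).2 (orderOf_coe_pos (σ : G))).IsFiniteSumOfIrreducibles := by
  have := Fintype.ofFinite (Quotient (orbitSetoid X))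
  let S := orbit X hX
  obtain ⟨φ⟩ := nonempty_transport S
  obtain ⟨s⟩ := φ.nonempty_scalars hcount
  let X' := X.restrict G (σ : G).2 (orderOf_coe_pos (σ : G))
  have hfin := S.total.isSemisimpleModule_and_finite s.total_commutes
    (s.exists_total_modeSpan_eq hcount)
  refine X'.isFiniteSumOfIrreducibles ?_
  let _ := X'.freeModule
  let _ := S.total.freeModule
  obtain ⟨_, _⟩ := hfin
  let q : Quotient (orbitSetoid X) := Quotient.mk _ 1
  -- on `V^G` the actions on `M` and `M ∘ g` agree
  have hY : ∀ (u : fixed G) n (x : M), X'.Y u n x = (S.X q).Y u n x := by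
    intro u n x
    change X.Y u n x = X.Y (((q.out : G) : Aut V) • (u : V)) n x
    rw [u.2 _ (q.out : G).2]
  let p : S.Total →ₗ[ModeAlgebra (fixed G)] M :=
    TwistedModule.freeHom (X := S.total) (X' := X') (S.proj q) fun u n x => (hY u n _).symm
  have hp : Function.Surjective p := fun x => ⟨S.incl q x, proj_incl S q x⟩
  exact ⟨IsSemisimpleModule.of_surjective p hp, Module.Finite.of_surjective p hp⟩

end Orbit

end StableFamily

end

theorem theorem7 {V : Type u} [AddCommGroup V] [Module ℂ V] [VertexAlgebra V]
    (hsimple : VertexAlgebra.IsSimple V) (hcount : Module.rank ℂ V ≤ Cardinal.aleph0)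
    (G : Subgroup (VertexAlgebra.Aut V)) [Finite G] (σ : Subgroup.center G) :
    (∀ (I : Type w) [Fintype I] (S : StableFamily.{u, v, w} G σ I),
      Nonempty S.Transport ∧ ∀ φ : S.Transport,
      Nonempty φ.Scalars ∧ ∀ α : φ.Scalars,
        IsDualPair α.Alg S.total ∧
        ∀ J : Set I, S.IsTransversal J →
          ((∀ p : α.Index J, IsSimpleModule α.Alg p.W) ∧
            (∀ p q : α.Index J, Nonempty (p.W ≃ₗ[α.Alg] q.W) ↔ p = q) ∧
            (∀ cl : SimpleClass α.Alg, ∃ p : α.Index J, Nonempty (cl.Rep ≃ₗ[α.Alg] p.W))) ∧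
          α.Decomposes J ∧
          (∀ p : α.Index J, Nontrivial p.MultSpace) ∧
          (∀ p : α.Index J, p.mult.IsIrreducible) ∧
          (∀ p q : α.Index J, p.mult.Iso q.mult ↔ p = q)) ∧
    (∀ (M : Type v) [AddCommGroup M] [Module ℂ M]
      (X : VertexAlgebra.TwistedModule ((σ : G) : VertexAlgebra.Aut V) M), X.IsIrreducible →
        (X.restrict G (σ : G).2 (orderOf_coe_pos (σ : G))).IsFiniteSumOfIrreducibles) := by
  open StableFamily.Transport.Scalars in
  refine ⟨fun I _ S => ⟨StableFamily.nonempty_transport S, fun φ =>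
    ⟨φ.nonempty_scalars hcount, fun α => ⟨α.isDualPair hcount hsimple, fun J hJ =>
      ⟨⟨Index.isSimpleModule hcount hsimple, fun p q =>
        ⟨Index.eq_of_equiv hcount hsimple hJ, ?_⟩,
        fun cl => exists_index_equiv hcount hsimple hJ cl.Rep⟩,
      decomposes hcount hsimple hJ, Index.nontrivial_multSpace hcount hsimple,
      Index.isIrreducible_mult hcount hsimple, Index.mult_iso_iff hcount hsimple hJ⟩⟩⟩⟩,
    fun M _ _ X hX => StableFamily.isFiniteSumOfIrreducibles_restrict X hcount hX⟩
  rintro rfl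
  exact ⟨LinearEquiv.refl _ _⟩
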